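/- Let $X$ be a smooth projective Calabi--Yau $3$-fold over $\mathbb{C}$, i.e. a smooth projective variety of dimension $3$ with $K_X\cong\mathcal{O}_X$ and $H^1(\mathcal{O}_X)=0$. Let $\mathrm{Coh}_0(X)$ be the category of coherent sheaves on $X$ with zero-dimensional (or empty) support, and let $$\mathcal{A}_X=\langle \mathcal{O}_X,\ \mathrm{Coh}_0(X)[-1]\rangle_{\mathrm{ex}}\subset D^b(\mathrm{Coh}(X))$$ be the smallest extension-closed (full, isomorphism-closed) subcategory containing $\mathcal{O}_X$ and all $F[-1]$ with $F\in\mathrm{Coh}_0(X)$. This is an abelian category, and each of its objects is isomorphic to a two-term complex $(\mathcal{O}_X^{\oplus r}\xrightarrow{s}F)$ with $r\ge 0$, $F\in\mathrm{Coh}_0(X)$ and $\mathcal{O}_X^{\oplus r}$ in degree $0$; its class is $\mathrm{cl}(E)=(r,\mathrm{length}\,F)\in\Gamma=\mathbb{Z}\oplus\mathbb{Z}$. Put $S_0=(\mathcal{O}_X\to 0)$ and $S_x=(0\to\mathcal{O}_x)$ for a closed point $x\in X$. A stability condition on $\mathcal{A}_X$ is a group homomorphism $Z:\Gamma\to\mathbb{C}$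 such that $Z(E):=Z(\mathrm{cl}(E))$ satisfies $\operatorname{Im}Z(E)>0$ for every nonzero $E\in\mathcal{A}_X$. An object $E\in\mathcal{A}_X$ is $Z$-semistable if $\arg Z(E')\le\arg Z(E)$ for every subobject $0\subsetneq E'\subsetneq E$ in $\mathcal{A}_X$; it is $Z$-stable if $E\ne 0$ and $\arg Z(E')<\arg Z(E)$ for every such $E'$ (so the zero object is semistable but not stable). Let $Z_-,Z_0,Z_+$ be stability conditions on $\mathcal{A}_X$ with $\arg Z_-(1,0)<\arg Z_-(0,1)$, $\arg Z_0(1,0)=\arg Z_0(0,1)$ and $\arg Z_+(1,0)>\arg Z_+(0,1)$. Let $E\in\mathcal{A}_X$. (i) $E$ is $Z_-$-semistable if and only if $E$ is isomorphic to $(\mathcal{O}_X^{\oplus r}\to 0)$ for some $r\ge 0$ or to $(0\to F)$ for some $F\in\mathrm{Coh}_0(X)$. $E$ is $Z_-$-stable if and only if $E$ is isomorphic to $S_0$ or to $S_x$ for some closed point $x\in X$. (ii) $E$ is $Z_0$-semistable. $E$ is $Z_0$-stable if and only if $E$ is isomorphic to $S_0$ or to $S_x$ for some closed point $x\in X$.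 (iii) $E$ is $Z_+$-semistable (resp. $Z_+$-stable) if and only if either $E$ is isomorphic to $(\mathcal{O}_X^{\oplus r}\to 0)$ for some $r\ge0$ or to $(0\to F)$ for some $F\in\mathrm{Coh}_0(X)$ (resp. to $S_0$ or to $S_x$ for some closed point $x\in X$), or $E$ is isomorphic to $(\mathcal{O}_X^{\oplus r}\xrightarrow{s}F)$ with $r>0$ and $0\ne F\in\mathrm{Coh}_0(X)$ satisfying the following two conditions. - The image $V=\operatorname{Im}\{H^0(s):\mathbb{C}^{\oplus r}\to H^0(F)\}$ is $r$-dimensional and generates $F$ as an $\mathcal{O}_X$-module. - For every linear subspace $0\subsetneq W\subsetneq V$, the subsheaf $F_W=\mathcal{O}_X\cdot W\subset F$ satisfies $$\frac{\mathrm{length}\,F_W}{\dim W}\ \ge\ \frac{\mathrm{length}\,F}{r}\qquad\left(\text{resp. }\frac{\mathrm{length}\,F_W}{\dim W}>\frac{\mathrm{length}\,F}{r}\right).$$ -/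

import Mathlib

open CategoryTheory Limits AlgebraicGeometry

universe w

noncomputable section

namespace BoundState

/-! ### Smooth projective Calabi-Yau threefolds over the complex numbers -/

section Geometry

variable {X : Scheme.{0}} (f : X ⟶ Spec (.of ℂ))

/-- The structure homomorphism `ℂ → Γ(X, U)` of a scheme over `ℂ`. -/
def scalars (U : X.Opens) : ℂ →+* Γ(X, U) :=
  ((Scheme.ΓSpecIso (.of ℂ)).inv ≫ f.appTop ≫ X.presheaf.map (homOfLE le_top).op).hom

lemma restrict_comp_scalars {U V : X.Opens} (h : U ≤ V) :
    (X.presheaf.map (homOfLE h).op).hom.comp (scalars f V) = scalars f U := by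
  rw [scalars, scalars, ← CommRingCat.hom_comp, Category.assoc, Category.assoc,
    ← Functor.map_comp]
  rfl

attribute [local instance] MvPolynomial.gradedAlgebra

/-- Projective `n`-space over `ℂ`. -/
abbrev projectiveSpace (n : ℕ) : Scheme.{0} :=
  Proj (MvPolynomial.homogeneousSubmodule (Fin (n + 1)) ℂ)

/-- The structure morphism of projective space. -/
def projectiveSpaceToSpec (n : ℕ) : projectiveSpace n ⟶ Spec (.of ℂ) :=
  Proj.toSpecZero (MvPolynomial.homogeneousSubmodule (Fin (n + 1)) ℂ) ≫
    Spec.map (CommRingCat.ofHom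
      (algebraMap ℂ (MvPolynomial.homogeneousSubmodule (Fin (n + 1)) ℂ 0)))

/-- A scheme over `ℂ` is projective if it is isomorphic, over `ℂ`, to a closed subscheme of some
projective space. -/
def IsProjective : Prop :=
  ∃ (n : ℕ) (i : X ⟶ projectiveSpace n), IsClosedImmersion i ∧ i ≫ projectiveSpaceToSpec n = f

/-- The pullback of Kähler `3`-forms along a homomorphism of `ℂ`-algebras. -/
def threeFormsMap {A B : Type} [CommRing A] [CommRing B] [Algebra ℂ A] [Algebra ℂ B]
    (φ : A →ₐ[ℂ] B) : ⋀[A]^3 (Ω[A⁄ℂ]) → ⋀[B]^3 (Ω[B⁄ℂ]) :=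
  letI : Algebra A B := φ.toRingHom.toAlgebra
  haveI : IsScalarTower ℂ A B := IsScalarTower.of_algebraMap_eq fun x => (φ.commutes x).symm
  exteriorPower.alternatingMapLinearEquiv
    { ((exteriorPower.ιMulti B 3 (M := Ω[B⁄ℂ])).toMultilinearMap.restrictScalars A).compLinearMap
        (fun _ => KaehlerDifferential.map ℂ ℂ A B) with
      map_eq_zero_of_eq' := fun _ _ _ h hij =>
        (exteriorPower.ιMulti B 3 (M := Ω[B⁄ℂ])).map_eq_zero_of_eq _
          (congrArg (KaehlerDifferential.map ℂ ℂ A B) h) hij }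

/-- Triviality of the canonical line bundle `⋀³ Ω_X` of a smooth threefold. The sections of
`⋀³ Ω_X` over an affine open `U` are `⋀³ Ω_{Γ(X, U)/ℂ}`, so an isomorphism of `𝒪_X` with `⋀³ Ω_X`
is a compatible family `ω U` of `3`-forms on the affine opens `U` such that `ω U` is a basis of
the `Γ(X, U)`-module `⋀³ Ω_{Γ(X, U)/ℂ}` for every `U`. -/
def HasTrivialCanonicalBundle : Prop :=
  letI (U : X.Opens) : Algebra ℂ Γ(X, U) := (scalars f U).toAlgebra
  ∃ ω : ∀ U : X.affineOpens, ⋀[Γ(X, U.1)]^3 (Ω[Γ(X, U.1)⁄ℂ]),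
    (∀ U, Function.Bijective fun a : Γ(X, U.1) => a • ω U) ∧
    ∀ (U V : X.affineOpens) (h : U.1 ≤ V.1),
      threeFormsMap
        { (X.presheaf.map (homOfLE h).op).hom with
          commutes' := fun z => DFunLike.congr_fun (restrict_comp_scalars f h) z } (ω V) = ω U

variable (X) in
/-- The structure sheaf `𝒪_X` as a sheaf of modules. -/
def structureSheaf : X.Modules := SheafOfModules.unit X.ringCatSheaf

variable (X) in
/-- The vanishing of the first sheaf cohomology group `H¹(X, 𝒪_X)`. -/
def FirstCohomologyVanishes : Prop :=
  letI : HasExt.{1} (Sheaf (Opens.grothendieckTopology X) AddCommGrpCat.{0}) := HasExt.standard _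
  Subsingleton (Sheaf.H ((SheafOfModules.toSheaf X.ringCatSheaf).obj (structureSheaf X)) 1)

/-- Smooth projective Calabi-Yau threefolds over `ℂ`: smooth projective varieties of dimension `3`
with `K_X ≅ 𝒪_X` and `H¹(𝒪_X) = 0`. -/
structure IsCalabiYauThreefold : Prop where
  isIntegral : IsIntegral X
  smooth : SmoothOfRelativeDimension 3 f
  projective : IsProjective f
  canonical : HasTrivialCanonicalBundle f
  cohomology : FirstCohomologyVanishes X

end Geometry

/-! ### Zero-dimensional coherent sheaves -/

section Sheaves

variable {X : Scheme.{0}}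

variable (X) in
/-- The free sheaf `𝒪_X^{⊕ I}` on a set `I`. -/
def freeOn (I : Type) : X.Modules := SheafOfModules.free (R := X.ringCatSheaf) I

variable (X) in
/-- The free sheaf `𝒪_X^{⊕ r}`. -/
abbrev free (r : ℕ) : X.Modules := freeOn X (Fin r)

/-- The structure sheaf `𝒪_x` of a point `x`: the direct image of the structure sheaf under
`Spec κ(x) ⟶ X`. -/
def pointSheaf (x : X) : X.Modules :=
  (Scheme.Modules.pushforward (X.fromSpecResidueField x)).obj
    (structureSheaf (Spec (X.residueField x)))

/-- The support of a sheaf of modules. -/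
def support (F : X.Modules) : Set X := {x | Nontrivial (F.presheaf.stalk x)}

/-- `F ∈ Coh₀(X)`: a coherent sheaf (on a noetherian scheme: quasi-coherent and of finite type)
whose support has dimension zero (or is empty, for `F = 0`). -/
structure IsCohZero (F : X.Modules) : Prop where
  quasicoherent : SheafOfModules.IsQuasicoherent (R := X.ringCatSheaf) F
  finiteType : SheafOfModules.IsFiniteType (R := X.ringCatSheaf) F
  dim_support : topologicalKrullDim (support F) ≤ 0

/-- The length of a sheaf of modules of finite length: the supremum of the lengths of the strictly
increasing chains of its subobjects. -/
def length (F : X.Modules) : ℕ := (Order.height (⊤ : Subobject F)).toNat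

end Sheaves

/-! ### Global sections and the subsheaves that they generate -/

section Sections

variable {X : Scheme.{0}} (f : X ⟶ Spec (.of ℂ))

/-- The space `H⁰(F)` of global sections of a sheaf of modules on a scheme over `ℂ`. -/
@[nolint unusedArguments]
def H0 (_f : X ⟶ Spec (.of ℂ)) (F : X.Modules) : Type := Γ(F, ⊤)

instance (F : X.Modules) : AddCommGroup (H0 f F) := inferInstanceAs (AddCommGroup Γ(F, ⊤))

instance (F : X.Modules) : Module Γ(X, ⊤) (H0 f F) := inferInstanceAs (Module Γ(X, ⊤) Γ(F, ⊤))

instance (F : X.Modules) : Module ℂ (H0 f F) := Module.compHom _ (scalars f ⊤)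

/-- The `ℂ`-linear map `H⁰(s)` induced by a morphism `s` of sheaves of modules. -/
def H0map {F G : X.Modules} (s : F ⟶ G) : H0 f F →ₗ[ℂ] H0 f G where
  toFun v := s.app ⊤ v
  map_add' v w := map_add (s.app ⊤).hom v w
  map_smul' z v := s.app_smul (scalars f ⊤ z) v

variable {f} in
/-- A global section as a compatible family of sections over all open sets. -/
def toSections {F : X.Modules} (v : H0 f F) :
    SheafOfModules.sections (R := X.ringCatSheaf) F :=
  PresheafOfModules.sectionsMk
    (fun U => F.presheaf.map (homOfLE (le_top : U.unop ≤ ⊤)).op v)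
    (fun U V g => by
      have h := F.presheaf.map_comp (homOfLE (le_top : U.unop ≤ ⊤)).op g
      exact (congrArg (fun φ => φ.hom (v : Γ(F, ⊤))) h).symm)

variable {f} in
/-- The morphism from the free sheaf on a linear subspace `W` of `H⁰(F)` to `F` that sends the
basis element `w` to the section `w`. -/
def evaluation {F : X.Modules} (W : Submodule ℂ (H0 f F)) : freeOn X W ⟶ F :=
  (SheafOfModules.freeHomEquiv (R := X.ringCatSheaf) F).symm fun v => toSections v.1

variable {f} in
/-- The subsheaf `𝒪_X · W ⊆ F` generated by a linear subspace `W` of `H⁰(F)`. -/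
def generated {F : X.Modules} (W : Submodule ℂ (H0 f F)) : Subobject F :=
  imageSubobject (evaluation W)

/-- The subspace `V = Im (H⁰(s))` of `H⁰(F)` attached to `s : 𝒪_X^{⊕ r} ⟶ F`. -/
def imageSections {r : ℕ} {F : X.Modules} (s : free X r ⟶ F) : Submodule ℂ (H0 f F) :=
  LinearMap.range (H0map f s)

/-- `V = Im (H⁰(s))` is `r`-dimensional and generates `F`, and every subspace `0 ⊊ W ⊊ V`
satisfies `length (𝒪_X · W) / dim W ≥ length F / r`. -/
structure IsSemistablePair {r : ℕ} {F : X.Modules} (s : free X r ⟶ F) : Prop where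
  finrank_eq : Module.finrank ℂ (imageSections f s) = r
  generated_eq : generated (imageSections f s) = ⊤
  le_slope : ∀ W : Submodule ℂ (H0 f F), ⊥ < W → W < imageSections f s →
    (length F : ℚ) / r ≤ (length (generated W : X.Modules) : ℚ) / Module.finrank ℂ W

/-- `V = Im (H⁰(s))` is `r`-dimensional and generates `F`, and every subspace `0 ⊊ W ⊊ V`
satisfies `length (𝒪_X · W) / dim W > length F / r`. -/
structure IsStablePair {r : ℕ} {F : X.Modules} (s : free X r ⟶ F) : Prop where
  finrank_eq : Module.finrank ℂ (imageSections f s) = r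
  generated_eq : generated (imageSections f s) = ⊤
  lt_slope : ∀ W : Submodule ℂ (H0 f F), ⊥ < W → W < imageSections f s →
    (length F : ℚ) / r < (length (generated W : X.Modules) : ℚ) / Module.finrank ℂ W

end Sections

/-! ### The heart `𝒜_X` -/

section Heart

variable {X : Scheme.{0}} [HasDerivedCategory.{w} X.Modules]

/-- The two-term complex `⋯ ⟶ 0 ⟶ A ⟶ B ⟶ 0 ⟶ ⋯`, with `A` in degree `0` and `B` in degree `1`,
as an object of the derived category. -/
def twoTerm {A B : X.Modules} (s : A ⟶ B) : DerivedCategory X.Modules :=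
  DerivedCategory.Q.obj
    (HomologicalComplex.double s (show (ComplexShape.up ℤ).Rel 0 1 from rfl))

variable (X) in
/-- The extension closure `⟨𝒪_X, Coh₀(X)[-1]⟩`: the smallest class of objects of the derived
category that is closed under isomorphisms and extensions and contains `𝒪_X` and `F[-1]` for
`F ∈ Coh₀(X)`. The ambient category is the derived category of all sheaves of modules, in which
`D^b(Coh(X))` (for `X` noetherian) is the full triangulated subcategory of the complexes with
bounded coherent cohomology; it contains the generators, hence the whole extension closure. -/
inductive heart : ObjectProperty (DerivedCategory X.Modules)
  | structureSheaf : heart ((DerivedCategory.singleFunctor X.Modules 0).obj (structureSheaf X))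
  | shift (F : X.Modules) (hF : IsCohZero F) :
      heart (((DerivedCategory.singleFunctor X.Modules 0).obj F)⟦(-1 : ℤ)⟧)
  | of_iso {E E' : DerivedCategory X.Modules} (e : E ≅ E') (hE : heart E) : heart E'
  | extension (T : Pretriangulated.Triangle (DerivedCategory X.Modules))
      (hT : T ∈ Pretriangulated.distinguishedTriangles) (h₁ : heart T.obj₁) (h₃ : heart T.obj₃) :
      heart T.obj₂

variable (X) in
/-- The category `𝒜_X`, a full subcategory of the derived category. -/
abbrev Heart := (heart X).FullSubcategory

/-- The object `E` is isomorphic to a two-term complex `𝒪_X^{⊕ r} ⟶ F` with `F ∈ Coh₀(X)` and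
`(r, length F) = c`. -/
def HasClass (E : Heart X) (c : ℤ × ℤ) : Prop :=
  ∃ (r : ℕ) (F : X.Modules) (s : free X r ⟶ F), IsCohZero F ∧
    Nonempty (E.obj ≅ twoTerm s) ∧ c = ((r : ℤ), (length F : ℤ))

open scoped Classical in
/-- The class `cl(E) ∈ Γ = ℤ ⊕ ℤ`, equal to `(r, length F)` if `E ≅ (𝒪_X^{⊕ r} ⟶ F)`. On a
Calabi-Yau threefold every object of `𝒜_X` is of this form, and the pair does not depend on the
choice of the complex. -/
def cl (E : Heart X) : ℤ × ℤ :=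
  if h : ∃ c, HasClass E c then h.choose else 0

variable (X) in
/-- A stability condition on `𝒜_X`: a group homomorphism `Z : Γ → ℂ` that sends the class of every
nonzero object to the open upper half plane. -/
def IsStabilityCondition (Z : ℤ × ℤ →+ ℂ) : Prop :=
  ∀ E : Heart X, ¬ IsZero E → 0 < (Z (cl E)).im

/-- `E` is `Z`-semistable: `arg Z(E') ≤ arg Z(E)` for all subobjects `0 ⊊ E' ⊊ E` in `𝒜_X`. -/
def IsSemistable (Z : ℤ × ℤ →+ ℂ) (E : Heart X) : Prop :=
  ∀ (E' : Heart X) (i : E' ⟶ E), Mono i → ¬ IsZero E' → ¬ IsIso i →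
    Complex.arg (Z (cl E')) ≤ Complex.arg (Z (cl E))

/-- `E` is `Z`-stable: it is nonzero, and `arg Z(E') < arg Z(E)` for all subobjects
`0 ⊊ E' ⊊ E` in `𝒜_X`. -/
def IsStable (Z : ℤ × ℤ →+ ℂ) (E : Heart X) : Prop :=
  ¬ IsZero E ∧ ∀ (E' : Heart X) (i : E' ⟶ E), Mono i → ¬ IsZero E' → ¬ IsIso i →
    Complex.arg (Z (cl E')) < Complex.arg (Z (cl E))

open scoped ZeroObject in
/-- `E` is isomorphic to `(𝒪_X^{⊕ r} ⟶ 0)` or to `(0 ⟶ F)` with `F ∈ Coh₀(X)`. -/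
def IsPure (E : Heart X) : Prop :=
  (∃ r : ℕ, Nonempty (E.obj ≅ twoTerm (0 : free X r ⟶ 0))) ∨
    ∃ F : X.Modules, IsCohZero F ∧ Nonempty (E.obj ≅ twoTerm (0 : 0 ⟶ F))

open scoped ZeroObject in
/-- `E` is isomorphic to `S₀ = (𝒪_X ⟶ 0)` or to `S_x = (0 ⟶ 𝒪_x)` for a closed point `x`. -/
def IsSimplePure (E : Heart X) : Prop :=
  Nonempty (E.obj ≅ twoTerm (0 : structureSheaf X ⟶ 0)) ∨
    ∃ x : X, IsClosed {x} ∧ Nonempty (E.obj ≅ twoTerm (0 : 0 ⟶ pointSheaf x))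

end Heart

end BoundState

end

/-!
A complex `𝒪_X^{⊕ r} ⟶ F` is governed by its subobjects, and these are governed by linear algebra on
global sections. The proof makes both points precise.

Sheaves in `Coh₀(X)` are those with finitely many closed points in their support and stalks of
finite length (`isCohZero_iff`), so they are iterated extensions of sheaves `𝒪_x`. Since `X` is
smooth of dimension `3`, the maximal ideal of the local ring at a closed point `x` contains a
regular sequence of length `3` (`exists_isRegularTriple_stalk`). Hence `Hom(𝒪_x, 𝒪_X)`, `Ext¹(𝒪_x,
𝒪_X)` and `Ext²(𝒪_x, 𝒪_X)` vanish (`IsCalabiYauThreefold.ext_pointSheaf_eq_zero`): the first two by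
a computation with one lift of the generator of `𝒪_x`, the third because the sheaf `K` of rational
functions is injective, so that it is `Ext¹(𝒪_x, K / 𝒪_X)`, which a similar computation shows to be
zero. On the other hand `Ext¹(𝒪_X, 𝒪_X) = H¹(𝒪_X) = 0`.

With `Ext¹(𝒪_X, 𝒪_X) = 0` and `Ext²(F, 𝒪_X) = 0`, the two-term complexes `A ⟶ F` with `A` free and
`F ∈ Coh₀(X)` are closed under extensions, so they make up `𝒜_X` (`heart_le`). With `Hom(F, 𝒪_X) =
0` and `Ext¹(F, 𝒪_X) = 0`, morphisms between them are commutative squares. Therefore `𝒜_X` is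
equivalent to the category of these pairs (`isEquivalence_pairToHeart`). Its monomorphisms are the
squares of monomorphisms, the class of an object is well defined, and a condition on the classes of
proper subobjects in `𝒜_X` becomes a condition on pairs (`forall_subobject_iff`).

Since `H⁰(𝒪_X) = ℂ`, monomorphisms `𝒪_X^{⊕ k} ⟶ 𝒪_X^{⊕ r}` are `k`-dimensional subspaces `U` of
`ℂ^r`, and the smallest `F'` for which such a monomorphism underlies a subobject `𝒪_X^{⊕ k} ⟶ F'` is
the subsheaf generated by the image of `U` in `H⁰(F)`. Phases of `Z` are compared by the sign of a
determinant (`arg_apply_lt_iff`), which is the determinant of the two classes up to a constant whose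
sign is given by the order of the phases at the basis vectors. If the constant is zero, all phases
agree, and the stable objects are those without proper subobjects. If `F[-1]` has the larger phase,
it destabilizes every object of mixed class. If `𝒪_X` has the larger phase, semistability says `k *
length F ≤ r * length F'` for all proper subobjects, and on the smallest choices of `F'` these
inequalities are the conditions on the subspaces of `V` (`isSemistablePair_iff`,
`isStablePair_iff`).
-/

noncomputable section

namespace BoundState

/-! ### Two-term complexes -/

section TwoTerm
open Pretriangulated HomologicalComplex DerivedCategory
universe v u

variable {C : Type u} [Category.{v} C] [Abelian C]

lemma rel_zero_one : (ComplexShape.up ℤ).Rel 0 1 := rfl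

/-- The two-term cochain complex `A ⟶ B` in degrees `0` and `1`. -/
abbrev pairComplex {A B : C} (s : A ⟶ B) : CochainComplex C ℤ := double s rel_zero_one

/-- The inclusion of `B[-1]` into the complex `A ⟶ B`. -/
def pairIncl {A B : C} (s : A ⟶ B) :
    (single C (ComplexShape.up ℤ) 1).obj B ⟶ pairComplex s :=
  mkHomFromSingle (doubleXIso₁ s rel_zero_one zero_ne_one).inv fun k _ => by
    rw [double_d_eq_zero₀ _ _ _ _ one_ne_zero, comp_zero]

/-- The projection of the complex `A ⟶ B` onto `A`. -/
def pairProj {A B : C} (s : A ⟶ B) :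
    pairComplex s ⟶ (single C (ComplexShape.up ℤ) 0).obj A :=
  mkHomToSingle (doubleXIso₀ s rel_zero_one).hom fun k _ => by
    rw [double_d_eq_zero₁ _ _ _ _ zero_ne_one, zero_comp]

/-- The morphism of two-term complexes given by a commutative square. -/
def pairMap {A B A' B' : C} {s : A ⟶ B} {s' : A' ⟶ B'} (b : A ⟶ A') (a : B ⟶ B')
    (h : s ≫ a = b ≫ s') : pairComplex s ⟶ pairComplex s' :=
  mkHomFromDouble rel_zero_one zero_ne_one (b ≫ (doubleXIso₀ s' rel_zero_one).inv)
    (a ≫ (doubleXIso₁ s' rel_zero_one zero_ne_one).inv)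
    (by rw [double_d _ _ zero_ne_one]; simp [reassoc_of% h])
    (fun k _ => by rw [double_d_eq_zero₀ _ _ _ _ one_ne_zero, comp_zero])

/-- The short exact sequence `0 ⟶ B[-1] ⟶ (A ⟶ B) ⟶ A ⟶ 0` of complexes. -/
abbrev pairShortComplex {A B : C} (s : A ⟶ B) : ShortComplex (CochainComplex C ℤ) :=
  ShortComplex.mk (pairIncl s) (pairProj s) (by
    refine hom_ext _ _ fun k => ?_
    by_cases hk : k = 1
    · subst hk
      exact (isZero_single_obj_X _ _ _ _ one_ne_zero).eq_of_tgt _ _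
    · exact (isZero_single_obj_X _ _ _ _ hk).eq_of_src _ _)

lemma pairShortComplex_shortExact {A B : C} (s : A ⟶ B) : (pairShortComplex s).ShortExact := by
  have z₁ (k : ℤ) (h : k ≠ 1) : IsZero (((pairShortComplex s).map (eval _ _ k)).X₁) :=
    isZero_single_obj_X (ComplexShape.up ℤ) 1 B k h
  have z₃ (k : ℤ) (h : k ≠ 0) : IsZero (((pairShortComplex s).map (eval _ _ k)).X₃) :=
    isZero_single_obj_X (ComplexShape.up ℤ) 0 A k h
  refine shortExact_of_degreewise_shortExact _ fun k => ?_
  by_cases h0 : k = 0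
  · subst h0
    have : IsIso (((pairShortComplex s).map (eval _ _ 0)).g) := by
      change IsIso ((pairProj s).f 0)
      rw [pairProj, mkHomToSingle_f]; infer_instance
    refine ShortComplex.ShortExact.mk' ?_ ?_ inferInstance
    · rw [ShortComplex.exact_iff_mono _ ((z₁ 0 zero_ne_one).eq_of_src _ _)]
      infer_instance
    · exact ⟨fun _ _ _ => (z₁ 0 zero_ne_one).eq_of_tgt _ _⟩
  by_cases h1 : k = 1
  · subst h1
    have : IsIso (((pairShortComplex s).map (eval _ _ 1)).f) := by
      change IsIso ((pairIncl s).f 1)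
      rw [pairIncl, mkHomFromSingle_f]; infer_instance
    refine ShortComplex.ShortExact.mk' ?_ inferInstance ?_
    · rw [ShortComplex.exact_iff_epi _ ((z₃ 1 one_ne_zero).eq_of_tgt _ _)]
      infer_instance
    · exact ⟨fun _ _ _ => (z₃ 1 one_ne_zero).eq_of_src _ _⟩
  · have hz := isZero_double_X s rel_zero_one k h0 h1
    refine ShortComplex.ShortExact.mk' ?_ ?_ ?_
    · exact ShortComplex.exact_of_isZero_X₂ _ hz
    · exact ⟨fun _ _ _ => (z₁ k h1).eq_of_tgt _ _⟩
    · exact ⟨fun _ _ _ => (z₃ k h0).eq_of_src _ _⟩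

/-- The morphism of short exact sequences induced by a commutative square. -/
def pairShortComplexMap {A B A' B' : C} {s : A ⟶ B} {s' : A' ⟶ B'} (b : A ⟶ A') (a : B ⟶ B')
    (h : s ≫ a = b ≫ s') : pairShortComplex s ⟶ pairShortComplex s' where
  τ₁ := (single C _ 1).map a
  τ₂ := pairMap b a h
  τ₃ := (single C _ 0).map b
  comm₁₂ := by
    apply from_single_hom_ext
    dsimp
    rw [single_map_f_self, pairIncl, pairIncl, mkHomFromSingle_f, mkHomFromSingle_f, pairMap,
      mkHomFromDouble_f₁]
    simp
  comm₂₃ := by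
    apply to_single_hom_ext
    dsimp
    rw [single_map_f_self, pairProj, pairProj, mkHomToSingle_f, mkHomToSingle_f, pairMap,
      mkHomFromDouble_f₀]
    simp

/-- The complex `𝟙 : A ⟶ A` is contractible. -/
def pairComplexIdHomotopy (A : C) :
    Homotopy (𝟙 (pairComplex (𝟙 A))) 0 := by
  classical
  refine (Homotopy.ofEq ?_).trans (Homotopy.nullHomotopy' (fun i j _ =>
    if h : i = 1 ∧ j = 0 then
      eqToHom (by rw [h.1]) ≫ (doubleXIso₁ (𝟙 A) rel_zero_one zero_ne_one).hom ≫
        (doubleXIso₀ (𝟙 A) rel_zero_one).inv ≫ eqToHom (by rw [h.2]) else 0))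
  apply from_double_hom_ext
  · rw [Homotopy.nullHomotopicMap'_f (k₂ := -1) (k₁ := 0) (k₀ := 1) rfl rfl,
      double_d _ _ zero_ne_one]
    simp
  · rw [Homotopy.nullHomotopicMap'_f (k₂ := 0) (k₁ := 1) (k₀ := 2) rfl rfl,
      double_d _ _ zero_ne_one]
    simp

variable [HasDerivedCategory.{w} C]

/-- The two-term complex `A ⟶ B` in degrees `0` and `1`, as an object of the derived category. -/
abbrev pairObj {A B : C} (s : A ⟶ B) : DerivedCategory C := Q.obj (pairComplex s)

/-- The complex `A ⟶ A` with differential the identity is contractible. -/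
lemma isZero_pairObj_id (A : C) : IsZero (pairObj (𝟙 A)) := by
  rw [IsZero.iff_id_eq_zero, ← CategoryTheory.Functor.map_id,
    Q_map_eq_of_homotopy _ (pairComplexIdHomotopy A), Functor.map_zero]

/-- The isomorphism `B[-1][1] ≅ B`. -/
def singleOneShiftIso (B : C) :
    ((singleFunctor C 1).obj B)⟦(1 : ℤ)⟧ ≅ (singleFunctor C 0).obj B :=
  ((singleFunctors C).shiftIso 1 0 1 rfl).app B

lemma singleOneShiftIso_naturality {A B : C} (s : A ⟶ B) :
    ((singleFunctor C 1).map s)⟦(1 : ℤ)⟧' ≫ (singleOneShiftIso B).hom =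
      (singleOneShiftIso A).hom ≫ (singleFunctor C 0).map s :=
  ((singleFunctors C).shiftIso 1 0 1 rfl).hom.naturality s

/-- The inclusion of `B[-1]` into the complex `A ⟶ B`, in the derived category. -/
def pairInclQ {A B : C} (s : A ⟶ B) : (singleFunctor C 1).obj B ⟶ pairObj s := Q.map (pairIncl s)

/-- The projection of the complex `A ⟶ B` onto `A`, in the derived category. -/
def pairProjQ {A B : C} (s : A ⟶ B) : pairObj s ⟶ (singleFunctor C 0).obj A := Q.map (pairProj s)

/-- The connecting morphism `A ⟶ B[-1][1]` of the complex `A ⟶ B`. -/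
def pairδ {A B : C} (s : A ⟶ B) :
    (singleFunctor C 0).obj A ⟶ ((singleFunctor C 1).obj B)⟦(1 : ℤ)⟧ :=
  triangleOfSESδ (pairShortComplex_shortExact s)

/-- The triangle of the stupid filtration `B[-1] ⟶ (A ⟶ B) ⟶ A` of a two-term complex. -/
lemma pair_stupid_distinguished {A B : C} (s : A ⟶ B) :
    Triangle.mk (pairInclQ s) (pairProjQ s) (pairδ s) ∈ distTriang (DerivedCategory C) :=
  triangleOfSES_distinguished (pairShortComplex_shortExact s)

lemma pairδ_naturality {A B : C} (s : A ⟶ B) :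
    pairδ (𝟙 A) ≫ ((singleFunctor C 1).map s)⟦(1 : ℤ)⟧' = pairδ s := by
  have h : pairδ (𝟙 A) ≫ ((singleFunctor C 1).map s)⟦(1 : ℤ)⟧' =
      (singleFunctor C 0).map (𝟙 A) ≫ pairδ s :=
    triangleOfSESδ_naturality (pairShortComplex_shortExact (𝟙 A))
      (pairShortComplex_shortExact s) (pairShortComplexMap (𝟙 A) s rfl)
  rw [h, CategoryTheory.Functor.map_id, Category.id_comp]

/-- The connecting morphism `A ⟶ B` of the complex `A ⟶ B`; up to an automorphism of `A` it is the
differential. -/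
def pairConn {A B : C} (s : A ⟶ B) : (singleFunctor C 0).obj A ⟶ (singleFunctor C 0).obj B :=
  pairδ s ≫ (singleOneShiftIso B).hom

/-- The cone of the identity vanishes, so the connecting morphism of `A ⟶ A` is invertible. Together
with `pairConn_naturality` this identifies connecting morphisms and differentials without a
computation of signs. -/
instance isIso_pairConn_id (A : C) : IsIso (pairConn (𝟙 A)) := by
  have : IsIso (pairδ (𝟙 A)) :=
    (Triangle.isZero₂_iff_isIso₃ _ (pair_stupid_distinguished (𝟙 A))).1 (isZero_pairObj_id A)
  rw [pairConn]
  infer_instance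

lemma pairConn_naturality {A B : C} (s : A ⟶ B) :
    pairConn s = pairConn (𝟙 A) ≫ (singleFunctor C 0).map s := by
  rw [pairConn, pairConn, ← pairδ_naturality s, Category.assoc, Category.assoc,
    singleOneShiftIso_naturality]

end TwoTerm

/-! ### Extensions in the derived category -/

section TwoTermMaps
open Pretriangulated HomologicalComplex DerivedCategory
universe v u

variable {C : Type u} [Category.{v} C] [Abelian C] [HasDerivedCategory.{w} C]

lemma single_hom_eq_zero {A B : C} {m n : ℤ} (h : m < n)
    (g : (singleFunctor C m).obj A ⟶ (singleFunctor C n).obj B) : g = 0 :=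
  TStructure.t.zero g m n h

lemma single_shift_hom_eq_zero {A B : C} {n : ℤ}
    (g : ((singleFunctor C n).obj A)⟦(1 : ℤ)⟧ ⟶ (singleFunctor C n).obj B) : g = 0 := by
  have := TStructure.t.isLE_shift ((singleFunctor C n).obj A) n 1 (n - 1)
  exact TStructure.t.zero g (n - 1) n

lemma single_hom_shift_neg_eq_zero {A B : C} {n : ℤ}
    (g : ((singleFunctor C n).obj A) ⟶ ((singleFunctor C n).obj B)⟦(-1 : ℤ)⟧) : g = 0 := by
  have := TStructure.t.isGE_shift ((singleFunctor C n).obj B) n (-1) (n + 1)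
  exact TStructure.t.zero g n (n + 1)

section Unbundled
variable {X Y Z W : DerivedCategory C} {f : X ⟶ Y} {g : Y ⟶ Z} {h : Z ⟶ X⟦(1 : ℤ)⟧}
  (hT : Triangle.mk f g h ∈ distTriang (DerivedCategory C))
include hT

lemma exists_eq_comp_mor₁ (k : W ⟶ Y) (hk : k ≫ g = 0) : ∃ l : W ⟶ X, k = l ≫ f :=
  Triangle.coyoneda_exact₂ _ hT k hk

lemma exists_eq_mor₂_comp (k : Y ⟶ W) (hk : f ≫ k = 0) : ∃ l : Z ⟶ W, k = g ≫ l :=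
  Triangle.yoneda_exact₂ _ hT k hk

lemma exists_eq_mor₃_comp (k : Z ⟶ W) (hk : g ≫ k = 0) : ∃ l : X⟦(1 : ℤ)⟧ ⟶ W, k = h ≫ l :=
  Triangle.yoneda_exact₃ _ hT k hk

lemma eq_zero_of_comp_mor₁ (h0 : ∀ l : W ⟶ Z⟦(-1 : ℤ)⟧, l = 0) (k : W ⟶ X) (hk : k ≫ f = 0) :
    k = 0 := by
  obtain ⟨m, hm⟩ := Triangle.coyoneda_exact₂ _ (inv_rot_of_distTriang _ hT) k hk
  exact hm.trans (by rw [show m = 0 from h0 m]; exact zero_comp)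

end Unbundled

/-- A triangle whose outer terms are objects of `C` in degree `n` comes from a short exact
sequence in `C`. -/
lemma exists_shortExact_of_distinguished {n : ℤ} {G F : C} {E : DerivedCategory C}
    (i : (singleFunctor C n).obj G ⟶ E) (p : E ⟶ (singleFunctor C n).obj F)
    (h : (singleFunctor C n).obj F ⟶ ((singleFunctor C n).obj G)⟦(1 : ℤ)⟧)
    (hT : Triangle.mk i p h ∈ distTriang (DerivedCategory C)) :
    ∃ (S : ShortComplex C) (_ : S.ShortExact) (_ : S.X₁ = G) (e₃ : S.X₃ = F)
      (e : E ≅ (singleFunctor C n).obj S.X₂),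
      p = e.hom ≫ (singleFunctor C n).map (S.g ≫ eqToHom e₃) := by
  have : E.IsLE n := TStructure.t.isLE₂ _ hT n
    (inferInstanceAs (((singleFunctor C n).obj G).IsLE n))
    (inferInstanceAs (((singleFunctor C n).obj F).IsLE n))
  have : E.IsGE n := TStructure.t.isGE₂ _ hT n
    (inferInstanceAs (((singleFunctor C n).obj G).IsGE n))
    (inferInstanceAs (((singleFunctor C n).obj F).IsGE n))
  obtain ⟨M, ⟨e⟩⟩ := exists_iso_singleFunctor_obj_of_isGE_of_isLE E n
  obtain ⟨f, hf⟩ := (singleFunctor C n).map_surjective (i ≫ e.hom)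
  obtain ⟨g, hg⟩ := (singleFunctor C n).map_surjective (e.inv ≫ p)
  have hT' : Triangle.mk ((singleFunctor C n).map f) ((singleFunctor C n).map g) h ∈
      distTriang (DerivedCategory C) := by
    refine isomorphic_distinguished _ hT _ (Triangle.isoMk _ _ (Iso.refl _) e.symm (Iso.refl _)
      ?_ ?_ ?_)
    · change (singleFunctor C n).map f ≫ e.inv = 𝟙 _ ≫ i
      simp [hf]
    · change (singleFunctor C n).map g ≫ 𝟙 _ = e.inv ≫ p
      simp [hg]
    · change h ≫ (𝟙 _)⟦(1 : ℤ)⟧' = 𝟙 _ ≫ h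
      rw [CategoryTheory.Functor.map_id]; simp
  have hfg : f ≫ g = 0 := by
    apply (singleFunctor C n).map_injective
    rw [Functor.map_comp, Functor.map_zero]
    exact comp_distTriang_mor_zero₁₂ _ hT'
  have hm : Mono f := by
    refine Preadditive.mono_of_cancel_zero _ fun {T} k hk => ?_
    apply (singleFunctor C n).map_injective
    have h1 : (singleFunctor C n).map k ≫ (singleFunctor C n).map f = 0 := by
      rw [← Functor.map_comp, hk, Functor.map_zero]
    rw [Functor.map_zero]
    exact eq_zero_of_comp_mor₁ hT' single_hom_shift_neg_eq_zero _ h1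
  have he : Epi g := by
    refine Preadditive.epi_of_cancel_zero _ fun {T} k hk => ?_
    apply (singleFunctor C n).map_injective
    have h1 : (singleFunctor C n).map g ≫ (singleFunctor C n).map k = 0 := by
      rw [← Functor.map_comp, hk, Functor.map_zero]
    obtain ⟨m, hm⟩ := exists_eq_mor₃_comp hT' _ h1
    rw [hm, Functor.map_zero, single_shift_hom_eq_zero m, comp_zero]
  refine ⟨ShortComplex.mk f g hfg, ?_, rfl, rfl, e, by simp [hg]⟩
  refine ShortComplex.ShortExact.mk' ?_ hm he
  refine ShortComplex.exact_of_f_is_kernel _ (KernelFork.IsLimit.ofι' f hfg fun {T} k hk => ?_)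
  have h1 : (singleFunctor C n).map k ≫ (singleFunctor C n).map g = 0 := by
    rw [← Functor.map_comp, hk, Functor.map_zero]
  have h2 := exists_eq_comp_mor₁ hT' _ h1
  refine ⟨(singleFunctor C n).preimage h2.choose, ?_⟩
  apply (singleFunctor C n).map_injective
  rw [Functor.map_comp, Functor.map_preimage]
  exact h2.choose_spec.symm

/-- If all extensions of `F` by `G` split, then `Ext¹(F, G) = 0`. -/
lemma hom_shift_one_eq_zero {F G : C}
    (H : ∀ (S : ShortComplex C) (_ : S.ShortExact), S.X₁ = G → S.X₃ = F → IsSplitEpi S.g)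
    (h : (singleFunctor C 0).obj F ⟶ ((singleFunctor C 0).obj G)⟦(1 : ℤ)⟧) : h = 0 := by
  obtain ⟨E, i, p, hT⟩ := distinguished_cocone_triangle₂ h
  obtain ⟨S, hS, rfl, rfl, e, he⟩ := exists_shortExact_of_distinguished i p h hT
  have := H S hS rfl rfl
  have h0 : p ≫ h = 0 := comp_distTriang_mor_zero₂₃ _ hT
  have : (e.inv ≫ p) ≫ h = 0 := by rw [Category.assoc, h0, comp_zero]
  rw [he] at this
  simp only [eqToHom_refl, Category.comp_id, Iso.inv_hom_id_assoc] at this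
  exact (cancel_epi _).1 (this.trans comp_zero.symm)

/-! ### Morphisms of two-term complexes -/

/-- The connecting morphism is natural in the term of degree `0`; `pairδ_naturality` is its
naturality in the term of degree `1`. -/
lemma singleδ_naturality {A B A' : C} (b : A' ⟶ A) (s : A ⟶ B) :
    (singleFunctor C 0).map b ≫ pairδ s = pairδ (b ≫ s) := by
  have h : pairδ (b ≫ s) ≫ ((singleFunctor C 1).map (𝟙 B))⟦(1 : ℤ)⟧' =
      (singleFunctor C 0).map b ≫ pairδ s :=
    triangleOfSESδ_naturality (pairShortComplex_shortExact (b ≫ s))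
      (pairShortComplex_shortExact s) (pairShortComplexMap b (𝟙 B) (Category.comp_id _))
  rw [← h, CategoryTheory.Functor.map_id, CategoryTheory.Functor.map_id, Category.comp_id]

/-- Two-term complexes, as a functor on the category of arrows. -/
def pairFunctor : Arrow C ⥤ CochainComplex C ℤ where
  obj s := pairComplex s.hom
  map {s s'} φ := pairMap φ.left φ.right φ.w.symm
  map_id s := by
    apply from_double_hom_ext
    · rw [pairMap, mkHomFromDouble_f₀]; simp
    · rw [pairMap, mkHomFromDouble_f₁]; simp
  map_comp φ ψ := by
    apply from_double_hom_ext
    · rw [HomologicalComplex.comp_f, pairMap, pairMap, pairMap, mkHomFromDouble_f₀,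
        mkHomFromDouble_f₀, mkHomFromDouble_f₀]; simp
    · rw [HomologicalComplex.comp_f, pairMap, pairMap, pairMap, mkHomFromDouble_f₁,
        mkHomFromDouble_f₁, mkHomFromDouble_f₁]; simp

variable (C) in
/-- Two-term complexes as objects of the derived category. -/
def pairFunctorQ : Arrow C ⥤ DerivedCategory C := pairFunctor ⋙ Q

/-- The morphism of two-term complexes induced by a morphism of arrows, in the derived category. -/
def pairQMap {s s' : Arrow C} (φ : s ⟶ s') : pairObj s.hom ⟶ pairObj s'.hom :=
  (pairFunctorQ C).map φ

lemma pairInclQ_naturality {s s' : Arrow C} (φ : s ⟶ s') :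
    pairInclQ s.hom ≫ pairQMap φ =
      (singleFunctor C 1).map φ.right ≫ pairInclQ s'.hom :=
  (Q.map_comp _ _).symm.trans ((congrArg Q.map
    (pairShortComplexMap φ.left φ.right φ.w.symm).comm₁₂.symm).trans (Q.map_comp _ _))

lemma pairProjQ_naturality {s s' : Arrow C} (φ : s ⟶ s') :
    pairQMap φ ≫ pairProjQ s'.hom =
      pairProjQ s.hom ≫ (singleFunctor C 0).map φ.left :=
  (Q.map_comp _ _).symm.trans ((congrArg Q.map
    (pairShortComplexMap φ.left φ.right φ.w.symm).comm₂₃).trans (Q.map_comp _ _))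

lemma pairδ_injective {A B : C} {s s' : A ⟶ B} (h : pairδ s = pairδ s') : s = s' := by
  have : pairConn s = pairConn s' := by rw [pairConn, pairConn, h]
  rw [pairConn_naturality s, pairConn_naturality s'] at this
  exact (singleFunctor C 0).map_injective ((cancel_epi _).1 this)

/-- Every morphism `A ⟶ B[-1][1]` in the derived category is the connecting morphism of a two-term
complex. -/
lemma pairδ_surjective {A B : C}
    (h : (singleFunctor C 0).obj A ⟶ ((singleFunctor C 1).obj B)⟦(1 : ℤ)⟧) :
    ∃ s : A ⟶ B, pairδ s = h := by
  obtain ⟨s, hs⟩ := (singleFunctor C 0).map_surjective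
    (inv (pairConn (𝟙 A)) ≫ h ≫ (singleOneShiftIso B).hom)
  refine ⟨s, (cancel_mono (singleOneShiftIso B).hom).1 ?_⟩
  change pairConn s = _
  rw [pairConn_naturality, hs, IsIso.hom_inv_id_assoc]

section
variable {s s' : Arrow C} (h0 : ∀ g : s.right ⟶ s'.left, g = 0)
  (h1 : ∀ g : (singleFunctor C 0).obj s.right ⟶ ((singleFunctor C 0).obj s'.left)⟦(1 : ℤ)⟧, g = 0)
include h0 in
lemma single_one_shift_hom_eq_zero (g : ((singleFunctor C 1).obj s.right)⟦(1 : ℤ)⟧ ⟶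
    (singleFunctor C 0).obj s'.left) : g = 0 := by
  rw [← cancel_epi (singleOneShiftIso s.right).inv, comp_zero]
  obtain ⟨k, hk⟩ := (singleFunctor C 0).map_surjective ((singleOneShiftIso s.right).inv ≫ g)
  rw [← hk, h0 k, Functor.map_zero]

include h1 in
lemma single_one_hom_eq_zero (g : (singleFunctor C 1).obj s.right ⟶
    (singleFunctor C 0).obj s'.left) : g = 0 := by
  apply (shiftFunctor (DerivedCategory C) (1 : ℤ)).map_injective
  rw [Functor.map_zero, ← cancel_epi (singleOneShiftIso s.right).inv, comp_zero]
  exact h1 _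

include h0 in
/-- Morphisms `(A ⟶ B) ⟶ (A' ⟶ B')` of two-term complexes are determined by their images in the
derived category if `Hom(B, A') = 0`: if the images of two morphisms agree, the difference in each
degree factors through a morphism `B ⟶ A'`. -/
lemma pairFunctorQ_map_injective :
    Function.Injective ((pairFunctorQ C).map : (s ⟶ s') → _) := by
  intro φ ψ h
  replace h : pairQMap φ = pairQMap ψ := h
  refine Arrow.hom_ext _ _ ?_ ?_
  · apply (singleFunctor C 0).map_injective
    rw [← sub_eq_zero]
    have h1 : pairProjQ s.hom ≫ ((singleFunctor C 0).map φ.left - (singleFunctor C 0).map ψ.left)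
        = 0 := by
      rw [Preadditive.comp_sub, ← pairProjQ_naturality, ← pairProjQ_naturality, h, sub_self]
    obtain ⟨g, hg⟩ := exists_eq_mor₃_comp (pair_stupid_distinguished s.hom) _ h1
    rw [hg, single_one_shift_hom_eq_zero h0 g, comp_zero]
  · apply (singleFunctor C 1).map_injective
    rw [← sub_eq_zero]
    have h1 : ((singleFunctor C 1).map φ.right - (singleFunctor C 1).map ψ.right) ≫
        pairInclQ s'.hom = 0 := by
      rw [Preadditive.sub_comp, ← pairInclQ_naturality, ← pairInclQ_naturality, h, sub_self]
    refine eq_zero_of_comp_mor₁ (pair_stupid_distinguished s'.hom) (fun g => ?_) _ h1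
    apply (shiftFunctor (DerivedCategory C) (1 : ℤ)).map_injective
    rw [Functor.map_zero, ← cancel_mono
      ((shiftFunctorCompIsoId (DerivedCategory C) (-1 : ℤ) 1 (by simp)).hom.app _), zero_comp]
    exact single_one_shift_hom_eq_zero h0 _

include h0 h1 in
/-- Morphisms `(A ⟶ B) ⟶ (A' ⟶ B')` in the derived category are commutative squares if `Hom(B, A')`
and `Ext¹(B, A')` vanish, since they then respect the stupid filtrations. -/
lemma pairFunctorQ_map_surjective :
    Function.Surjective ((pairFunctorQ C).map : (s ⟶ s') → _) := by
  intro c'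
  obtain ⟨c, hc⟩ : ∃ c : pairObj s.hom ⟶ pairObj s'.hom, c = c' := ⟨c', rfl⟩
  suffices ∃ φ, pairQMap φ = c from this.imp fun φ hφ => hφ.trans hc
  clear hc c'
  -- `c` induces morphisms on the graded pieces of the stupid filtration
  obtain ⟨a', ha'⟩ := exists_eq_comp_mor₁ (pair_stupid_distinguished s'.hom) (pairInclQ s.hom ≫ c)
    (single_one_hom_eq_zero h1 _)
  obtain ⟨b', hb', hab⟩ := complete_distinguished_triangle_morphism _ _
    (pair_stupid_distinguished s.hom) (pair_stupid_distinguished s'.hom) a' c ha'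
  change (singleFunctor C 0).obj s.left ⟶ (singleFunctor C 0).obj s'.left at b'
  obtain ⟨a, rfl⟩ := (singleFunctor C 1).map_surjective a'
  obtain ⟨b, rfl⟩ := (singleFunctor C 0).map_surjective b'
  change pairProjQ s.hom ≫ (singleFunctor C 0).map b = c ≫ pairProjQ s'.hom at hb'
  change pairδ s.hom ≫ ((singleFunctor C 1).map a)⟦(1 : ℤ)⟧' =
    (singleFunctor C 0).map b ≫ pairδ s'.hom at hab
  have comm : b ≫ s'.hom = s.hom ≫ a := by
    apply pairδ_injective
    rw [← singleδ_naturality, ← hab, ← pairδ_naturality s.hom, ← pairδ_naturality (s.hom ≫ a),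
      Functor.map_comp, Functor.map_comp, Category.assoc]
  let φ : s ⟶ s' := Arrow.homMk b a comm
  refine ⟨φ, Eq.symm ?_⟩
  rw [← sub_eq_zero]
  -- the difference vanishes on the graded pieces, so it factors through `A ⟶ B'[-1]`
  have h2 : pairInclQ s.hom ≫ (c - pairQMap φ) = 0 := by
    rw [Preadditive.comp_sub, pairInclQ_naturality, ha']; exact sub_self _
  have h3 : (c - pairQMap φ) ≫ pairProjQ s'.hom = 0 := by
    rw [Preadditive.sub_comp, pairProjQ_naturality, ← hb']; exact sub_self _
  obtain ⟨k, hk⟩ := exists_eq_mor₂_comp (pair_stupid_distinguished s.hom) _ h2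
  have h4 : k ≫ pairProjQ s'.hom = 0 := by
    rw [hk, Category.assoc] at h3
    obtain ⟨g, hg⟩ := exists_eq_mor₃_comp (pair_stupid_distinguished s.hom) _ h3
    rw [hg, single_one_shift_hom_eq_zero h0 g, comp_zero]
  obtain ⟨m, hm⟩ := exists_eq_comp_mor₁ (pair_stupid_distinguished s'.hom) k h4
  rw [hk, hm, single_hom_eq_zero zero_lt_one m, zero_comp, comp_zero]
end

/-! ### The extension closure consists of two-term complexes -/

/-- The objects `F[-1]`, for `F` in a given class. -/
def degreeOne (P : ObjectProperty C) : ObjectProperty (DerivedCategory C) :=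
  fun E => ∃ F, P F ∧ Nonempty (E ≅ (singleFunctor C 1).obj F)

/-- The objects `A` in degree `0`, for `A` in a given class. -/
def degreeZero (P : ObjectProperty C) : ObjectProperty (DerivedCategory C) :=
  fun E => ∃ F, P F ∧ Nonempty (E ≅ (singleFunctor C 0).obj F)

/-- The two-term complexes `A ⟶ B` with `A` and `B` in given classes. -/
def twoTerms (P Q : ObjectProperty C) : ObjectProperty (DerivedCategory C) :=
  fun E => ∃ (A B : C) (s : A ⟶ B), P A ∧ Q B ∧ Nonempty (E ≅ pairObj s)

/-- Two-term complexes are the extensions of objects in degree `0` by objects in degree `1`. -/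
lemma twoTerms_eq_extensionProduct (P Q : ObjectProperty C) :
    twoTerms P Q = (degreeOne Q).extensionProduct (degreeZero P) := by
  ext E
  constructor
  · rintro ⟨A, B, s, hA, hB, ⟨e⟩⟩
    exact ((degreeOne Q).extensionProduct (degreeZero P)).prop_of_iso e.symm
      ⟨_, _, _, _, _, pair_stupid_distinguished s, ⟨B, hB, ⟨Iso.refl _⟩⟩, ⟨A, hA, ⟨Iso.refl _⟩⟩⟩
  · rintro ⟨Y, Z, f, g, h, hT, ⟨B, hB, ⟨eB⟩⟩, ⟨A, hA, ⟨eA⟩⟩⟩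
    obtain ⟨s, hs⟩ := pairδ_surjective (eA.inv ≫ h ≫ eB.hom⟦(1 : ℤ)⟧')
    have comm : h ≫ eB.hom⟦(1 : ℤ)⟧' = eA.hom ≫ pairδ s := by rw [hs, Iso.hom_inv_id_assoc]
    obtain ⟨φ, h₁, h₂⟩ := complete_distinguished_triangle_morphism₂ _ _ hT
      (pair_stupid_distinguished s) eB.hom eA.hom comm
    let ψ : Triangle.mk f g h ⟶ Triangle.mk (pairInclQ s) (pairProjQ s) (pairδ s) :=
      { hom₁ := eB.hom, hom₂ := φ, hom₃ := eA.hom, comm₁ := h₁, comm₂ := h₂, comm₃ := comm }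
    have : IsIso ψ.hom₂ := isIso₂_of_isIso₁₃ ψ hT (pair_stupid_distinguished s)
      (inferInstanceAs (IsIso eB.hom)) (inferInstanceAs (IsIso eA.hom))
    exact ⟨A, B, s, hA, hB, ⟨@asIso _ _ _ _ φ this⟩⟩

/-- If all extensions of `Q` by `P` split, then they are also extensions of `P` by `Q`. -/
lemma extensionProduct_comm_of_hom_eq_zero {P Q : ObjectProperty (DerivedCategory C)}
    (h : ∀ X Y, P X → Q Y → ∀ g : Y ⟶ X⟦(1 : ℤ)⟧, g = 0) :
    P.extensionProduct Q ≤ Q.extensionProduct P := by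
  rintro E ⟨X, Y, f, g, δ, hT, hX, hY⟩
  obtain ⟨e, -, -⟩ := exists_iso_binaryBiproduct_of_distTriang _ hT (h X Y hX hY δ)
  exact (Q.extensionProduct P).prop_of_iso ((biprod.braiding Y X) ≪≫ e.symm)
    ⟨Y, X, _, _, _, binaryBiproductTriangle_distinguished Y X, hY, hX⟩

/-- A class of objects of `C` that is closed under extensions remains so after its embedding in the
derived category in a single degree. -/
lemma exists_single_of_extension {n : ℤ} {P : ObjectProperty C}
    (hP : ∀ S : ShortComplex C, S.ShortExact → P S.X₁ → P S.X₃ → P S.X₂)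
    {T : Triangle (DerivedCategory C)} (hT : T ∈ distTriang (DerivedCategory C)) {A B : C}
    (hA : P A) (hB : P B) (e₁ : T.obj₁ ≅ (singleFunctor C n).obj A)
    (e₃ : T.obj₃ ≅ (singleFunctor C n).obj B) :
    ∃ F, P F ∧ Nonempty (T.obj₂ ≅ (singleFunctor C n).obj F) := by
  have h₃ : (T.mor₃ ≫ e₁.hom⟦(1 : ℤ)⟧') ≫ e₁.inv⟦(1 : ℤ)⟧' = T.mor₃ := by
    rw [Category.assoc, ← Functor.map_comp, Iso.hom_inv_id, CategoryTheory.Functor.map_id,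
      Category.comp_id]
  have hT' : Triangle.mk (e₁.inv ≫ T.mor₁) (T.mor₂ ≫ e₃.hom)
      (e₃.inv ≫ T.mor₃ ≫ e₁.hom⟦(1 : ℤ)⟧') ∈ distTriang (DerivedCategory C) := by
    refine isomorphic_distinguished _ hT _ (Triangle.isoMk _ _ e₁.symm (Iso.refl _) e₃.symm
      ?_ ?_ ?_)
    · exact Category.comp_id _
    · change (T.mor₂ ≫ e₃.hom) ≫ e₃.inv = 𝟙 _ ≫ T.mor₂
      simp
    · change (e₃.inv ≫ T.mor₃ ≫ e₁.hom⟦(1 : ℤ)⟧') ≫ e₁.inv⟦(1 : ℤ)⟧' = e₃.inv ≫ T.mor₃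
      rw [Category.assoc, h₃]
  obtain ⟨S, hS, h₁, h₃, e, -⟩ := exists_shortExact_of_distinguished _ _ _ hT'
  exact ⟨S.X₂, hP S hS (h₁ ▸ hA) (h₃ ▸ hB), ⟨e⟩⟩

lemma degreeOne_extension {P : ObjectProperty C}
    (hP : ∀ S : ShortComplex C, S.ShortExact → P S.X₁ → P S.X₃ → P S.X₂) :
    (degreeOne P).extensionProduct (degreeOne P) ≤ degreeOne P := by
  rintro E ⟨Y, Z, f, g, h, hT, ⟨B, hB, ⟨eB⟩⟩, ⟨A, hA, ⟨eA⟩⟩⟩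
  exact exists_single_of_extension hP hT hB hA eB eA

lemma degreeZero_extension {P : ObjectProperty C}
    (hP : ∀ S : ShortComplex C, S.ShortExact → P S.X₁ → P S.X₃ → P S.X₂) :
    (degreeZero P).extensionProduct (degreeZero P) ≤ degreeZero P := by
  rintro E ⟨Y, Z, f, g, h, hT, ⟨B, hB, ⟨eB⟩⟩, ⟨A, hA, ⟨eA⟩⟩⟩
  exact exists_single_of_extension hP hT hB hA eB eA

/-- The two-term complexes `A ⟶ B` with `A ∈ P` and `B ∈ Q` are closed under extensions, if `P`
and `Q` are and `Ext²(B, A) = 0`. -/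
lemma twoTerms_extension {P Q : ObjectProperty C}
    (hP : ∀ S : ShortComplex C, S.ShortExact → P S.X₁ → P S.X₃ → P S.X₂)
    (hQ : ∀ S : ShortComplex C, S.ShortExact → Q S.X₁ → Q S.X₃ → Q S.X₂)
    (h2 : ∀ A B, P A → Q B → ∀ g : (singleFunctor C 1).obj B ⟶
      ((singleFunctor C 0).obj A)⟦(1 : ℤ)⟧, g = 0) :
    (twoTerms P Q).extensionProduct (twoTerms P Q) ≤ twoTerms P Q := by
  have hc : (degreeZero P).extensionProduct (degreeOne Q) ≤
      (degreeOne Q).extensionProduct (degreeZero P) := by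
    apply extensionProduct_comm_of_hom_eq_zero
    rintro X Y ⟨A, hA, ⟨eA⟩⟩ ⟨B, hB, ⟨eB⟩⟩ g
    rw [← cancel_epi eB.inv, ← cancel_mono (eA.hom⟦(1 : ℤ)⟧'), comp_zero, zero_comp]
    exact h2 A B hA hB _
  rw [twoTerms_eq_extensionProduct, ObjectProperty.extensionProduct_assoc,
    ← ObjectProperty.extensionProduct_assoc (degreeZero P)]
  refine (ObjectProperty.monotone_extensionProduct_right _
    (ObjectProperty.monotone_extensionProduct_left _ hc)).trans ?_
  rw [ObjectProperty.extensionProduct_assoc, ← ObjectProperty.extensionProduct_assoc]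
  exact (ObjectProperty.monotone_extensionProduct_left _ (degreeOne_extension hQ)).trans
    (ObjectProperty.monotone_extensionProduct_right _ (degreeZero_extension hP))

end TwoTermMaps

/-! ### Stalks of sheaves of modules -/

section Stalks
open TopologicalSpace

variable {X : Scheme.{0}}

/-- Restriction of sections of a sheaf of modules. -/
def res (F : X.Modules) {U V : X.Opens} (h : U ≤ V) : Γ(F, V) →+ Γ(F, U) :=
  (F.presheaf.map (homOfLE h).op).hom

/-- Restriction of functions. -/
def resO {U V : X.Opens} (h : U ≤ V) : Γ(X, V) →+* Γ(X, U) :=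
  (X.presheaf.map (homOfLE h).op).hom

/-- The stalk of a sheaf of modules. -/
def Stalk (F : X.Modules) (x : X) : Type := F.presheaf.stalk x

instance (F : X.Modules) (x : X) : AddCommGroup (Stalk F x) :=
  inferInstanceAs (AddCommGroup (F.presheaf.stalk x))

instance (F : X.Modules) (x : X) : Module (X.presheaf.stalk x) (Stalk F x) :=
  PresheafOfModules.instModuleCarrierStalkCommRingCatCarrierAbPresheafOpensCarrier
    (R := X.presheaf) F.val x

/-- The germ of a section. -/
def germ (F : X.Modules) {U : X.Opens} {x : X} (hx : x ∈ U) : Γ(F, U) →+ Stalk F x :=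
  (F.presheaf.germ U x hx).hom

/-- The germ of a function. -/
def germO {U : X.Opens} {x : X} (hx : x ∈ U) : Γ(X, U) →+* X.presheaf.stalk x :=
  (X.presheaf.germ U x hx).hom

variable {F G H : X.Modules}

@[simp] lemma res_self {U : X.Opens} (s : Γ(F, U)) : res F le_rfl s = s := by
  change (F.presheaf.map (𝟙 _)).hom s = s
  rw [CategoryTheory.Functor.map_id]; rfl

@[simp] lemma res_res {U V W : X.Opens} (h : U ≤ V) (h' : V ≤ W) (s : Γ(F, W)) :
    res F h (res F h' s) = res F (h.trans h') s :=
  (congrArg (fun φ => φ.hom s) (F.presheaf.map_comp (homOfLE h').op (homOfLE h).op)).symm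

@[simp] lemma resO_resO {U V W : X.Opens} (h : U ≤ V) (h' : V ≤ W) (s : Γ(X, W)) :
    resO h (resO h' s) = resO (h.trans h') s :=
  (congrArg (fun φ => φ.hom s) (X.presheaf.map_comp (homOfLE h').op (homOfLE h).op)).symm

lemma res_smul {U V : X.Opens} (h : U ≤ V) (a : Γ(X, V)) (s : Γ(F, V)) :
    res F h (a • s) = resO h a • res F h s := F.map_smul (homOfLE h) a s

@[simp] lemma germ_res {U V : X.Opens} (h : U ≤ V) {x : X} (hx : x ∈ U) (s : Γ(F, V)) :
    germ F hx (res F h s) = germ F (h hx) s :=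
  F.presheaf.germ_res_apply (homOfLE h) x hx s

@[simp] lemma germO_resO {U V : X.Opens} (h : U ≤ V) {x : X} (hx : x ∈ U) (s : Γ(X, V)) :
    germO hx (resO h s) = germO (h hx) s :=
  X.presheaf.germ_res_apply (homOfLE h) x hx s

lemma germ_smul {U : X.Opens} {x : X} (hx : x ∈ U) (a : Γ(X, U)) (s : Γ(F, U)) :
    germ F hx (a • s) = germO hx a • germ F hx s :=
  PresheafOfModules.germ_smul (R := X.presheaf) F.val x U hx a s

lemma exists_germ_eq {x : X} (t : Stalk F x) :
    ∃ (U : X.Opens) (hx : x ∈ U) (s : Γ(F, U)), germ F hx s = t :=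
  F.presheaf.exists_germ_eq t

lemma exists_germO_eq {x : X} (t : X.presheaf.stalk x) :
    ∃ (U : X.Opens) (hx : x ∈ U) (s : Γ(X, U)), germO hx s = t :=
  X.presheaf.exists_germ_eq t

lemma exists_res_eq_of_germ_eq {U V : X.Opens} {x : X} (hU : x ∈ U) (hV : x ∈ V)
    {s : Γ(F, U)} {t : Γ(F, V)} (h : germ F hU s = germ F hV t) :
    ∃ (W : X.Opens) (_ : x ∈ W) (h₁ : W ≤ U) (h₂ : W ≤ V), res F h₁ s = res F h₂ t := by
  obtain ⟨W, hW, i, j, e⟩ := F.presheaf.germ_eq x hU hV s t h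
  exact ⟨W, hW, leOfHom i, leOfHom j, e⟩

lemma exists_res_eq_zero {U : X.Opens} {x : X} (hU : x ∈ U) {s : Γ(F, U)} (h : germ F hU s = 0) :
    ∃ (W : X.Opens) (_ : x ∈ W) (h₁ : W ≤ U), res F h₁ s = 0 := by
  obtain ⟨W, hW, h₁, h₂, e⟩ := exists_res_eq_of_germ_eq hU hU (t := 0) (h.trans (map_zero _).symm)
  exact ⟨W, hW, h₁, e.trans (map_zero _)⟩

lemma section_ext {U : X.Opens} {s t : Γ(F, U)}
    (h : ∀ x (hx : x ∈ U), germ F hx s = germ F hx t) : s = t :=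
  TopCat.Presheaf.section_ext (⟨F.presheaf, F.isSheaf⟩ : TopCat.Sheaf Ab X) U s t h

/-- The underlying sheaf of abelian groups. -/
def abSheaf (F : X.Modules) : TopCat.Sheaf Ab X := ⟨F.presheaf, F.isSheaf⟩

/-- Gluing sections over two open sets. -/
lemma exists_glue {U V W : X.Opens} (hU : U ≤ W) (hV : V ≤ W) (hW : W ≤ U ⊔ V)
    (s : Γ(F, U)) (t : Γ(F, V))
    (h : res F (inf_le_left : U ⊓ V ≤ U) s = res F (inf_le_right : U ⊓ V ≤ V) t) :
    ∃ u : Γ(F, W), res F hU u = s ∧ res F hV u = t := by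
  let Uι : Bool → X.Opens := fun b => cond b U V
  let iUV : ∀ i, Uι i ⟶ W := fun i => homOfLE (by cases i <;> assumption)
  let sf : ∀ i, Γ(F, Uι i) := fun i => match i with
    | true => s
    | false => t
  obtain ⟨u, hu, -⟩ := (abSheaf F).existsUnique_gluing' Uι W iUV
    (hW.trans (sup_le (le_iSup Uι true) (le_iSup Uι false))) sf (by
      rintro (_ | _) (_ | _)
      · rfl
      · have := congrArg (res F (le_inf inf_le_right inf_le_left : V ⊓ U ≤ U ⊓ V)) h
        rw [res_res, res_res] at this
        exact this.symm
      · exact h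
      · rfl)
  exact ⟨u, hu true, hu false⟩

@[simp] lemma app_res (φ : F ⟶ G) {U V : X.Opens} (h : U ≤ V) (s : Γ(F, V)) :
    φ.app U (res F h s) = res G h (φ.app V s) :=
  congrArg (fun ψ => ψ.hom s) (φ.mapPresheaf.naturality (homOfLE h).op)

/-- The map on stalks of a morphism of sheaves of modules. -/
def stalkMap (φ : F ⟶ G) (x : X) : Stalk F x →ₗ[X.presheaf.stalk x] Stalk G x where
  toFun := ((TopCat.Presheaf.stalkFunctor Ab x).map φ.mapPresheaf).hom
  map_add' := map_add _
  map_smul' r t := by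
    obtain ⟨U, hx, s, rfl⟩ := exists_germ_eq t
    obtain ⟨V, hx', a, rfl⟩ := exists_germO_eq r
    have hW : x ∈ U ⊓ V := ⟨hx, hx'⟩
    rw [← germ_res inf_le_left hW s, ← germO_resO inf_le_right hW a, ← germ_smul]
    have key (s : Γ(F, U ⊓ V)) : ((TopCat.Presheaf.stalkFunctor Ab x).map φ.mapPresheaf).hom
        (germ F hW s) = germ G hW (φ.app _ s) :=
      TopCat.Presheaf.stalkFunctor_map_germ_apply _ x hW φ.mapPresheaf s
    rw [key, key, φ.app_smul, germ_smul]
    rfl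

@[simp] lemma stalkMap_germ (φ : F ⟶ G) {U : X.Opens} {x : X} (hx : x ∈ U) (s : Γ(F, U)) :
    stalkMap φ x (germ F hx s) = germ G hx (φ.app U s) :=
  TopCat.Presheaf.stalkFunctor_map_germ_apply _ x hx φ.mapPresheaf s

@[simp] lemma stalkMap_id (x : X) : stalkMap (𝟙 F) x = LinearMap.id := by
  ext t
  obtain ⟨U, hx, s, rfl⟩ := exists_germ_eq t
  rw [stalkMap_germ]; rfl

@[simp] lemma stalkMap_comp (φ : F ⟶ G) (ψ : G ⟶ H) (x : X) :
    stalkMap (φ ≫ ψ) x = (stalkMap ψ x).comp (stalkMap φ x) := by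
  ext t
  obtain ⟨U, hx, s, rfl⟩ := exists_germ_eq t
  rw [LinearMap.comp_apply, stalkMap_germ, stalkMap_germ, stalkMap_germ]; rfl

@[simp] lemma stalkMap_zero (x : X) : stalkMap (0 : F ⟶ G) x = 0 := by
  ext t
  obtain ⟨U, hx, s, rfl⟩ := exists_germ_eq t
  rw [stalkMap_germ]
  exact map_zero (germ G hx)

lemma stalkMap_add (φ ψ : F ⟶ G) (x : X) : stalkMap (φ + ψ) x = stalkMap φ x + stalkMap ψ x := by
  ext t
  obtain ⟨U, hx, s, rfl⟩ := exists_germ_eq t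
  rw [LinearMap.add_apply, stalkMap_germ, stalkMap_germ, stalkMap_germ, ← map_add]; rfl

lemma hom_ext_stalk {φ ψ : F ⟶ G} (h : ∀ x, stalkMap φ x = stalkMap ψ x) : φ = ψ := by
  ext U s
  refine section_ext fun x hx => ?_
  rw [← stalkMap_germ, ← stalkMap_germ, h]

lemma mono_of_stalkMap_injective (φ : F ⟶ G) (h : ∀ x, Function.Injective (stalkMap φ x)) :
    Mono φ := by
  refine ⟨fun {K} f g hfg => hom_ext_stalk fun x => LinearMap.ext fun t => h x ?_⟩
  have := congrArg (fun χ => stalkMap χ x t) hfg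
  simpa using this

lemma epi_of_stalkMap_surjective (φ : F ⟶ G) (h : ∀ x, Function.Surjective (stalkMap φ x)) :
    Epi φ := by
  refine ⟨fun {K} f g hfg => hom_ext_stalk fun x => LinearMap.ext fun t => ?_⟩
  obtain ⟨t, rfl⟩ := h x t
  have := congrArg (fun χ => stalkMap χ x t) hfg
  simpa using this

lemma app_injective_of_mono (φ : F ⟶ G) [Mono φ] (U : X.Opens) : Function.Injective (φ.app U) := by
  have : Mono ((Scheme.Modules.toPresheaf X).map φ) := inferInstance
  have : Mono (((Scheme.Modules.toPresheaf X).map φ).app (.op U)) := inferInstance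
  exact (AddCommGrpCat.mono_iff_injective _).1 this

lemma stalkMap_injective_of_mono (φ : F ⟶ G) [Mono φ] (x : X) :
    Function.Injective (stalkMap φ x) := by
  rw [injective_iff_map_eq_zero]
  intro t ht
  obtain ⟨U, hx, s, rfl⟩ := exists_germ_eq t
  rw [stalkMap_germ] at ht
  obtain ⟨W, hW, h₁, e⟩ := exists_res_eq_zero hx ht
  rw [← app_res] at e
  rw [← germ_res h₁ hW, app_injective_of_mono φ W (e.trans (map_zero (φ.app W).hom).symm), map_zero]

/-- Left exact functors to modules, on elements. -/
lemma exists_map_eq_of_exact {C : Type*} [Category C] [Abelian C] {R : Type*} [Ring R]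
    (E : C ⥤ ModuleCat R) [PreservesFiniteLimits E] {S : ShortComplex C} (hS : S.Exact) [Mono S.f]
    (t : E.obj S.X₂) (ht : E.map S.g t = 0) : ∃ s, E.map S.f s = t := by
  have h1 := hS.map_of_mono_of_preservesKernel E inferInstance inferInstance
  rw [ShortComplex.moduleCat_exact_iff] at h1
  exact h1 t ht

/-- A section killed by `g` comes from the kernel. -/
lemma exists_app_eq_of_exact {S : ShortComplex X.Modules} (hS : S.Exact) [hm : Mono S.f]
    (U : X.Opens) (t : Γ(S.X₂, U)) (ht : S.g.app U t = 0) : ∃ s : Γ(S.X₁, U), S.f.app U s = t := by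
  let E : X.Modules ⥤ ModuleCat (X.ringCatSheaf.obj.obj (.op U)) :=
    SheafOfModules.evaluation X.ringCatSheaf (.op U)
  have : PreservesFiniteLimits E := inferInstanceAs
    (PreservesFiniteLimits (SheafOfModules.evaluation X.ringCatSheaf (.op U)))
  exact exists_map_eq_of_exact E hS t ht

/-- Let `L ⊣ R` be an adjunction with invertible counit such that `L` preserves monomorphisms. If
`L ⋙ T` preserves epimorphisms, then so does `T`: the image of `R.map φ` is sent by `L` to an
isomorphism. -/
lemma preservesEpi_of_adjunction {C D E : Type*} [Category C] [Category D] [Category E] [Abelian C]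
    [Abelian D] {L : C ⥤ D} {R : D ⥤ C} (adj : L ⊣ R) [IsIso adj.counit]
    [L.PreservesMonomorphisms] (T : D ⥤ E) [(L ⋙ T).PreservesEpimorphisms] {F G : D}
    (φ : F ⟶ G) [Epi φ] : Epi (T.map φ) := by
  have h : L.map (R.map φ) = adj.counit.app F ≫ φ ≫ inv (adj.counit.app G) := by
    rw [← Category.assoc, IsIso.eq_comp_inv]
    exact adj.counit.naturality φ
  have : Epi (L.map (R.map φ)) := by rw [h]; infer_instance
  have h' : L.map (factorThruImage (R.map φ)) ≫ L.map (image.ι (R.map φ)) = L.map (R.map φ) := by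
    rw [← L.map_comp, image.fac]
  have : Epi (L.map (image.ι (R.map φ))) := epi_of_epi_fac h'
  have : IsIso (L.map (image.ι (R.map φ))) := isIso_of_mono_of_epi _
  have : Epi (T.map (L.map (factorThruImage (R.map φ)))) :=
    inferInstanceAs (Epi ((L ⋙ T).map (factorThruImage (R.map φ))))
  have h3 : T.map (adj.counit.app F) ≫ T.map φ =
      T.map (L.map (factorThruImage (R.map φ))) ≫ T.map (L.map (image.ι (R.map φ))) ≫
        T.map (adj.counit.app G) := by
    rw [← T.map_comp, ← T.map_comp, ← T.map_comp, ← Category.assoc, h', h]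
    simp
  have : Epi (T.map (adj.counit.app F) ≫ T.map φ) := by rw [h3]; infer_instance
  exact epi_of_epi (T.map (adj.counit.app F)) (T.map φ)

/-- An epimorphism of sheaves of modules is an epimorphism of sheaves of abelian groups: the
sheafification functor preserves monomorphisms, and it commutes with the forgetful functors. -/
lemma epi_toSheaf_map (φ : F ⟶ G) [Epi φ] :
    Epi ((SheafOfModules.toSheaf X.ringCatSheaf).map φ) := by
  have : (PresheafOfModules.sheafification (𝟙 X.ringCatSheaf.obj) ⋙
      SheafOfModules.toSheaf X.ringCatSheaf).PreservesEpimorphisms :=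
    inferInstanceAs ((PresheafOfModules.toPresheaf X.ringCatSheaf.obj ⋙
      presheafToSheaf (Opens.grothendieckTopology X) AddCommGrpCat).PreservesEpimorphisms)
  have : Epi (C := SheafOfModules X.ringCatSheaf) φ := ‹Epi φ›
  exact preservesEpi_of_adjunction
    (PresheafOfModules.sheafificationAdjunction (𝟙 X.ringCatSheaf.obj))
    (SheafOfModules.toSheaf X.ringCatSheaf) φ

lemma stalkMap_surjective_of_epi (φ : F ⟶ G) [Epi φ] (x : X) :
    Function.Surjective (stalkMap φ x) := by
  have := epi_toSheaf_map φ
  have h := (TopCat.Sheaf.isLocallySurjective_iff_epi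
    ((SheafOfModules.toSheaf X.ringCatSheaf).map φ)).2 this
  exact (TopCat.Presheaf.locally_surjective_iff_surjective_on_stalks _).1 h x

lemma stalkMap_exact {S : ShortComplex X.Modules} (hS : S.ShortExact) (x : X) :
    Function.Exact (stalkMap S.f x) (stalkMap S.g x) := by
  have := hS.mono_f
  intro t
  constructor
  · intro ht
    obtain ⟨U, hx, s, rfl⟩ := exists_germ_eq t
    rw [stalkMap_germ] at ht
    obtain ⟨W, hW, h₁, e⟩ := exists_res_eq_zero hx ht
    rw [← app_res] at e
    obtain ⟨r, hr⟩ := exists_app_eq_of_exact hS.exact W _ e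
    exact ⟨germ _ hW r, by rw [stalkMap_germ, hr, germ_res]⟩
  · rintro ⟨r, rfl⟩
    rw [← LinearMap.comp_apply, ← stalkMap_comp, S.zero, stalkMap_zero, LinearMap.zero_apply]

lemma isZero_iff_stalk (F : X.Modules) : IsZero F ↔ ∀ x, Subsingleton (Stalk F x) := by
  constructor
  · intro h x
    refine subsingleton_of_forall_eq 0 fun t => ?_
    have := congrArg (fun χ => stalkMap χ x t) (h.eq_of_src (𝟙 F) 0)
    simpa using this
  · intro h
    rw [IsZero.iff_id_eq_zero]
    exact hom_ext_stalk fun x => LinearMap.ext fun t => Subsingleton.elim _ _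

lemma mem_support {F : X.Modules} {x : X} : x ∈ support F ↔ Nontrivial (Stalk F x) := Iff.rfl

lemma notMem_support {F : X.Modules} {x : X} : x ∉ support F ↔ Subsingleton (Stalk F x) := by
  rw [mem_support, not_nontrivial_iff_subsingleton]

end Stalks

/-! ### Skyscraper sheaves -/

section Skyscraper
open TopologicalSpace

variable {X : Scheme.{0}}

/-- A morphism of sheaves of modules from a family of linear maps that commute with restriction. -/
def homOfApp {F G : X.Modules} (f : ∀ U : X.Opens, Γ(F, U) →+ Γ(G, U))
    (hres : ∀ (U V : X.Opens) (h : U ≤ V) (s : Γ(F, V)), f U (res F h s) = res G h (f V s))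
    (hsmul : ∀ (U : X.Opens) (a : Γ(X, U)) (s : Γ(F, U)), f U (a • s) = a • f U s) : F ⟶ G :=
  ⟨PresheafOfModules.homMk (M₁ := F.val) (M₂ := G.val)
    { app := fun U => AddCommGrpCat.ofHom (f U.unop)
      naturality := fun U V i => by
        ext s
        exact hres V.unop U.unop (leOfHom i.unop) s }
    fun U a s => hsmul U.unop a s⟩

@[simp] lemma homOfApp_app {F G : X.Modules} (f : ∀ U : X.Opens, Γ(F, U) →+ Γ(G, U))
    (hres : ∀ (U V : X.Opens) (h : U ≤ V) (s : Γ(F, V)), f U (res F h s) = res G h (f V s))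
    (hsmul : ∀ (U : X.Opens) (a : Γ(X, U)) (s : Γ(F, U)), f U (a • s) = a • f U s) (U : X.Opens)
    (s : Γ(F, U)) : (homOfApp f hres hsmul).app U s = f U s := rfl

/-- A skyscraper sheaf at `x`: its sections over `U` are the elements of its stalk at `x` if
`x ∈ U`, and zero otherwise. -/
structure IsSkyscraper (P : X.Modules) (x : X) : Prop where
  bijective : ∀ (U : X.Opens) (hx : x ∈ U), Function.Bijective (germ P hx)
  subsingleton : ∀ U : X.Opens, x ∉ U → Subsingleton Γ(P, U)

open scoped Classical in
/-- A linear map on stalks at `x` with values in a skyscraper sheaf at `x` is induced by a morphism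
of sheaves. -/
lemma IsSkyscraper.exists_hom {P : X.Modules} {x : X} (hP : IsSkyscraper P x) {F : X.Modules}
    (l : Stalk F x →ₗ[X.presheaf.stalk x] Stalk P x) : ∃ φ : F ⟶ P, stalkMap φ x = l := by
  let f (U : X.Opens) : Γ(F, U) →+ Γ(P, U) :=
    if hx : x ∈ U then
      ((AddEquiv.ofBijective (germ P hx) (hP.bijective U hx)).symm.toAddMonoidHom.comp
        l.toAddMonoidHom).comp (germ F hx)
    else 0
  have hf (U : X.Opens) (hx : x ∈ U) (s : Γ(F, U)) : germ P hx (f U s) = l (germ F hx s) := by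
    simp only [f, dif_pos hx]
    exact (AddEquiv.ofBijective (germ P hx) (hP.bijective U hx)).apply_symm_apply _
  refine ⟨homOfApp f ?_ ?_, ?_⟩
  · intro U V h s
    by_cases hx : x ∈ U
    · apply (hP.bijective U hx).1
      rw [hf, germ_res, germ_res, hf]
    · have := hP.subsingleton U hx
      exact Subsingleton.elim _ _
  · intro U a s
    by_cases hx : x ∈ U
    · apply (hP.bijective U hx).1
      rw [hf, germ_smul, germ_smul, hf, map_smul]
    · have := hP.subsingleton U hx
      exact Subsingleton.elim _ _
  · ext t
    obtain ⟨U, hx, s, rfl⟩ := exists_germ_eq t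
    rw [stalkMap_germ, homOfApp_app, hf]

lemma IsSkyscraper.hom_ext {P : X.Modules} {x : X} (hP : IsSkyscraper P x) {F : X.Modules}
    {φ ψ : F ⟶ P} (h : stalkMap φ x = stalkMap ψ x) : φ = ψ := by
  ext U s
  by_cases hx : x ∈ U
  · apply (hP.bijective U hx).1
    rw [← stalkMap_germ, ← stalkMap_germ, h]
  · have := hP.subsingleton U hx
    exact Subsingleton.elim _ _

lemma IsSkyscraper.subsingleton_stalk {P : X.Modules} {x : X} (hP : IsSkyscraper P x)
    {y : X} (hy : ¬ y ∈ closure {x}) : Subsingleton (Stalk P y) := by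
  refine subsingleton_of_forall_eq 0 fun t => ?_
  obtain ⟨U, hU, s, rfl⟩ := exists_germ_eq t
  let W : X.Opens := U ⊓ ⟨(closure {x})ᶜ, isClosed_closure.isOpen_compl⟩
  have hW : y ∈ W := ⟨hU, hy⟩
  have := hP.subsingleton W (fun h => h.2 (subset_closure rfl))
  rw [← germ_res inf_le_left hW, Subsingleton.elim (res P _ s) 0, map_zero]

/-! ### The structure sheaf of a point -/

variable (x : X)

lemma fromSpecResidueField_preimage_eq_top {U : X.Opens} (hx : x ∈ U) :
    X.fromSpecResidueField x ⁻¹ᵁ U = ⊤ := by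
  ext y
  simp [Scheme.fromSpecResidueField_apply, hx]

lemma fromSpecResidueField_preimage_eq_bot {U : X.Opens} (hx : x ∉ U) :
    X.fromSpecResidueField x ⁻¹ᵁ U = ⊥ := by
  ext y
  simp [Scheme.fromSpecResidueField_apply, hx]

/-- The section of `𝒪_x` given by an element of the residue field. -/
def pointSection (U : X.Opens) : X.residueField x →+ Γ(pointSheaf x, U) :=
  ((resO le_top : _ →+* Γ(Spec (X.residueField x), X.fromSpecResidueField x ⁻¹ᵁ U)).comp
    (Scheme.ΓSpecIso (X.residueField x)).inv.hom).toAddMonoidHom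

lemma res_pointSection {U V : X.Opens} (h : U ≤ V) (c : X.residueField x) :
    res (pointSheaf x) h (pointSection x V c) = pointSection x U c :=
  resO_resO (X := Spec (X.residueField x)) _ _ _

lemma fromSpecResidueField_app {U : X.Opens} (hx : x ∈ U) (a : Γ(X, U)) :
    (X.fromSpecResidueField x).app U a =
      resO le_top ((Scheme.ΓSpecIso (X.residueField x)).inv.hom (X.residue x (germO hx a))) := by
  have h : (X.fromSpecResidueField x).app U = X.presheaf.germ U x hx ≫ X.residue x ≫
      (Scheme.ΓSpecIso (X.residueField x)).inv ≫
        (Spec (X.residueField x)).presheaf.map (homOfLE le_top).op := by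
    rw [Scheme.fromSpecResidueField, Scheme.Hom.comp_app, Scheme.fromSpecStalk_app hx,
      Category.assoc, Category.assoc, Scheme.Hom.naturality, ← Category.assoc
      (Scheme.ΓSpecIso (X.presheaf.stalk x)).inv, Scheme.ΓSpecIso_inv_naturality_assoc]
    rfl
  rw [h]; rfl

lemma smul_pointSection {U : X.Opens} (hx : x ∈ U) (a : Γ(X, U)) (c : X.residueField x) :
    a • pointSection x U c = pointSection x U (X.residue x (germO hx a) * c) := by
  have : a • pointSection x U c = (X.fromSpecResidueField x).app U a *
    (resO le_top : _ →+* Γ(Spec (X.residueField x), X.fromSpecResidueField x ⁻¹ᵁ U))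
      ((Scheme.ΓSpecIso (X.residueField x)).inv.hom c) := rfl
  rw [this, fromSpecResidueField_app x hx, ← map_mul, ← map_mul]
  rfl

lemma pointSection_bijective {U : X.Opens} (hx : x ∈ U) :
    Function.Bijective (pointSection x U) := by
  have h : IsIso ((Scheme.ΓSpecIso (X.residueField x)).inv ≫
      (Spec (X.residueField x)).presheaf.map (homOfLE (le_top :
        X.fromSpecResidueField x ⁻¹ᵁ U ≤ ⊤)).op) := by
    have : IsIso (homOfLE (le_top : X.fromSpecResidueField x ⁻¹ᵁ U ≤ ⊤)) :=
      ⟨homOfLE (fromSpecResidueField_preimage_eq_top x hx).ge, rfl, rfl⟩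
    infer_instance
  exact (ConcreteCategory.isIso_iff_bijective _).1 h

lemma isSkyscraper_pointSheaf : IsSkyscraper (pointSheaf x) x where
  bijective U hx := by
    constructor
    · intro s t hst
      obtain ⟨c, rfl⟩ := (pointSection_bijective x hx).2 s
      obtain ⟨d, rfl⟩ := (pointSection_bijective x hx).2 t
      obtain ⟨W, hW, h₁, h₂, e⟩ := exists_res_eq_of_germ_eq hx hx hst
      rw [res_pointSection, res_pointSection] at e
      rw [(pointSection_bijective x hW).1 e]
    · intro t
      obtain ⟨W, hW, s, rfl⟩ := exists_germ_eq t
      obtain ⟨c, rfl⟩ := (pointSection_bijective x hW).2 s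
      refine ⟨pointSection x U c, ?_⟩
      have hUW : x ∈ U ⊓ W := ⟨hx, hW⟩
      rw [← germ_res (inf_le_left) hUW, ← germ_res (inf_le_right : U ⊓ W ≤ W) hUW,
        res_pointSection, res_pointSection]
  subsingleton U hx := by
    have h := fromSpecResidueField_preimage_eq_bot x hx
    have : Subsingleton Γ(Spec (X.residueField x), X.fromSpecResidueField x ⁻¹ᵁ U) := by
      rw [h]; infer_instance
    exact this

/-- The value at `x` of a function, as a germ of a section of `𝒪_x`. -/
def residueToStalk :
    IsLocalRing.ResidueField (X.presheaf.stalk x) →ₗ[X.presheaf.stalk x]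
      Stalk (pointSheaf x) x where
  toFun := fun c => germ (pointSheaf x) (U := ⊤) trivial (pointSection x ⊤ c)
  map_add' := fun c d => (congrArg _ (map_add (pointSection x ⊤) c d)).trans (map_add _ _ _)
  map_smul' := fun r c => by
    obtain ⟨U, hx, a, rfl⟩ := exists_germO_eq r
    have h (c : X.residueField x) : germ (pointSheaf x) (U := ⊤) trivial (pointSection x ⊤ c) =
        germ (pointSheaf x) hx (pointSection x U c) := by
      rw [← res_pointSection x (le_top : U ≤ ⊤), germ_res]
    exact (h _).trans ((congrArg _ (smul_pointSection x hx a c).symm).trans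
      ((germ_smul hx _ _).trans (congrArg _ (h c).symm)))

lemma residueToStalk_bijective : Function.Bijective (residueToStalk x) :=
  ((isSkyscraper_pointSheaf x).bijective ⊤ trivial).comp
    (pointSection_bijective x (U := ⊤) trivial)

/-- The stalk of `𝒪_x` at `x` is the residue field. -/
def pointStalkEquiv :
    IsLocalRing.ResidueField (X.presheaf.stalk x) ≃ₗ[X.presheaf.stalk x]
      Stalk (pointSheaf x) x :=
  LinearEquiv.ofBijective (residueToStalk x) (residueToStalk_bijective x)

end Skyscraper

/-! ### Sheaves of finite length -/

section FiniteLength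
open TopologicalSpace

variable {X : Scheme.{0}}

/-- The length of the stalk of a sheaf of modules. -/
def stalkLength (F : X.Modules) (x : X) : ℕ∞ := Module.length (X.presheaf.stalk x) (Stalk F x)

lemma stalkLength_eq_zero_iff {F : X.Modules} {x : X} : stalkLength F x = 0 ↔ x ∉ support F := by
  rw [stalkLength, Module.length_eq_zero_iff, notMem_support]

lemma stalkLength_add {S : ShortComplex X.Modules} (hS : S.ShortExact) (x : X) :
    stalkLength S.X₂ x = stalkLength S.X₁ x + stalkLength S.X₃ x := by
  have := hS.mono_f
  have := hS.epi_g
  exact Module.length_eq_add_of_exact (stalkMap S.f x) (stalkMap S.g x)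
    (stalkMap_injective_of_mono _ x) (stalkMap_surjective_of_epi _ x) (stalkMap_exact hS x)

/-- A sheaf of modules with finitely many points in its support, all of them closed, and with stalks
of finite length. -/
structure HasFiniteLength (F : X.Modules) : Prop where
  finite_support : (support F).Finite
  isClosed : ∀ x ∈ support F, IsClosed {x}
  stalkLength_ne_top : ∀ x, stalkLength F x ≠ ⊤

lemma support_eq_union {S : ShortComplex X.Modules} (hS : S.ShortExact) :
    support S.X₂ = support S.X₁ ∪ support S.X₃ := by
  ext x
  have h := stalkLength_add hS x
  have h₁ := stalkLength_eq_zero_iff (F := S.X₁) (x := x)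
  have h₂ := stalkLength_eq_zero_iff (F := S.X₂) (x := x)
  have h₃ := stalkLength_eq_zero_iff (F := S.X₃) (x := x)
  rw [h, add_eq_zero] at h₂
  rw [Set.mem_union]
  tauto

lemma hasFiniteLength_iff_of_shortExact {S : ShortComplex X.Modules} (hS : S.ShortExact) :
    HasFiniteLength S.X₂ ↔ HasFiniteLength S.X₁ ∧ HasFiniteLength S.X₃ := by
  have h := support_eq_union hS
  have hl := stalkLength_add hS
  constructor
  · rintro ⟨h1, h2, h3⟩
    rw [h] at h1 h2
    refine ⟨⟨h1.subset Set.subset_union_left, fun x hx => h2 x (.inl hx), fun x hx => h3 x ?_⟩,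
      h1.subset Set.subset_union_right, fun x hx => h2 x (.inr hx), fun x hx => h3 x ?_⟩
    · rw [hl, hx, top_add]
    · rw [hl, hx, add_top]
  · rintro ⟨⟨h1, h2, h3⟩, h1', h2', h3'⟩
    refine ⟨by rw [h]; exact h1.union h1', ?_, fun x hx => ?_⟩
    · rw [h]
      rintro x (hx | hx)
      exacts [h2 x hx, h2' x hx]
    · rw [hl] at hx
      rcases WithTop.add_eq_top.1 hx with hx | hx
      exacts [h3 x hx, h3' x hx]

lemma shortExact_of_mono {F G : X.Modules} (φ : F ⟶ G) [Mono φ] :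
    (ShortComplex.mk φ (cokernel.π φ) (cokernel.condition φ)).ShortExact :=
  ⟨ShortComplex.exact_cokernel φ⟩

lemma shortExact_of_epi {F G : X.Modules} (φ : F ⟶ G) [Epi φ] :
    (ShortComplex.mk (kernel.ι φ) φ (kernel.condition φ)).ShortExact :=
  ⟨ShortComplex.exact_kernel φ⟩

lemma HasFiniteLength.of_mono {F G : X.Modules} (hG : HasFiniteLength G) (φ : F ⟶ G) [Mono φ] :
    HasFiniteLength F :=
  ((hasFiniteLength_iff_of_shortExact (shortExact_of_mono φ)).1 hG).1

lemma HasFiniteLength.of_epi {F G : X.Modules} (hF : HasFiniteLength F) (φ : F ⟶ G) [Epi φ] :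
    HasFiniteLength G :=
  ((hasFiniteLength_iff_of_shortExact (shortExact_of_epi φ)).1 hF).2

open scoped Classical in
lemma stalkLength_pointSheaf {x : X} (hx : IsClosed {x}) (y : X) :
    stalkLength (pointSheaf x) y = if y = x then 1 else 0 := by
  split_ifs with h
  · subst h
    rw [stalkLength, ← (pointStalkEquiv y).length_eq]
    have : IsSimpleModule (X.presheaf.stalk y) (IsLocalRing.ResidueField (X.presheaf.stalk y)) :=
      isSimpleModule_iff_quot_maximal.2 ⟨IsLocalRing.maximalIdeal _, inferInstance, ⟨.refl _ _⟩⟩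
    exact Module.length_eq_one _ _
  · rw [stalkLength_eq_zero_iff, notMem_support]
    refine (isSkyscraper_pointSheaf x).subsingleton_stalk ?_
    rwa [hx.closure_eq]

lemma hasFiniteLength_pointSheaf {x : X} (hx : IsClosed {x}) : HasFiniteLength (pointSheaf x) := by
  have h : support (pointSheaf x) ⊆ {x} := by
    intro y hy
    by_contra hne
    rw [Set.mem_singleton_iff] at hne
    exact stalkLength_eq_zero_iff.1 ((stalkLength_pointSheaf hx y).trans (if_neg hne)) hy
  refine ⟨(Set.finite_singleton x).subset h, fun y hy => ?_, fun y => ?_⟩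
  · rwa [h hy]
  · rw [stalkLength_pointSheaf hx]
    split_ifs <;> simp

lemma hasFiniteLength_of_isZero {F : X.Modules} (hF : IsZero F) : HasFiniteLength F := by
  rw [isZero_iff_stalk] at hF
  have h : support F = ∅ := Set.eq_empty_iff_forall_notMem.2 fun x => notMem_support.2 (hF x)
  refine ⟨by rw [h]; exact Set.finite_empty, by simp [h], fun x => ?_⟩
  rw [stalkLength_eq_zero_iff.2 (by simp [h])]
  simp

/-- The sum of the lengths of the stalks. For a sheaf of finite length it is the length of the
sheaf, by `HasFiniteLength.length_eq`. -/
def totalLength (F : X.Modules) : ℕ := ∑ᶠ x, (stalkLength F x).toNat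

lemma HasFiniteLength.finite_mulSupport {F : X.Modules} (hF : HasFiniteLength F) :
    (Function.support fun x => (stalkLength F x).toNat).Finite := by
  refine hF.finite_support.subset fun x hx => ?_
  by_contra h
  exact hx (by simp [stalkLength_eq_zero_iff.2 h])

lemma totalLength_add {S : ShortComplex X.Modules} (hS : S.ShortExact)
    (h : HasFiniteLength S.X₂) : totalLength S.X₂ = totalLength S.X₁ + totalLength S.X₃ := by
  obtain ⟨h₁, h₃⟩ := (hasFiniteLength_iff_of_shortExact hS).1 h
  rw [totalLength, totalLength, totalLength,
    ← finsum_add_distrib h₁.finite_mulSupport h₃.finite_mulSupport]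
  congr! 2 with x
  rw [stalkLength_add hS, ENat.toNat_add (h₁.stalkLength_ne_top x) (h₃.stalkLength_ne_top x)]

lemma totalLength_eq_of_iso {F G : X.Modules} (e : F ≅ G) : totalLength F = totalLength G := by
  unfold totalLength
  congr! 2 with x
  have h (t : Stalk F x) : stalkMap e.inv x (stalkMap e.hom x t) = t := by
    rw [← LinearMap.comp_apply, ← stalkMap_comp, e.hom_inv_id, stalkMap_id, LinearMap.id_apply]
  have h' (t : Stalk G x) : stalkMap e.hom x (stalkMap e.inv x t) = t := by
    rw [← LinearMap.comp_apply, ← stalkMap_comp, e.inv_hom_id, stalkMap_id, LinearMap.id_apply]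
  exact congrArg _ (LinearEquiv.length_eq
    { stalkMap e.hom x with invFun := stalkMap e.inv x, left_inv := h, right_inv := h' })

lemma HasFiniteLength.totalLength_eq_zero_iff {F : X.Modules} (hF : HasFiniteLength F) :
    totalLength F = 0 ↔ IsZero F := by
  rw [isZero_iff_stalk, totalLength]
  constructor
  · intro h x
    have h2 : (stalkLength F x).toNat = 0 := by
      have := single_le_finsum x hF.finite_mulSupport fun x => Nat.zero_le _
      exact Nat.le_zero.1 (this.trans h.le)
    rw [ENat.toNat_eq_zero, or_iff_left (hF.stalkLength_ne_top x)] at h2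
    exact notMem_support.1 (stalkLength_eq_zero_iff.1 h2)
  · intro h
    refine finsum_eq_zero_of_forall_eq_zero fun x => ?_
    rw [stalkLength_eq_zero_iff.2 (notMem_support.2 (h x))]
    rfl

lemma totalLength_pointSheaf {x : X} (hx : IsClosed {x}) : totalLength (pointSheaf x) = 1 := by
  classical
  rw [totalLength, finsum_eq_single _ x fun y hy => by
      rw [stalkLength_pointSheaf hx, if_neg hy]; rfl,
    stalkLength_pointSheaf hx, if_pos rfl]
  rfl

/-- A nonzero module of finite length over a local ring has a maximal submodule, hence it maps onto
the residue field. -/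
lemma exists_surjective_stalk {F : X.Modules} {x : X} (hx : x ∈ support F)
    (hl : stalkLength F x ≠ ⊤) :
    ∃ l : Stalk F x →ₗ[X.presheaf.stalk x] Stalk (pointSheaf x) x, Function.Surjective l := by
  have := mem_support.1 hx
  have : IsNoetherian (X.presheaf.stalk x) (Stalk F x) :=
    (isFiniteLength_iff_isNoetherian_isArtinian.1 (Module.length_ne_top_iff.1 hl)).1
  obtain ⟨N, hN, -⟩ := (eq_top_or_exists_le_coatom
    (⊥ : Submodule (X.presheaf.stalk x) (Stalk F x))).resolve_left bot_ne_top
  obtain ⟨I, hI, ⟨e⟩⟩ := isSimpleModule_iff_quot_maximal.1 (isSimpleModule_iff_isCoatom.2 hN)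
  obtain rfl := IsLocalRing.eq_maximalIdeal hI
  exact ⟨(pointStalkEquiv x).toLinearMap ∘ₗ e.toLinearMap ∘ₗ N.mkQ,
    (pointStalkEquiv x).surjective.comp (e.surjective.comp N.mkQ_surjective)⟩

/-- A nonzero sheaf of finite length has a quotient `𝒪_x`. -/
lemma HasFiniteLength.exists_epi {F : X.Modules} (hF : HasFiniteLength F) (h : ¬ IsZero F) :
    ∃ (x : X) (φ : F ⟶ pointSheaf x), IsClosed {x} ∧ Epi φ := by
  classical
  rw [isZero_iff_stalk] at h
  push Not at h
  obtain ⟨x, hx⟩ := h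
  obtain ⟨l, hl⟩ := exists_surjective_stalk hx (hF.stalkLength_ne_top x)
  have hc := hF.isClosed x hx
  obtain ⟨φ, rfl⟩ := (isSkyscraper_pointSheaf x).exists_hom l
  refine ⟨x, φ, hc, epi_of_stalkMap_surjective φ fun y => ?_⟩
  by_cases hy : y = x
  · subst hy
    exact hl
  · have : Subsingleton (Stalk (pointSheaf x) y) := by
      rw [← notMem_support, ← stalkLength_eq_zero_iff, stalkLength_pointSheaf hc, if_neg hy]
    exact fun t => ⟨0, Subsingleton.elim _ _⟩

/-- Induction on the length: a property of sheaves of finite length holds if it holds for zero and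
is inherited by extensions of `𝒪_x` by sheaves that have it. -/
lemma HasFiniteLength.induction {P : X.Modules → Prop} (zero : ∀ F, IsZero F → P F)
    (ext : ∀ (S : ShortComplex X.Modules) (x : X), S.ShortExact → IsClosed {x} →
      S.X₃ = pointSheaf x → HasFiniteLength S.X₁ → P S.X₁ → P S.X₂)
    {F : X.Modules} (hF : HasFiniteLength F) : P F := by
  induction h : totalLength F generalizing F with
  | zero => exact zero F (hF.totalLength_eq_zero_iff.1 h)
  | succ n ih =>
    obtain ⟨x, φ, hx, hφ⟩ := hF.exists_epi fun h0 => by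
      rw [hF.totalLength_eq_zero_iff.2 h0] at h
      exact absurd h (by simp)
    have hS := shortExact_of_epi φ
    have hK := hF.of_mono (kernel.ι φ)
    refine ext _ x hS hx rfl hK (ih hK ?_)
    have := totalLength_add hS hF
    simp only [totalLength_pointSheaf hx] at this ⊢
    exact Nat.succ_injective (this.symm.trans h)

/-- A subsheaf of full length is the whole sheaf. -/
lemma isIso_of_totalLength_le {F G : X.Modules} (hG : HasFiniteLength G) (φ : F ⟶ G) [Mono φ]
    (h : totalLength G ≤ totalLength F) : IsIso φ := by
  have h1 := totalLength_add (shortExact_of_mono φ) hG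
  have h2 : IsZero (cokernel φ) := by
    rw [← (hG.of_epi (cokernel.π φ)).totalLength_eq_zero_iff]
    simp only at h1
    omega
  have : Epi φ := Preadditive.epi_of_isZero_cokernel φ h2
  exact isIso_of_mono_of_epi φ

lemma totalLength_le_of_mono {F G : X.Modules} (hG : HasFiniteLength G) (φ : F ⟶ G) [Mono φ] :
    totalLength F ≤ totalLength G := by
  have h1 := totalLength_add (shortExact_of_mono φ) hG
  simp only at h1
  omega

/-- A chain of subobjects of `S.X₁` extends by the subobject `S.X₂`. -/
lemma height_add_one_le_of_shortExact {C : Type*} [Category C] [Abelian C] {S : ShortComplex C}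
    (hS : S.ShortExact) (h : ¬ IsZero S.X₃) :
    Order.height (⊤ : Subobject S.X₁) + 1 ≤ Order.height (⊤ : Subobject S.X₂) := by
  have := hS.mono_f
  have h1 : StrictMono (Subobject.map S.f).obj :=
    (Functor.monotone _).strictMono_of_injective (Subobject.map_obj_injective S.f)
  refine le_trans (add_le_add_left (Order.height_le_height_apply_of_strictMono _ h1 ⊤) 1)
    (Order.height_add_one_le (lt_top_iff_ne_top.2 fun ht => h ?_))
  rw [Subobject.map_top, ← Subobject.isIso_iff_mk_eq_top] at ht
  have := hS.epi_g
  rw [IsZero.iff_id_eq_zero, ← cancel_epi S.g, ← cancel_epi S.f]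
  simp

/-- The length is the sum of the lengths of the stalks. -/
lemma HasFiniteLength.length_eq {F : X.Modules} (hF : HasFiniteLength F) :
    length F = totalLength F := by
  suffices h : Order.height (⊤ : Subobject F) = totalLength F by rw [length, h]; rfl
  apply le_antisymm
  · have h1 : StrictMono fun S : Subobject F => totalLength (S : X.Modules) := by
      intro S T hST
      by_contra hlt
      have := isIso_of_totalLength_le (hF.of_mono T.arrow) (Subobject.ofLE S T hST.le)
        (not_lt.1 hlt)
      exact hST.not_ge (Subobject.le_of_comm (inv (Subobject.ofLE S T hST.le)) (by simp))
    refine (Order.height_le_height_apply_of_strictMono _ h1 ⊤).trans ?_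
    rw [Order.height_nat]
    exact_mod_cast (totalLength_eq_of_iso (asIso (⊤ : Subobject F).arrow)).le
  · refine hF.induction (P := fun F => (totalLength F : ℕ∞) ≤ Order.height (⊤ : Subobject F)) ?_ ?_
    · intro F h0
      rw [(hasFiniteLength_of_isZero h0).totalLength_eq_zero_iff.2 h0]
      simp
    · rintro S x hS hx h3 hf ih
      have h3' : HasFiniteLength S.X₃ := by rw [h3]; exact hasFiniteLength_pointSheaf hx
      have h := totalLength_add hS ((hasFiniteLength_iff_of_shortExact hS).2 ⟨hf, h3'⟩)
      rw [h3, totalLength_pointSheaf hx] at h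
      rw [h]
      push_cast
      refine le_trans (add_le_add_left ih 1) (height_add_one_le_of_shortExact hS fun h0 => ?_)
      rw [← h3'.totalLength_eq_zero_iff, h3, totalLength_pointSheaf hx] at h0
      exact one_ne_zero h0

end FiniteLength

/-! ### Restriction along open immersions -/

section Restrict
open TopologicalSpace

variable {X Y : Scheme.{0}} (j : Y ⟶ X) [IsOpenImmersion j] (F : X.Modules)

/-- The stalk of a sheaf and of its restriction along an open immersion. -/
def restrictStalk (y : Y) : Stalk (F.restrict j) y ≃+ Stalk F (j y) :=
  ((Scheme.Modules.restrictStalkNatIso j y).app F).addCommGroupIsoToAddEquiv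

/-- Sections of the restriction along an open immersion. -/
def restrictSec (U : Y.Opens) : Γ(F.restrict j, U) ≃+ Γ(F, j ''ᵁ U) :=
  (F.restrictAppIso j U).addCommGroupIsoToAddEquiv

variable {j F}

lemma restrictStalk_germ {U : Y.Opens} {y : Y} (hy : y ∈ U) (s : Γ(F.restrict j, U)) :
    restrictStalk j F y (germ (F.restrict j) hy s) =
      germ F (U := j ''ᵁ U) (by simpa) (restrictSec j F U s) :=
  congrArg (fun φ => φ.hom s) (Scheme.Modules.germ_restrictStalkNatIso_hom_app j y F hy)

lemma restrictSec_smul {U : Y.Opens} (a : Γ(X, j ''ᵁ U)) (s : Γ(F.restrict j, U)) :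
    restrictSec j F U ((j.appIso U).hom.hom a • s) = a • restrictSec j F U s := by
  have h := congrArg (fun φ => φ.hom s) (F.smul_restrictAppIso_hom j U ((j.appIso U).hom.hom a))
  have h2 : (j.appIso U).inv.hom ((j.appIso U).hom.hom a) = a := by
    change ((j.appIso U).hom ≫ (j.appIso U).inv).hom a = a
    rw [Iso.hom_inv_id]
    rfl
  exact h.trans (congrArg (fun b : Γ(X, j ''ᵁ U) => b • restrictSec j F U s) h2)

lemma stalkMap_germO {U : Y.Opens} {y : Y} (hy : y ∈ U) (a : Γ(X, j ''ᵁ U)) :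
    (j.stalkMap y).hom (germO (x := j y) (by simpa) a) = germO hy ((j.appIso U).hom.hom a) := by
  have h := congrArg (fun φ => φ.hom a) (j.germ_stalkMap (j ''ᵁ U) y (by simpa))
  refine Eq.trans h ?_
  rw [j.appIso_hom]
  exact (germO_resO (j.preimage_image_eq U).ge hy _).symm

lemma restrictStalk_smul {y : Y} (r : X.presheaf.stalk (j y)) (t : Stalk (F.restrict j) y) :
    restrictStalk j F y ((j.stalkMap y).hom r • t) = r • restrictStalk j F y t := by
  obtain ⟨U, hy, s, rfl⟩ := exists_germ_eq t
  obtain ⟨V, hV, a, rfl⟩ := exists_germO_eq r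
  have hW : y ∈ U ⊓ j ⁻¹ᵁ V := ⟨hy, hV⟩
  have hle : j ''ᵁ (U ⊓ j ⁻¹ᵁ V) ≤ V := by
    rintro _ ⟨z, hz, rfl⟩
    exact hz.2
  rw [← germ_res (F := F.restrict j) inf_le_left hW s,
    ← germO_resO hle (x := j y) (by simpa using hW) a, stalkMap_germO hW, ← germ_smul,
    restrictStalk_germ, restrictSec_smul, germ_smul, restrictStalk_germ]

/-- Restriction along an open immersion is an isomorphism on stalks, semilinear over the isomorphism
of local rings. -/
lemma stalkLength_restrict (y : Y) : stalkLength (F.restrict j) y = stalkLength F (j y) := by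
  let : Algebra (X.presheaf.stalk (j y)) (Y.presheaf.stalk y) := (j.stalkMap y).hom.toAlgebra
  let : Module (X.presheaf.stalk (j y)) (Stalk (F.restrict j) y) := .compHom _ (j.stalkMap y).hom
  have : IsScalarTower (X.presheaf.stalk (j y)) (Y.presheaf.stalk y) (Stalk (F.restrict j) y) :=
    .of_compHom _ _ _
  have h : Function.Surjective (algebraMap (X.presheaf.stalk (j y)) (Y.presheaf.stalk y)) :=
    ((ConcreteCategory.isIso_iff_bijective (j.stalkMap y)).1 inferInstance).2
  let e : Stalk (F.restrict j) y ≃ₗ[X.presheaf.stalk (j y)] Stalk F (j y) :=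
    { restrictStalk j F y with map_smul' := restrictStalk_smul }
  exact (Module.length_eq_of_surjective h).symm.trans e.length_eq

lemma mem_support_restrict {y : Y} : y ∈ support (F.restrict j) ↔ j y ∈ support F := by
  rw [← not_iff_not, ← stalkLength_eq_zero_iff, ← stalkLength_eq_zero_iff, stalkLength_restrict]

lemma HasFiniteLength.restrict (hF : HasFiniteLength F) : HasFiniteLength (F.restrict j) where
  finite_support := by
    have : support (F.restrict j) = j ⁻¹' support F := Set.ext fun y => mem_support_restrict
    rw [this]
    exact hF.finite_support.preimage j.isOpenEmbedding.injective.injOn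
  isClosed y hy := by
    have := (hF.isClosed _ (mem_support_restrict.1 hy)).preimage j.continuous
    rwa [← Set.image_singleton, Set.preimage_image_eq _ j.isOpenEmbedding.injective] at this
  stalkLength_ne_top y := by
    rw [stalkLength_restrict]
    exact hF.stalkLength_ne_top _

end Restrict

/-! ### Free sheaves -/

section Free
open TopologicalSpace

variable {X : Scheme.{0}} {F G : X.Modules}

/-- The germ of a global section. -/
def globalGerm (F : X.Modules) (x : X) : Γ(F, ⊤) →+ Stalk F x :=
  germ F (U := ⊤) (TopologicalSpace.Opens.mem_top x)

@[simp] lemma germ_res_top {U : X.Opens} {x : X} (hx : x ∈ U) (s : Γ(F, ⊤)) :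
    germ F hx (res F le_top s) = globalGerm F x s := germ_res _ _ _

@[simp] lemma stalkMap_globalGerm (φ : F ⟶ G) (x : X) (s : Γ(F, ⊤)) :
    stalkMap φ x (globalGerm F x s) = globalGerm G x (φ.app ⊤ s) := stalkMap_germ _ _ _

/-- The section `1` of the structure sheaf. -/
def unitOne (U : X.Opens) : Γ(structureSheaf X, U) := (1 : Γ(X, U))

lemma smul_unitOne {U : X.Opens} (a : Γ(structureSheaf X, U)) :
    (show Γ(X, U) from a) • unitOne U = a :=
  mul_one (show Γ(X, U) from a)

lemma res_unitOne {U V : X.Opens} (h : U ≤ V) : res (structureSheaf X) h (unitOne V) = unitOne U :=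
  map_one (resO h)

/-- The morphism from the structure sheaf that sends `1` to a global section. -/
def unitHom (v : Γ(F, ⊤)) : structureSheaf X ⟶ F :=
  homOfApp
    (fun U =>
      { toFun := fun a => (show Γ(X, U) from a) • res F le_top v
        map_zero' := zero_smul _ _
        map_add' := fun a b => add_smul (show Γ(X, U) from a) b _ })
    (fun U V h s => by
      have := res_smul h (show Γ(X, V) from s) (res F le_top v)
      rw [res_res] at this
      exact this.symm)
    (fun U a s => mul_smul a (show Γ(X, U) from s) _)

lemma unitHom_app_one (v : Γ(F, ⊤)) (U : X.Opens) :
    (unitHom v).app U (unitOne U) = res F le_top v := one_smul _ _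

lemma structureSheaf_hom_app (φ : structureSheaf X ⟶ F) {U : X.Opens}
    (a : Γ(structureSheaf X, U)) :
    φ.app U a = (show Γ(X, U) from a) • res F le_top (φ.app ⊤ (unitOne ⊤)) := by
  rw [← app_res, res_unitOne, ← φ.app_smul, smul_unitOne]

lemma structureSheaf_hom_ext {φ ψ : structureSheaf X ⟶ F}
    (h : φ.app ⊤ (unitOne ⊤) = ψ.app ⊤ (unitOne ⊤)) : φ = ψ := by
  ext U a
  rw [structureSheaf_hom_app, structureSheaf_hom_app ψ, h]

/-- The inclusion of a summand of a free sheaf. -/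
def freeι {I : Type} (i : I) : structureSheaf X ⟶ freeOn X I :=
  SheafOfModules.ιFree (R := X.ringCatSheaf) i

/-- The morphism from a free sheaf with given components. -/
def freeDesc {I : Type} (φ : I → (structureSheaf X ⟶ F)) : freeOn X I ⟶ F :=
  Cofan.IsColimit.desc (SheafOfModules.isColimitFreeCofan (R := X.ringCatSheaf) I) φ

@[simp]
lemma freeι_freeDesc {I : Type} (φ : I → (structureSheaf X ⟶ F)) (i : I) :
    freeι i ≫ freeDesc φ = φ i :=
  Cofan.IsColimit.fac (SheafOfModules.isColimitFreeCofan (R := X.ringCatSheaf) I) φ i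

lemma free_hom_ext {I : Type} {φ ψ : freeOn X I ⟶ F} (h : ∀ i, freeι i ≫ φ = freeι i ≫ ψ) :
    φ = ψ :=
  Cofan.IsColimit.hom_ext (SheafOfModules.isColimitFreeCofan (R := X.ringCatSheaf) I) _ _ h

/-- The projection of a free sheaf to a summand. -/
def freeπ {I : Type} [DecidableEq I] (i : I) : freeOn X I ⟶ structureSheaf X :=
  freeDesc fun k => if k = i then 𝟙 _ else 0

lemma freeι_freeπ {I : Type} [DecidableEq I] (i k : I) :
    freeι (X := X) k ≫ freeπ i = if k = i then 𝟙 _ else 0 :=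
  freeι_freeDesc _ _

lemma sum_freeπ_freeι {I : Type} [DecidableEq I] [Fintype I] :
    ∑ i : I, freeπ (X := X) i ≫ freeι i = 𝟙 _ := by
  refine free_hom_ext fun k => ?_
  rw [Preadditive.comp_sum, Finset.sum_eq_single k, ← Category.assoc, freeι_freeπ, if_pos rfl,
    Category.id_comp, Category.comp_id]
  · intro i _ hi
    rw [← Category.assoc, freeι_freeπ, if_neg hi.symm, zero_comp]
  · simp

/-- The components of a morphism from a free sheaf, as global sections. -/
def freeSec {I : Type} (φ : freeOn X I ⟶ F) (i : I) : Γ(F, ⊤) := (freeι i ≫ φ).app ⊤ (unitOne ⊤)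

/-- The image of a morphism from the structure sheaf is generated by the image of `1`. -/
lemma stalkMap_structureSheaf_mem_span (φ : structureSheaf X ⟶ F) (x : X)
    (t : Stalk (structureSheaf X) x) :
    stalkMap φ x t ∈ Submodule.span (X.presheaf.stalk x)
      {globalGerm F x (φ.app ⊤ (unitOne ⊤))} := by
  obtain ⟨U, hx, a, rfl⟩ := exists_germ_eq t
  rw [stalkMap_germ, structureSheaf_hom_app φ a, germ_smul, germ_res_top]
  exact Submodule.smul_mem _ _ (Submodule.mem_span_singleton_self _)

lemma stalkMap_sum {ι : Type*} (s : Finset ι) (φ : ι → (F ⟶ G)) (x : X) :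
    stalkMap (∑ i ∈ s, φ i) x = ∑ i ∈ s, stalkMap (φ i) x := by
  classical
  induction s using Finset.induction_on with
  | empty => simp
  | insert a s ha ih => rw [Finset.sum_insert ha, Finset.sum_insert ha, stalkMap_add, ih]

lemma range_stalkMap_le_span {I : Type} [Finite I] (φ : freeOn X I ⟶ F) (x : X) :
    LinearMap.range (stalkMap φ x) ≤ Submodule.span (X.presheaf.stalk x)
      (Set.range fun i => globalGerm F x (freeSec φ i)) := by
  classical
  have := Fintype.ofFinite I
  rintro _ ⟨t, rfl⟩
  have h : φ = ∑ i : I, freeπ i ≫ freeι i ≫ φ := by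
    conv_lhs => rw [← Category.id_comp φ, ← sum_freeπ_freeι, Preadditive.sum_comp]
    simp
  rw [h, stalkMap_sum, LinearMap.sum_apply]
  refine Submodule.sum_mem _ fun i _ => ?_
  rw [stalkMap_comp, LinearMap.comp_apply, ← h]
  refine Submodule.span_mono ?_ (stalkMap_structureSheaf_mem_span (freeι i ≫ φ) x _)
  exact Set.singleton_subset_iff.2 ⟨i, rfl⟩

end Free

/-! ### Local generators and local presentations -/

section Local
open TopologicalSpace

variable {X : Scheme.{0}} {F G : X.Modules}

/-- The structure sheaf of `U` is the restriction of the structure sheaf of `X`. -/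
def overUnitIso (U : X.Opens) :
    SheafOfModules.unit (U : Scheme.{0}).ringCatSheaf ≅
      (Scheme.Modules.overEquiv U).functor.obj (SheafOfModules.unit (X.ringCatSheaf.over U)) :=
  (Scheme.Modules.restrictUnitIso U.ι).symm ≪≫
    ((Scheme.Modules.overFunctorEquiv U).app (SheafOfModules.unit X.ringCatSheaf)).symm

/-- Sheaves of modules on the slice site of `U` as sheaves of modules on the scheme `U`. -/
def overFunctor (U : X.Opens) :
    SheafOfModules (X.ringCatSheaf.over U) ⥤ SheafOfModules (U : Scheme.{0}).ringCatSheaf :=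
  (Scheme.Modules.overEquiv U).functor

/-- Sheaves of modules on the scheme `U` as sheaves of modules on the slice site of `U`. -/
def overInverse (U : X.Opens) :
    SheafOfModules (U : Scheme.{0}).ringCatSheaf ⥤ SheafOfModules (X.ringCatSheaf.over U) :=
  (Scheme.Modules.overEquiv U).inverse

instance (U : X.Opens) : PreservesColimitsOfSize.{0, 0} (overFunctor U) :=
  inferInstanceAs (PreservesColimitsOfSize.{0, 0} (Scheme.Modules.overEquiv U).functor)

instance (U : X.Opens) : PreservesColimitsOfSize.{0, 0} (overInverse U) :=
  inferInstanceAs (PreservesColimitsOfSize.{0, 0} (Scheme.Modules.overEquiv U).inverse)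

/-- A sheaf of finite type is locally a quotient of a finite free sheaf. -/
lemma exists_epi_of_isFiniteType (hF : SheafOfModules.IsFiniteType (R := X.ringCatSheaf) F)
    (x : X) : ∃ (U : X.Opens) (_ : x ∈ U) (I : Type) (_ : Finite I)
      (φ : freeOn (U : Scheme.{0}) I ⟶ F.restrict U.ι), Epi φ := by
  obtain ⟨σ, hσ⟩ := hF.exists_localGeneratorsData
  have hc := σ.coversTop
  rw [Opens.coversTop_iff, IsOpenCover] at hc
  obtain ⟨i, hi⟩ := Opens.mem_iSup.1 (hc.ge (Opens.mem_top x))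
  have := hσ.isFiniteType i
  let U : X.Opens := σ.X i
  let γ : (F.over U).GeneratingSections := σ.generators i
  let A : (U : Scheme.{0}).Modules := (overFunctor U).obj (F.over U)
  let e : A ≅ F.restrict U.ι := (Scheme.Modules.overFunctorEquiv U).app F
  let g := γ.map (overFunctor U) (overUnitIso U)
  have hg : Finite g.I := inferInstanceAs (Finite (σ.generators i).I)
  let φ : freeOn (U : Scheme.{0}) g.I ⟶ A := g.π
  have : Epi φ := g.epi
  exact ⟨U, hi, g.I, hg, φ ≫ e.hom, epi_comp φ e.hom⟩

/-- Presentations on the open subscheme `U` are presentations on the slice site of `U`. -/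
lemma exists_finite_presentation_over {U : X.Opens} (P : SheafOfModules.Presentation
      (R := (U : Scheme.{0}).ringCatSheaf) (F.restrict U.ι)) (hP : P.IsFinite) :
    ∃ P : (F.over U).Presentation, P.IsFinite := by
  let e : (overInverse U).obj (F.restrict U.ι) ≅ F.over U :=
    (Scheme.Modules.overEquiv U).inverse.mapIso
      ((Scheme.Modules.overFunctorEquiv U).app F).symm ≪≫
      (Scheme.Modules.overEquiv U).unitIso.symm.app (F.over U)
  let η : SheafOfModules.unit (X.ringCatSheaf.over U) ≅
      (overInverse U).obj (SheafOfModules.unit (U : Scheme.{0}).ringCatSheaf) :=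
    (Scheme.Modules.overEquiv U).unitIso.app _ ≪≫
      (Scheme.Modules.overEquiv U).inverse.mapIso (overUnitIso U).symm
  exact ⟨(P.map (overInverse U) η).ofIsIso e.hom,
    ⟨⟨hP.isFiniteType_generators.finite⟩, ⟨hP.isFiniteType_relations.finite⟩⟩⟩

/-- Being of finite presentation can be checked on the open subschemes of a cover. -/
lemma isFinitePresentation_of_local
    (h : ∀ x : X, ∃ (U : X.Opens) (_ : x ∈ U) (P : SheafOfModules.Presentation
      (R := (U : Scheme.{0}).ringCatSheaf) (F.restrict U.ι)), P.IsFinite) :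
    SheafOfModules.IsFinitePresentation (R := X.ringCatSheaf) F := by
  choose U hU P hP using h
  choose Q hQ using fun x => exists_finite_presentation_over (P x) (hP x)
  have hc : (Opens.grothendieckTopology X).CoversTop U := by
    rw [Opens.coversTop_iff, IsOpenCover]
    exact top_le_iff.1 fun x _ => Opens.mem_iSup.2 ⟨x, hU x⟩
  let q : SheafOfModules.QuasicoherentData (R := X.ringCatSheaf) F := ⟨X, U, hc, Q⟩
  exact ⟨q, ⟨hQ⟩⟩

/-- A sheaf of modules on a noetherian affine scheme that comes from a finite module has a finite
presentation. -/
lemma exists_finite_presentation {A : CommRingCat.{0}} [IsNoetherianRing A]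
    (M : (Spec A).Modules) [IsIso M.fromTildeΓ] [Module.Finite A Γ(M, ⊤)] :
    ∃ P : SheafOfModules.Presentation (R := (Spec A).ringCatSheaf) M, P.IsFinite := by
  let N : ModuleCat A := (modulesSpecToSheaf.obj M).presheaf.obj (.op ⊤)
  have : Module.Finite A N := ‹Module.Finite A Γ(M, ⊤)›
  obtain ⟨s, hs⟩ := (Module.finite_def (R := A) (M := N)).1 inferInstance
  obtain ⟨t, ht⟩ := (inferInstance : IsNoetherian A ((s : Set N) →₀ A)).noetherian
    (LinearMap.ker (Finsupp.linearCombination A (Subtype.val : ↥(s : Set N) → N)))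
  let P := presentationTilde N s hs t ht
  have : P.IsFinite := ⟨⟨inferInstanceAs (Finite (s : Set N))⟩,
    ⟨inferInstanceAs (Finite (t : Set ((s : Set N) →₀ A)))⟩⟩
  have : IsIso (C := SheafOfModules (Spec A).ringCatSheaf) M.fromTildeΓ := ‹IsIso M.fromTildeΓ›
  exact ⟨SheafOfModules.Presentation.ofIsIso (R := (Spec A).ringCatSheaf) M.fromTildeΓ P,
    ⟨⟨‹P.IsFinite›.isFiniteType_generators.finite⟩, ⟨‹P.IsFinite›.isFiniteType_relations.finite⟩⟩⟩

/-- A sheaf that comes from a finite module on a noetherian affine open subset has a finite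
presentation there. -/
lemma exists_finite_presentation_restrict {U : X.Opens} (hU : IsAffineOpen U)
    [IsNoetherianRing Γ(X, U)] [IsIso (F.restrict hU.fromSpec).fromTildeΓ]
    [Module.Finite Γ(X, U) Γ(F.restrict hU.fromSpec, ⊤)] :
    ∃ P : SheafOfModules.Presentation (R := (U : Scheme.{0}).ringCatSheaf) (F.restrict U.ι),
      P.IsFinite := by
  obtain ⟨P, hP⟩ := exists_finite_presentation (F.restrict hU.fromSpec)
  have h : hU.isoSpec.hom ≫ hU.fromSpec = U.ι := by simp
  let e : (F.restrict hU.fromSpec).restrict hU.isoSpec.hom ≅ F.restrict U.ι :=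
    (Scheme.Modules.restrictFunctorComp _ _).symm.app F ≪≫
      (Scheme.Modules.restrictFunctorCongr h).app F
  let Q := (Scheme.Modules.presentationRestrict hU.isoSpec.hom P)
  have : IsIso (C := SheafOfModules (U : Scheme.{0}).ringCatSheaf) e.hom :=
    (inferInstance : IsIso e.hom)
  exact ⟨SheafOfModules.Presentation.ofIsIso (R := (U : Scheme.{0}).ringCatSheaf) e.hom Q,
    ⟨⟨hP.isFiniteType_generators.finite⟩, ⟨hP.isFiniteType_relations.finite⟩⟩⟩

end Local

/-! ### Modules of finite length over a noetherian local ring -/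

section Algebra

/-- A finite module over a noetherian local ring has finite length if every element of the maximal
ideal acts locally nilpotently. By dévissage, the module is `R ⧸ p` with `p` prime, and then `p` is
the maximal ideal. -/
lemma length_ne_top_of_forall_pow_smul_eq_zero {R M : Type*} [CommRing R] [IsLocalRing R]
    [IsNoetherianRing R] [AddCommGroup M] [Module R M] [hM : Module.Finite R M]
    (h : ∀ r ∈ IsLocalRing.maximalIdeal R, ∀ m : M, ∃ n : ℕ, r ^ n • m = 0) :
    Module.length R M ≠ ⊤ := by
  induction hM using IsNoetherianRing.induction_on_isQuotientEquivQuotientPrime R with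
  | subsingleton N => rw [Module.length_eq_zero]; simp
  | quotient N p e =>
    have hp : p.1 = IsLocalRing.maximalIdeal R := by
      refine le_antisymm (IsLocalRing.le_maximalIdeal p.2.ne_top) fun r hr => ?_
      obtain ⟨n, hn⟩ := h r hr (e.symm 1)
      have h1 : (Ideal.Quotient.mk p.1 (r ^ n)) = 0 := by
        have := congrArg e hn
        rw [map_smul, e.apply_symm_apply, map_zero, Algebra.smul_def, mul_one] at this
        exact this
      exact p.2.mem_of_pow_mem n (Ideal.Quotient.eq_zero_iff_mem.1 h1)
    have hmax : p.1.IsMaximal := by rw [hp]; infer_instance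
    have : IsSimpleModule R N := isSimpleModule_iff_quot_maximal.2 ⟨p.1, hmax, ⟨e⟩⟩
    rw [Module.length_eq_one]
    simp
  | exact N₁ N₂ N₃ f g hf hg hfg h₁ h₃ =>
    rw [Module.length_eq_add_of_exact f g hf hg hfg]
    refine WithTop.add_ne_top.2 ⟨h₁ fun r hr m => ?_, h₃ fun r hr m => ?_⟩
    · obtain ⟨n, hn⟩ := h r hr (f m)
      exact ⟨n, hf (by rw [map_smul, hn, map_zero])⟩
    · obtain ⟨m, rfl⟩ := hg m
      obtain ⟨n, hn⟩ := h r hr m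
      exact ⟨n, by rw [← map_smul, hn, map_zero]⟩

/-- Elements of the maximal ideal act locally nilpotently on modules of finite length. -/
lemma exists_pow_smul_eq_zero_of_length_ne_top {R M : Type*} [CommRing R] [IsLocalRing R]
    [AddCommGroup M] [Module R M] (hM : Module.length R M ≠ ⊤) {r : R}
    (hr : r ∈ IsLocalRing.maximalIdeal R) (m : M) : ∃ n : ℕ, r ^ n • m = 0 := by
  rw [Module.length_ne_top_iff] at hM
  induction hM with
  | of_subsingleton => exact ⟨0, Subsingleton.elim _ _⟩
  | of_simple_quotient _ ih =>
    rename_i M _ _ N hs _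
    obtain ⟨I, hI, ⟨e⟩⟩ := isSimpleModule_iff_quot_maximal.1 hs
    have h1 : N.mkQ (r • m) = 0 := by
      apply e.injective
      have hr' : r ∈ I := (IsLocalRing.eq_maximalIdeal hI) ▸ hr
      obtain ⟨a, ha⟩ := Ideal.Quotient.mk_surjective (e (N.mkQ m))
      rw [map_zero, map_smul, map_smul, ← ha]
      exact Ideal.Quotient.eq_zero_iff_mem.2 (Ideal.mul_mem_right _ _ hr')
    obtain ⟨n, hn⟩ := ih ⟨r • m, (Submodule.Quotient.mk_eq_zero N).1 h1⟩
    refine ⟨n + 1, ?_⟩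
    rw [pow_succ, mul_smul]
    exact congrArg Subtype.val hn

end Algebra

/-! ### Sections over open sets that contain one point of the support -/

section Sections
open TopologicalSpace

variable {X : Scheme.{0}} {F G : X.Modules}

lemma subsingleton_sections {U : X.Opens} (h : ∀ y ∈ U, y ∉ support F) :
    Subsingleton Γ(F, U) := by
  refine ⟨fun s t => section_ext fun y hy => ?_⟩
  have := notMem_support.1 (h y hy)
  exact Subsingleton.elim _ _

lemma germ_injective_of_support {U : X.Opens} {x : X} (hx : x ∈ U)
    (h : ∀ y ∈ U, y ∈ support F → y = x) : Function.Injective (germ F hx) := by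
  intro s t hst
  refine section_ext fun y hy => ?_
  by_cases hyx : y = x
  · subst hyx
    exact hst
  · have := notMem_support.1 (fun h' => hyx (h y hy h'))
    exact Subsingleton.elim _ _

/-- A germ at a closed point of the support extends by zero over an open set without other points of
the support. -/
lemma germ_surjective_of_support {U : X.Opens} {x : X} (hx : x ∈ U) (hc : IsClosed {x})
    (h : ∀ y ∈ U, y ∈ support F → y = x) : Function.Surjective (germ F hx) := by
  intro t
  obtain ⟨W, hW, s, rfl⟩ := exists_germ_eq t
  let V : X.Opens := U ⊓ ⟨{x}ᶜ, hc.isOpen_compl⟩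
  have hWU : x ∈ U ⊓ W := ⟨hx, hW⟩
  have hsub : Subsingleton Γ(F, (U ⊓ W) ⊓ V) :=
    subsingleton_sections fun y hy hy' => hy.2.2 (h y hy.1.1 hy')
  obtain ⟨u, hu, -⟩ := exists_glue (F := F) (U := U ⊓ W) (V := V) (W := U) inf_le_left inf_le_left
    (fun y hy => by
      by_cases hyx : y = x
      · subst hyx
        exact Or.inl hWU
      · exact Or.inr ⟨hy, hyx⟩) (res F inf_le_right s) 0 (Subsingleton.elim _ _)
  refine ⟨u, ?_⟩
  rw [← germ_res (F := F) inf_le_left hWU u, hu, germ_res]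

lemma res_bijective_of_support {U V : X.Opens} (hUV : U ≤ V) {x : X} (hx : x ∈ U)
    (hc : IsClosed {x}) (h : ∀ y ∈ V, y ∈ support F → y = x) :
    Function.Bijective (res F hUV) := by
  have e : germ F hx ∘ res F hUV = germ F (hUV hx) := funext fun s => germ_res _ _ _
  have h' : ∀ y ∈ U, y ∈ support F → y = x := fun y hy => h y (hUV hy)
  have hb : Function.Bijective (germ F (hUV hx)) :=
    ⟨germ_injective_of_support _ h, germ_surjective_of_support _ hc h⟩
  rw [← e] at hb
  exact (Function.Bijective.of_comp_iff' ⟨germ_injective_of_support _ h',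
    germ_surjective_of_support _ hc h'⟩ _).1 hb

/-- Elements of the residue field at a closed point lift to functions on an affine neighbourhood. -/
lemma exists_residue_eq {U : X.Opens} (hU : IsAffineOpen U) {x : X} (hx : x ∈ U)
    (hc : IsClosed {x}) (c : X.residueField x) :
    ∃ a : Γ(X, U), X.residue x (germO hx a) = c := by
  obtain ⟨r, rfl⟩ := IsLocalRing.residue_surjective c
  have hmax := hU.primeIdealOf_isMaximal_of_isClosed ⟨x, hx⟩ hc
  let : Algebra Γ(X, U) (X.presheaf.stalk x) := (germO hx).toAlgebra
  have hloc : IsLocalization.AtPrime (X.presheaf.stalk x) (hU.primeIdealOf ⟨x, hx⟩).asIdeal :=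
    hU.isLocalization_stalk ⟨x, hx⟩
  obtain ⟨a, s, rfl⟩ := IsLocalization.exists_mk'_eq
    (hU.primeIdealOf ⟨x, hx⟩).asIdeal.primeCompl r
  obtain ⟨b, i, hi, hb⟩ := hmax.exists_inv s.2
  refine ⟨a * b, ?_⟩
  change IsLocalRing.residue _ (algebraMap _ _ (a * b)) = IsLocalRing.residue _ _
  rw [← sub_eq_zero, ← map_sub, IsLocalRing.residue_eq_zero_iff]
  have h1 : algebraMap Γ(X, U) (X.presheaf.stalk x) i ∈ IsLocalRing.maximalIdeal _ :=
    (IsLocalization.AtPrime.to_map_mem_maximal_iff _ _ _).2 hi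
  have h2 := IsLocalization.mk'_spec (X.presheaf.stalk x) a s
  have h3 := congrArg (algebraMap Γ(X, U) (X.presheaf.stalk x)) hb
  rw [map_add, map_mul, map_one] at h3
  have h4 : algebraMap Γ(X, U) (X.presheaf.stalk x) (a * b) - IsLocalization.mk' _ a s =
      -IsLocalization.mk' (X.presheaf.stalk x) a s * algebraMap Γ(X, U) (X.presheaf.stalk x) i := by
    rw [map_mul, ← h2]
    linear_combination (IsLocalization.mk' (X.presheaf.stalk x) a s) * h3
  rw [h4]
  exact Ideal.mul_mem_left _ _ h1

/-- The linear map on sections over `U` induced by a morphism of sheaves of modules. -/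
def appLinear (φ : F ⟶ G) (U : X.Opens) : Γ(F, U) →ₗ[Γ(X, U)] Γ(G, U) where
  toFun := φ.app U
  map_add' := map_add (φ.app U).hom
  map_smul' := φ.app_smul

lemma isNoetherian_sections_pointSheaf {U : X.Opens} (hU : IsAffineOpen U)
    [IsNoetherianRing Γ(X, U)] {x : X} (hc : IsClosed {x}) :
    IsNoetherian Γ(X, U) Γ(pointSheaf x, U) := by
  by_cases hx : x ∈ U
  · refine isNoetherian_of_surjective (M := Γ(X, U))
      (LinearMap.toSpanSingleton Γ(X, U) Γ(pointSheaf x, U) (pointSection x U 1)) ?_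
    rw [LinearMap.range_eq_top]
    intro s
    obtain ⟨c, rfl⟩ := (pointSection_bijective x hx).2 s
    obtain ⟨a, rfl⟩ := exists_residue_eq hU hx hc c
    refine ⟨a, ?_⟩
    rw [LinearMap.toSpanSingleton_apply, smul_pointSection x hx, mul_one]
  · have := (isSkyscraper_pointSheaf x).subsingleton U hx
    infer_instance

/-- The sections of a sheaf of finite length over an affine open form a finite module. -/
lemma HasFiniteLength.finite_sections {U : X.Opens} (hU : IsAffineOpen U)
    [IsNoetherianRing Γ(X, U)] (hF : HasFiniteLength F) : Module.Finite Γ(X, U) Γ(F, U) := by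
  refine hF.induction (P := fun F => Module.Finite Γ(X, U) Γ(F, U)) (fun F hF => ?_) ?_
  · have := subsingleton_sections (F := F) (U := U)
      fun y _ => notMem_support.2 ((isZero_iff_stalk F).1 hF y)
    infer_instance
  · intro S x hS hc h3 _ h1
    have := hS.mono_f
    have : IsNoetherian Γ(X, U) Γ(S.X₃, U) := by
      rw [h3]
      exact isNoetherian_sections_pointSheaf hU hc
    refine ⟨Submodule.fg_of_fg_map_of_fg_inf_ker (appLinear S.g U) (IsNoetherian.noetherian _) ?_⟩
    have h : ⊤ ⊓ LinearMap.ker (appLinear S.g U) = (⊤ : Submodule _ _).map (appLinear S.f U) := by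
      rw [top_inf_eq, Submodule.map_top]
      ext t
      constructor
      · intro ht
        obtain ⟨s, hs⟩ := exists_app_eq_of_exact hS.exact U t ht
        exact ⟨s, hs⟩
      · rintro ⟨s, rfl⟩
        exact congrArg (fun φ => φ.app U s) S.zero
    rw [h]
    exact h1.1.map _

end Sections

/-! ### Coherent sheaves with zero-dimensional support -/

section CohZero
open TopologicalSpace

/-- A basic open subset of an affine scheme. -/
def specBasic {A : CommRingCat.{0}} (a : A) : (Spec A).Opens := PrimeSpectrum.basicOpen a

lemma mem_maximalIdeal_germ_iff {A : CommRingCat.{0}} (x : Spec A) (a : A) :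
    germO (U := ⊤) (Opens.mem_top x) ((Scheme.ΓSpecIso A).inv.hom a) ∈
      IsLocalRing.maximalIdeal ((Spec A).presheaf.stalk x) ↔ x ∉ specBasic a := by
  rw [specBasic, ← basicOpen_eq_of_affine, IsLocalRing.mem_maximalIdeal, mem_nonunits_iff,
    not_iff_not]
  exact ((Spec A).mem_basicOpen _ x (Opens.mem_top x)).symm

/-- The action of `A` on the global sections of a sheaf of modules on `Spec A` is the one through
`Γ(Spec A, 𝒪)`. -/
lemma smul_Spec (A : CommRingCat.{0}) {M : (Spec A).Modules} (a : A) (s : Γ(M, ⊤)) :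
    a • s = ((Scheme.ΓSpecIso A).inv.hom a) • s := by
  rw [Scheme.Modules.smul_Spec_def]
  refine congrArg (fun b : Γ(Spec A, ⊤) => b • s) ?_
  exact congrArg (fun φ : Γ(Spec A, ⊤) ⟶ Γ(Spec A, ⊤) => φ.hom _)
    ((Spec A).presheaf.map_id (.op ⊤))

lemma germ_pow_smul {A : CommRingCat.{0}} {M : (Spec A).Modules} (x : Spec A) (a : A)
    (s : Γ(M, ⊤)) (n : ℕ) : globalGerm M x (a ^ n • s) =
      germO (U := ⊤) (Opens.mem_top x) ((Scheme.ΓSpecIso A).inv.hom a) ^ n • globalGerm M x s := by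
  rw [smul_Spec, globalGerm, germ_smul, map_pow, map_pow]

/-- A sheaf of finite length on an affine scheme with at most one point in its support is
quasi-coherent. -/
lemma isIso_fromTildeΓ_of_hasFiniteLength {A : CommRingCat.{0}} (M : (Spec A).Modules)
    (hM : HasFiniteLength M) (h : (support M).Subsingleton) : IsIso M.fromTildeΓ := by
  rw [isIso_fromTildeΓ_iff_isLocalizing]
  intro f
  rcases h.eq_empty_or_singleton with h0 | ⟨x, h⟩
  · have hs (U : (Spec A).Opens) : Subsingleton Γ(M, U) :=
      subsingleton_sections fun y _ hy' => by simp [h0] at hy'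
    have := hs ⊤
    have := hs (specBasic f)
    exact IsLocalizedModule.Away.mk_of_addCommGroup
      (M.isUnit_algebraMap_end_of_le_basicOpen f le_rfl)
      (fun s => ⟨0, 0, Subsingleton.elim (α := Γ(M, specBasic f)) _ _⟩)
      (fun s _ => ⟨0, Subsingleton.elim (α := Γ(M, ⊤)) _ _⟩)
  have hc := hM.isClosed x (h ▸ rfl)
  replace h := h.subset
  have h' (U : (Spec A).Opens) : ∀ y ∈ U, y ∈ support M → y = x := fun y _ hy => h hy
  refine IsLocalizedModule.Away.mk_of_addCommGroup
    (M.isUnit_algebraMap_end_of_le_basicOpen f le_rfl) ?_ ?_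
  · intro (s : Γ(M, specBasic f))
    by_cases hx : x ∈ specBasic f
    · obtain ⟨t, ht⟩ := (res_bijective_of_support (F := M) (le_top : specBasic f ≤ ⊤)
        hx hc (h' _)).2 s
      have h0 : f ^ 0 • s = res M le_top t := by rw [pow_zero, one_smul, ht]
      exact ⟨0, t, h0⟩
    · have : Subsingleton Γ(M, specBasic f) :=
        subsingleton_sections fun y hy hy' => hx (h hy' ▸ hy)
      exact ⟨0, 0, Subsingleton.elim (α := Γ(M, specBasic f)) _ _⟩
  · intro (s : Γ(M, ⊤)) hs
    change res M (le_top : specBasic f ≤ ⊤) s = 0 at hs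
    by_cases hx : x ∈ specBasic f
    · have h0 : f ^ 0 • s = 0 := by
        rw [pow_zero, one_smul]
        exact (res_bijective_of_support (F := M) (le_top : specBasic f ≤ ⊤)
          hx hc (h' _)).1 (hs.trans (map_zero _).symm)
      exact ⟨0, h0⟩
    · obtain ⟨n, hn⟩ := exists_pow_smul_eq_zero_of_length_ne_top (hM.stalkLength_ne_top x)
        ((mem_maximalIdeal_germ_iff x f).2 hx) (globalGerm M x s)
      refine ⟨n, ?_⟩
      apply germ_injective_of_support (F := M) (Opens.mem_top x) (h' _)
      exact (germ_pow_smul x f s n).trans (hn.trans (map_zero _).symm)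

/-- On an affine noetherian scheme, a quasi-coherent sheaf with finitely generated stalk at `x` and
support `{x}`, where `x` is closed, has finite length. -/
lemma stalkLength_ne_top_of_isIso_fromTildeΓ {A : CommRingCat.{0}} [IsNoetherianRing A]
    (M : (Spec A).Modules) [hM : IsIso M.fromTildeΓ] (x : Spec A) (hc : IsClosed {x})
    (h : support M ⊆ {x}) [Module.Finite ((Spec A).presheaf.stalk x) (Stalk M x)] :
    stalkLength M x ≠ ⊤ := by
  rw [isIso_fromTildeΓ_iff_isLocalizing] at hM
  refine length_ne_top_of_forall_pow_smul_eq_zero fun r hr t => ?_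
  obtain ⟨s, rfl⟩ := germ_surjective_of_support (F := M) (U := ⊤) (Opens.mem_top x) hc
    (fun y _ hy => h hy) t
  let p : PrimeSpectrum A := x
  let : Algebra A ((Spec A).presheaf.stalk x) :=
    ((germO (U := ⊤) (Opens.mem_top x)).comp (Scheme.ΓSpecIso A).inv.hom).toAlgebra
  have hloc : IsLocalization.AtPrime ((Spec A).presheaf.stalk x) p.asIdeal :=
    StructureSheaf.IsLocalization.to_stalk A x
  obtain ⟨⟨a, u⟩, hau⟩ := IsLocalization.surj p.asIdeal.primeCompl r
  have hu := IsLocalization.map_units ((Spec A).presheaf.stalk x) u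
  have ha : x ∉ specBasic a := by
    rw [← mem_maximalIdeal_germ_iff]
    exact hau ▸ Ideal.mul_mem_right _ _ hr
  have : Subsingleton Γ(M, specBasic a) :=
    subsingleton_sections fun y hy hy' => ha (h hy' ▸ hy)
  obtain ⟨⟨_, n, rfl⟩, hn⟩ := (hM a).exists_of_eq (x₁ := s) (x₂ := 0)
    (Subsingleton.elim (α := Γ(M, specBasic a)) _ _)
  have h0 : a ^ n • s = 0 := hn.trans (smul_zero _)
  refine ⟨n, ?_⟩
  have h1 := germ_pow_smul x a s n
  rw [h0, map_zero] at h1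
  have h2 : germO (U := ⊤) (Opens.mem_top x) ((Scheme.ΓSpecIso A).inv.hom a) =
      algebraMap A ((Spec A).presheaf.stalk x) u * r := hau.symm.trans (mul_comm _ _)
  rw [h2, mul_pow, mul_smul] at h1
  exact (hu.pow n).smul_eq_zero.1 h1.symm

end CohZero

section CohZero
open TopologicalSpace

variable {X : Scheme.{0}} {F : X.Modules}

/-- A sheaf of finite type is locally generated by finitely many sections. -/
lemma exists_generators (hF : SheafOfModules.IsFiniteType (R := X.ringCatSheaf) F) (x : X) :
    ∃ (U : X.Opens) (_ : x ∈ U) (I : Type) (_ : Finite I) (s : I → Γ(F, U)),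
      ∀ (y : X) (hy : y ∈ U), Submodule.span (X.presheaf.stalk y)
        (Set.range fun i => germ F hy (s i)) = ⊤ := by
  obtain ⟨U, hU, I, hI, φ, hφ⟩ := exists_epi_of_isFiniteType hF x
  refine ⟨U.ι ''ᵁ ⊤, ⟨⟨x, hU⟩, trivial, rfl⟩, I, hI, fun i => restrictSec U.ι F ⊤ (freeSec φ i), ?_⟩
  rintro _ ⟨y, -, rfl⟩
  rw [eq_top_iff]
  rintro t -
  obtain ⟨t, rfl⟩ := (restrictStalk U.ι F y).surjective t
  have ht : t ∈ Submodule.span ((U : Scheme.{0}).presheaf.stalk y)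
      (Set.range fun i => globalGerm (F.restrict U.ι) y (freeSec φ i)) :=
    range_stalkMap_le_span φ y (stalkMap_surjective_of_epi φ y t)
  induction ht using Submodule.span_induction with
  | mem t ht =>
    obtain ⟨i, rfl⟩ := ht
    exact Submodule.subset_span ⟨i, (restrictStalk_germ (Opens.mem_top y) _).symm⟩
  | zero => rw [map_zero]; exact zero_mem _
  | add t u _ _ ht hu => rw [map_add]; exact add_mem ht hu
  | smul r t _ ht =>
    obtain ⟨r, rfl⟩ := ((ConcreteCategory.isIso_iff_bijective (U.ι.stalkMap y)).1 inferInstance).2 r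
    exact (restrictStalk_smul r t).symm ▸ Submodule.smul_mem _ _ ht

/-- The support of a sheaf of finite type is closed: where the finitely many generators vanish, the
sheaf vanishes. -/
lemma isClosed_support (hF : SheafOfModules.IsFiniteType (R := X.ringCatSheaf) F) :
    IsClosed (support F) := by
  rw [← isOpen_compl_iff, isOpen_iff_forall_mem_open]
  intro x hx
  have := notMem_support.1 hx
  obtain ⟨U, hU, I, hI, s, hs⟩ := exists_generators hF x
  have h (i : I) : ∃ (W : X.Opens) (_ : x ∈ W) (h : W ≤ U), res F h (s i) = 0 :=
    exists_res_eq_zero hU (Subsingleton.elim _ _)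
  choose W hW hWU hW0 using h
  refine ⟨U ∩ ⋂ i, W i, fun y hy => ?_, U.isOpen.inter (isOpen_iInter_of_finite fun i =>
    (W i).isOpen), hU, Set.mem_iInter.2 hW⟩
  rw [Set.mem_compl_iff, notMem_support, ← Submodule.subsingleton_iff (X.presheaf.stalk y)]
  refine subsingleton_of_bot_eq_top ?_
  rw [← hs y hy.1, eq_comm, Submodule.span_eq_bot]
  rintro _ ⟨i, rfl⟩
  change germ F _ (s i) = 0
  rw [← germ_res (hWU i) (Set.mem_iInter.1 hy.2 i), hW0, map_zero]

lemma finite_stalk (hF : SheafOfModules.IsFiniteType (R := X.ringCatSheaf) F) (x : X) :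
    Module.Finite (X.presheaf.stalk x) (Stalk F x) := by
  obtain ⟨U, hU, I, hI, s, hs⟩ := exists_generators hF x
  rw [Module.finite_def, ← hs x hU]
  exact Submodule.fg_span (Set.finite_range _)

lemma finite_stalk_restrict {Y : Scheme.{0}} (j : Y ⟶ X) [IsOpenImmersion j] (y : Y)
    [hF : Module.Finite (X.presheaf.stalk (j y)) (Stalk F (j y))] :
    Module.Finite (Y.presheaf.stalk y) (Stalk (F.restrict j) y) := by
  let : Algebra (X.presheaf.stalk (j y)) (Y.presheaf.stalk y) := (j.stalkMap y).hom.toAlgebra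
  let : Module (X.presheaf.stalk (j y)) (Stalk (F.restrict j) y) := .compHom _ (j.stalkMap y).hom
  have : IsScalarTower (X.presheaf.stalk (j y)) (Y.presheaf.stalk y) (Stalk (F.restrict j) y) :=
    .of_compHom _ _ _
  let e : Stalk (F.restrict j) y ≃ₗ[X.presheaf.stalk (j y)] Stalk F (j y) :=
    { restrictStalk j F y with map_smul' := restrictStalk_smul }
  have : Module.Finite (X.presheaf.stalk (j y)) (Stalk (F.restrict j) y) := .equiv e.symm
  exact Module.Finite.of_restrictScalars_finite (X.presheaf.stalk (j y)) _ _

/-- A closed subset of dimension zero of a noetherian sober space is a finite set of closed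
points. -/
lemma finite_of_topologicalKrullDim_le_zero {T : Type*} [TopologicalSpace T] [T0Space T]
    [NoetherianSpace T] {S : Set T} (hS : IsClosed S) (h : topologicalKrullDim S ≤ 0) :
    S.Finite ∧ ∀ x ∈ S, IsClosed {x} := by
  have hmax := Order.krullDim_nonpos_iff_forall_isMax.1 h
  let c (x : S) : IrreducibleCloseds S := ⟨closure {x}, isIrreducible_singleton.closure,
    isClosed_closure⟩
  have hT1 (x y : S) (hxy : y ∈ closure {x}) : x = y := by
    have h1 : c y ≤ c x := closure_minimal (Set.singleton_subset_iff.2 hxy) isClosed_closure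
    have h2 : c x ≤ c y := hmax (c y) h1
    have h3 : closure {x} = closure {y} := congrArg IrreducibleCloseds.carrier (le_antisymm h2 h1)
    exact ((inseparable_iff_closure_eq).2 h3).eq
  have hc (x : S) : IsClosed {x} := by
    rw [← closure_subset_iff_isClosed]
    exact fun y hy => (hT1 x y hy).symm
  constructor
  · have hfin := NoetherianSpace.finite_irreducibleComponents (α := S)
    have := hfin.to_subtype
    rw [← Set.finite_coe_iff]
    have hm (x : S) : {x} ∈ irreducibleComponents S := by
      refine ⟨isIrreducible_singleton, fun t ht hxt => ?_⟩
      have h1 : c x ≤ ⟨closure t, ht.closure, isClosed_closure⟩ := closure_mono hxt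
      have h2 : closure t ⊆ closure {x} := hmax (c x) h1
      rw [(hc x).closure_eq] at h2
      exact subset_closure.trans h2
    exact Finite.of_injective (fun x : S => (⟨{x}, hm x⟩ : irreducibleComponents S))
      (fun x y hxy => Set.singleton_injective (congrArg Subtype.val hxy))
  · intro x hx
    have := hS.isClosedEmbedding_subtypeVal.isClosedMap _ (hc ⟨x, hx⟩)
    simpa using this

/-- A point has an affine neighbourhood that misses the other points of a finite set of closed
points. -/
lemma exists_affine_inter_subset_singleton {S : Set X} (hfin : S.Finite)
    (hc : ∀ x ∈ S, IsClosed {x}) (x : X) :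
    ∃ U : X.Opens, IsAffineOpen U ∧ x ∈ U ∧ ∀ y ∈ U, y ∈ S → y = x := by
  have hcl : IsClosed (S \ {x}) := by
    have h : S \ {x} = ⋃ y ∈ S \ {x}, {y} := (Set.biUnion_of_singleton _).symm
    rw [h]
    exact (hfin.subset Set.sdiff_subset).isClosed_biUnion fun y hy => hc y hy.1
  obtain ⟨_, ⟨U, hU, rfl⟩, hxU, hUS⟩ := X.isBasis_affineOpens.exists_subset_of_mem_open
    (show x ∈ (S \ {x})ᶜ by simp) hcl.isOpen_compl
  refine ⟨U, hU, hxU, fun y hy hyS => ?_⟩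
  by_contra hne
  exact hUS hy ⟨hyS, hne⟩

/-- Coherent sheaves with zero-dimensional support have finite length. -/
lemma IsCohZero.hasFiniteLength [IsNoetherian X] (hF : IsCohZero F) : HasFiniteLength F := by
  obtain ⟨hfin, hc⟩ := finite_of_topologicalKrullDim_le_zero (isClosed_support hF.finiteType)
    hF.dim_support
  refine ⟨hfin, hc, fun x => ?_⟩
  by_cases hx : x ∈ support F
  swap
  · rw [stalkLength_eq_zero_iff.2 hx]
    simp
  obtain ⟨U, hU, hxU, hUS⟩ := exists_affine_inter_subset_singleton hfin hc x
  have hnoeth : IsNoetherianRing Γ(X, U) := IsLocallyNoetherian.component_noetherian ⟨U, hU⟩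
  have : SheafOfModules.IsQuasicoherent (R := X.ringCatSheaf) F := hF.quasicoherent
  obtain ⟨z, rfl⟩ : ∃ z, hU.fromSpec z = x := ⟨_, hU.fromSpec_primeIdealOf ⟨x, hxU⟩⟩
  have := finite_stalk hF.finiteType (hU.fromSpec z)
  have := finite_stalk_restrict (F := F) hU.fromSpec z
  rw [← stalkLength_restrict]
  have hinj := hU.fromSpec.isOpenEmbedding.injective
  refine stalkLength_ne_top_of_isIso_fromTildeΓ (F.restrict hU.fromSpec) z ?_ ?_
  · have := (hc _ hx).preimage hU.fromSpec.continuous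
    rwa [← Set.image_singleton, Set.preimage_image_eq _ hinj] at this
  · intro y hy
    refine hinj (hUS _ ?_ (mem_support_restrict.1 hy))
    have := Set.mem_range_self (f := hU.fromSpec) y
    rwa [hU.range_fromSpec] at this

lemma isQuasicoherent_and_isFiniteType_of_isFinitePresentation
    (M : SheafOfModules X.ringCatSheaf) [M.IsFinitePresentation] :
    M.IsQuasicoherent ∧ M.IsFiniteType := ⟨inferInstance, inferInstance⟩

lemma finite_sections_Spec {A : CommRingCat.{0}} [IsNoetherianRing A] {M : (Spec A).Modules}
    (hM : HasFiniteLength M) : Module.Finite A Γ(M, ⊤) := by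
  have hn : IsNoetherianRing Γ(Spec A, ⊤) :=
    IsLocallyNoetherian.component_noetherian ⟨⊤, isAffineOpen_top (Spec A)⟩
  obtain ⟨s, hs⟩ := hM.finite_sections (isAffineOpen_top (Spec A))
  have h : Function.Surjective (Scheme.ΓSpecIso A).inv.hom :=
    ((ConcreteCategory.isIso_iff_bijective (Scheme.ΓSpecIso A).inv).1 inferInstance).2
  refine ⟨s, eq_top_iff.2 fun t _ => ?_⟩
  have ht : t ∈ Submodule.span Γ(Spec A, ⊤) (s : Set Γ(M, ⊤)) := by
    rw [hs]; exact Submodule.mem_top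
  induction ht using Submodule.span_induction with
  | mem t ht => exact Submodule.subset_span ht
  | zero => exact zero_mem _
  | add t u _ _ ht hu => exact add_mem (ht trivial) (hu trivial)
  | smul r t _ ht =>
    obtain ⟨a, rfl⟩ := h r
    rw [← smul_Spec]
    exact Submodule.smul_mem _ _ (ht trivial)

/-- Sheaves of finite length are coherent with zero-dimensional support. -/
lemma HasFiniteLength.isCohZero [IsLocallyNoetherian X] (hF : HasFiniteLength F) :
    IsCohZero F := by
  have hfp : SheafOfModules.IsFinitePresentation (R := X.ringCatSheaf) F := by
    refine isFinitePresentation_of_local fun x => ?_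
    obtain ⟨U, hU, hxU, hUS⟩ := exists_affine_inter_subset_singleton hF.finite_support hF.isClosed x
    have hnoeth : IsNoetherianRing Γ(X, U) := IsLocallyNoetherian.component_noetherian ⟨U, hU⟩
    have hM : HasFiniteLength (F.restrict hU.fromSpec) := hF.restrict
    have := finite_sections_Spec hM
    have h (y : Spec Γ(X, U)) (hy : y ∈ support (F.restrict hU.fromSpec)) :
        hU.fromSpec y = x := by
      refine hUS _ ?_ (mem_support_restrict.1 hy)
      have := Set.mem_range_self (f := hU.fromSpec) y
      rwa [hU.range_fromSpec] at this
    have := isIso_fromTildeΓ_of_hasFiniteLength _ hM fun y hy z hz =>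
      hU.fromSpec.isOpenEmbedding.injective ((h y hy).trans (h z hz).symm)
    obtain ⟨P, hP⟩ := exists_finite_presentation_restrict (F := F) hU
    exact ⟨U, hxU, P, hP⟩
  obtain ⟨h1, h2⟩ := isQuasicoherent_and_isFiniteType_of_isFinitePresentation (X := X) F
  refine ⟨h1, h2, ?_⟩
  have : T1Space (support F) := ⟨fun x => by
    have h := (hF.isClosed x.1 x.2).preimage (continuous_subtype_val (p := (· ∈ support F)))
    have h' : Subtype.val ⁻¹' {x.1} = ({x} : Set (support F)) := by
      ext y
      simp [Subtype.ext_iff]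
    rwa [h'] at h⟩
  have : Finite (support F) := hF.finite_support
  exact topologicalKrullDim_zero_of_discreteTopology _

end CohZero

/-! ### Projective varieties over the complex numbers -/

section Projective

variable {X : Scheme.{0}} {f : X ⟶ Spec (.of ℂ)}

attribute [local instance] MvPolynomial.gradedAlgebra

lemma algebraMap_homogeneousSubmodule_zero_bijective (n : ℕ) :
    Function.Bijective (algebraMap ℂ (MvPolynomial.homogeneousSubmodule (Fin (n + 1)) ℂ 0)) := by
  constructor
  · intro a b h
    exact MvPolynomial.C_injective (Fin (n + 1)) ℂ (congrArg Subtype.val h)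
  · rintro ⟨p, hp⟩
    have hp' := hp
    rw [MvPolynomial.homogeneousSubmodule_zero] at hp'
    obtain ⟨c, rfl⟩ := hp'
    exact ⟨c, Subtype.ext (Algebra.algebraMap_eq_smul_one (A := MvPolynomial (Fin (n + 1)) ℂ) c)⟩

/-- Projective space is proper over the spectrum of the degree zero part of the polynomial ring,
which is `ℂ`. -/
instance isProper_projectiveSpaceToSpec (n : ℕ) : IsProper (projectiveSpaceToSpec n) := by
  have h : Function.Surjective
    (algebraMap ℂ (MvPolynomial.homogeneousSubmodule (Fin (n + 1)) ℂ 0)) :=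
    (algebraMap_homogeneousSubmodule_zero_bijective n).2
  have : IsScalarTower ℂ (MvPolynomial.homogeneousSubmodule (Fin (n + 1)) ℂ 0)
      (MvPolynomial (Fin (n + 1)) ℂ) :=
    IsScalarTower.of_algebraMap_eq (R := ℂ)
      (S := MvPolynomial.homogeneousSubmodule (Fin (n + 1)) ℂ 0)
      (A := MvPolynomial (Fin (n + 1)) ℂ) fun _ => rfl
  have : Algebra.FiniteType (MvPolynomial.homogeneousSubmodule (Fin (n + 1)) ℂ 0)
      (MvPolynomial (Fin (n + 1)) ℂ) := Algebra.FiniteType.of_restrictScalars_finiteType ℂ _ _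
  have : IsClosedImmersion (Spec.map (CommRingCat.ofHom
      (algebraMap ℂ (MvPolynomial.homogeneousSubmodule (Fin (n + 1)) ℂ 0)))) :=
    IsClosedImmersion.spec_of_surjective _ h
  rw [projectiveSpaceToSpec]
  infer_instance

lemma IsProjective.isProper (h : IsProjective f) : IsProper f := by
  obtain ⟨n, i, hi, rfl⟩ := h
  infer_instance

lemma IsProjective.isNoetherian (h : IsProjective f) : IsNoetherian X := by
  have := h.isProper
  have := LocallyOfFiniteType.isLocallyNoetherian f
  have : CompactSpace X := QuasiCompact.compactSpace_of_compactSpace f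
  exact {}

/-- The global functions on a projective variety are the constants. -/
lemma IsProjective.scalars_bijective [IsIntegral X] (h : IsProjective f) :
    Function.Bijective (scalars f ⊤) := by
  have := h.isProper
  let : Field Γ(X, ⊤) := (isField_of_universallyClosed ℂ f).toField
  have hs : scalars f ⊤ = ((Scheme.ΓSpecIso (.of ℂ)).inv ≫ f.appTop).hom := by
    have : X.presheaf.map (homOfLE (le_top : (⊤ : X.Opens) ≤ ⊤)).op = 𝟙 _ :=
      X.presheaf.map_id (.op ⊤)
    rw [scalars, this, Category.comp_id]
  have hfin : (scalars f ⊤).Finite := by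
    rw [hs, CommRingCat.hom_comp]
    refine (finite_appTop_of_universallyClosed ℂ f).comp (RingHom.Finite.of_surjective _ ?_)
    exact ((ConcreteCategory.isIso_iff_bijective (Scheme.ΓSpecIso (.of ℂ)).inv).1 inferInstance).2
  exact IsAlgClosed.ringHom_bijective_of_isIntegral _ hfin.to_isIntegral

end Projective

/-! ### Regular sequences at the closed points of a smooth threefold -/

section Regular

/-- A weakly regular sequence of length three. -/
structure IsRegularTriple {R : Type*} [CommRing R] (t : Fin 3 → R) : Prop where
  eq_zero : ∀ r, t 0 * r = 0 → r = 0
  exists_eq : ∀ r s, t 1 * r = t 0 * s → ∃ u, r = t 0 * u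
  exists_eq_add : ∀ r s v, t 2 * r = t 0 * s + t 1 * v → ∃ u w, r = t 0 * u + t 1 * w

/-- Modulo the polynomials `X i - a i` with `i ∈ S`, the variables `X i` with `i ∈ S` may be
replaced by the constants `a i`. -/
lemma sub_eval_mem_span {k : Type*} [Field k] (a : Fin 3 → k) (S : Set (Fin 3))
    [DecidablePred (· ∈ S)] (p : MvPolynomial (Fin 3) k) :
    p - MvPolynomial.aeval (fun i => if i ∈ S then MvPolynomial.C (a i) else MvPolynomial.X i) p ∈
      Ideal.span ((fun i => (MvPolynomial.X i - MvPolynomial.C (a i) : MvPolynomial (Fin 3) k)) ''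
        S) := by
  set I := Ideal.span ((fun i => (MvPolynomial.X i - MvPolynomial.C (a i) :
    MvPolynomial (Fin 3) k)) '' S)
  rw [← Ideal.Quotient.mk_eq_mk_iff_sub_mem]
  have h : (Ideal.Quotient.mkₐ k I) = (Ideal.Quotient.mkₐ k I).comp (MvPolynomial.aeval
      (fun i => if i ∈ S then MvPolynomial.C (a i) else MvPolynomial.X i)) := by
    refine MvPolynomial.algHom_ext fun i => ?_
    rw [AlgHom.comp_apply, MvPolynomial.aeval_X]
    split_ifs with hi
    · exact Ideal.Quotient.eq.2 (Ideal.subset_span ⟨i, hi, rfl⟩)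
    · rfl
  exact DFunLike.congr_fun h p

/-- The coordinates centred at a point of affine space form a regular sequence: a quotient by some
of them is a polynomial ring in the other variables, hence a domain. -/
lemma isRegularTriple_mvPolynomial {k : Type*} [Field k] (a : Fin 3 → k) :
    IsRegularTriple fun i => (MvPolynomial.X i - MvPolynomial.C (a i) :
      MvPolynomial (Fin 3) k) := by
  classical
  have hne (i : Fin 3) :
      (MvPolynomial.X i - MvPolynomial.C (a i) : MvPolynomial (Fin 3) k) ≠ 0 := by
    intro h
    have := congrArg (MvPolynomial.aeval fun j : Fin 3 => a j + 1) h
    simp at this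
  have key (S : Set (Fin 3)) (i : Fin 3) (hi : i ∉ S) (r : MvPolynomial (Fin 3) k)
      (h : (MvPolynomial.X i - MvPolynomial.C (a i)) * r ∈ Ideal.span
        ((fun i => (MvPolynomial.X i - MvPolynomial.C (a i) : MvPolynomial (Fin 3) k)) '' S)) :
      r ∈ Ideal.span
        ((fun i => (MvPolynomial.X i - MvPolynomial.C (a i) : MvPolynomial (Fin 3) k)) '' S) := by
    have h0 := sub_eval_mem_span a S r
    set ev : MvPolynomial (Fin 3) k →ₐ[k] MvPolynomial (Fin 3) k := MvPolynomial.aeval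
      (fun i => if i ∈ S then MvPolynomial.C (a i) else MvPolynomial.X i)
    have h1 : Ideal.span ((fun i => (MvPolynomial.X i - MvPolynomial.C (a i) :
        MvPolynomial (Fin 3) k)) '' S) ≤ RingHom.ker ev := by
      rw [Ideal.span_le]
      rintro _ ⟨j, hj, rfl⟩
      simp [ev, hj]
    have h2 := h1 h
    rw [RingHom.mem_ker, map_mul] at h2
    have h3 : ev (MvPolynomial.X i - MvPolynomial.C (a i)) =
      MvPolynomial.X i - MvPolynomial.C (a i) := by simp [ev, hi]
    rw [h3] at h2
    have h4 := (mul_eq_zero.1 h2).resolve_left (hne i)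
    rwa [h4, sub_zero] at h0
  refine ⟨fun r h => (mul_eq_zero.1 h).resolve_left (hne 0), fun r s h => ?_, fun r s v h => ?_⟩
  · have := key {0} 1 (by simp) r (by
      rw [Set.image_singleton, Ideal.mem_span_singleton]
      exact ⟨s, h⟩)
    rw [Set.image_singleton, Ideal.mem_span_singleton] at this
    exact this
  · have := key {0, 1} 2 (by simp) r (by
      rw [Set.image_pair, Ideal.mem_span_pair]
      exact ⟨s, v, by rw [h]; ring⟩)
    rw [Set.image_pair, Ideal.mem_span_pair] at this
    obtain ⟨u, w, h⟩ := this
    exact ⟨u, w, by rw [← h]; ring⟩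

/-- Flat base change preserves regular sequences, by the equational criterion for flatness. -/
lemma IsRegularTriple.of_flat {P R : Type*} [CommRing P] [CommRing R] [Algebra P R]
    [Module.Flat P R] {t : Fin 3 → P} (h : IsRegularTriple t) :
    IsRegularTriple fun i => algebraMap P R (t i) := by
  constructor
  · intro r hr
    obtain ⟨k, a, y, h1, h2⟩ := Module.Flat.isTrivialRelation_of_sum_smul_eq_zero
      (R := P) (M := R) (f := ![t 0]) (x := ![r]) (by simp [Algebra.smul_def, hr])
    have h1 := h1 0
    simp only [Matrix.cons_val_zero, Fin.sum_univ_one] at h1 h2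
    rw [h1]
    refine Finset.sum_eq_zero fun j _ => ?_
    rw [h.eq_zero _ (h2 j), zero_smul]
  · intro r s hr
    obtain ⟨k, a, y, h1, h2⟩ := Module.Flat.isTrivialRelation_of_sum_smul_eq_zero
      (R := P) (M := R) (f := ![t 1, -t 0]) (x := ![r, s])
      (by simp [Fin.sum_univ_two, Algebra.smul_def, hr])
    have h1 := h1 0
    simp only [Fin.sum_univ_two, Matrix.cons_val_zero, Matrix.cons_val_one] at h1 h2
    choose u hu using fun j => h.exists_eq (a 0 j) (a 1 j) (by linear_combination h2 j)
    refine ⟨∑ j, u j • y j, ?_⟩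
    rw [h1, Finset.mul_sum]
    refine Finset.sum_congr rfl fun j _ => ?_
    rw [hu, mul_smul, Algebra.smul_def]
  · intro r s v hr
    obtain ⟨k, a, y, h1, h2⟩ := Module.Flat.isTrivialRelation_of_sum_smul_eq_zero
      (R := P) (M := R) (f := ![t 2, -t 0, -t 1]) (x := ![r, s, v])
      (by simp [Fin.sum_univ_three, Algebra.smul_def, hr])
    have h1 := h1 0
    simp only [Fin.sum_univ_three, Matrix.cons_val_zero, Matrix.cons_val_one, Matrix.cons_val]
      at h1 h2
    choose u w hu using fun j => h.exists_eq_add (a 0 j) (a 1 j) (a 2 j)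
      (by linear_combination h2 j)
    refine ⟨∑ j, u j • y j, ∑ j, w j • y j, ?_⟩
    rw [h1, Finset.mul_sum, Finset.mul_sum, ← Finset.sum_add_distrib]
    refine Finset.sum_congr rfl fun j _ => ?_
    rw [hu, add_smul, mul_smul, mul_smul, Algebra.smul_def (t 0), Algebra.smul_def (t 1)]

/-- At a maximal ideal of a smooth algebra of relative dimension three over an algebraically closed
field, coordinates of an étale map to affine space form a regular sequence. -/
lemma exists_isRegularTriple {k B : Type} [Field k] [IsAlgClosed k] [CommRing B] (φ : k →+* B)
    (hφ : φ.IsStandardSmoothOfRelativeDimension 3) (p : Ideal B) [hp : p.IsMaximal]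
    (R : Type) [CommRing R] [Algebra B R] [IsLocalization.AtPrime R p] :
    ∃ t : Fin 3 → B, (∀ i, t i ∈ p) ∧ IsRegularTriple fun i => algebraMap B R (t i) := by
  obtain ⟨g, hg, het⟩ := hφ.exists_etale_mvPolynomial
  have hflat : g.Flat := ((RingHom.etale_iff_formallyUnramified_and_smooth g).1 het).2.flat
  have hft : φ.FiniteType := by
    algebraize [φ]
    have : Algebra.IsStandardSmooth k B :=
      Algebra.IsStandardSmoothOfRelativeDimension.isStandardSmooth 3
    exact (inferInstance : Algebra.FiniteType k B)
  let : Field (B ⧸ p) := Ideal.Quotient.field p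
  have hint : ((Ideal.Quotient.mk p).comp φ).IsIntegral := by
    have h1 : ((Ideal.Quotient.mk p).comp φ).FiniteType :=
      (RingHom.FiniteType.of_surjective _ Ideal.Quotient.mk_surjective).comp hft
    algebraize [(Ideal.Quotient.mk p).comp φ]
    have := finite_of_finite_type_of_isJacobsonRing k (B ⧸ p)
    exact (inferInstance : Algebra.IsIntegral k (B ⧸ p)).isIntegral
  have hbij := IsAlgClosed.ringHom_bijective_of_isIntegral _ hint
  choose a ha using fun i => hbij.2 (Ideal.Quotient.mk p (g (MvPolynomial.X i)))
  have hmem (i : Fin 3) : g (MvPolynomial.X i - MvPolynomial.C (a i)) ∈ p := by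
    rw [← Ideal.Quotient.eq_zero_iff_mem, map_sub, map_sub, ← ha, sub_eq_zero, ← hg]
    rfl
  refine ⟨_, hmem, ?_⟩
  algebraize [g, (algebraMap B R).comp g]
  have : Module.Flat B R := IsLocalization.flat R p.primeCompl
  have : Module.Flat (MvPolynomial (Fin 3) k) R := Module.Flat.trans _ B _
  exact (isRegularTriple_mvPolynomial a).of_flat (R := R)

/-- The closed points of a smooth threefold over `ℂ` have regular sequences of length three in their
maximal ideals. -/
lemma exists_isRegularTriple_stalk {X : Scheme.{0}} {f : X ⟶ Spec (.of ℂ)}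
    (hf : SmoothOfRelativeDimension 3 f) {x : X} (hx : IsClosed {x}) :
    ∃ t : Fin 3 → X.presheaf.stalk x, (∀ i, t i ∈ IsLocalRing.maximalIdeal _) ∧
      IsRegularTriple t := by
  obtain ⟨U, hU, V, hV, hxV, e, hs⟩ := hf.exists_isStandardSmoothOfRelativeDimension x
  have hU' : U = ⊤ := by
    rw [eq_top_iff]
    intro y _
    have : y = f x := Subsingleton.elim (α := PrimeSpectrum ℂ) _ _
    exact this ▸ e hxV
  subst hU'
  have h1 := RingHom.isStandardSmoothOfRelativeDimension_respectsIso.2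
    (f.appLE ⊤ V e).hom (Scheme.ΓSpecIso (.of ℂ)).symm.commRingCatIsoToRingEquiv hs
  have hmax := hV.primeIdealOf_isMaximal_of_isClosed ⟨x, hxV⟩ hx
  let : Algebra Γ(X, V) (X.presheaf.stalk x) := (germO hxV).toAlgebra
  have hloc : IsLocalization.AtPrime (X.presheaf.stalk x) (hV.primeIdealOf ⟨x, hxV⟩).asIdeal :=
    hV.isLocalization_stalk ⟨x, hxV⟩
  obtain ⟨t, ht, hreg⟩ := exists_isRegularTriple (k := ℂ) _ h1
    (hV.primeIdealOf ⟨x, hxV⟩).asIdeal (X.presheaf.stalk x)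
  exact ⟨_, fun i => (IsLocalization.AtPrime.to_map_mem_maximal_iff _ _ _).2 (ht i), hreg⟩

end Regular

/-! ### Splitting extensions of the structure sheaf of a point -/

section RegularTriple
variable {R M : Type*} [CommRing R] [AddCommGroup M] [Module R M] {t : Fin 3 → R} {I : Ideal R}

/-- An extension of `R ⧸ I` by `R` splits if `I` contains a regular sequence of length `2`. Here `M`
is the extension, and `m` is a lift of the generator of `R ⧸ I`. -/
lemma IsRegularTriple.exists_smul_sub_eq_zero (ht : IsRegularTriple t) (hI : ∀ i, t i ∈ I)
    (ι : R →ₗ[R] M) (hι : Function.Injective ι) (m : M) (hm : ∀ a ∈ I, ∃ r, a • m = ι r) :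
    ∃ u, ∀ a ∈ I, a • (m - ι u) = 0 := by
  obtain ⟨r₀, h₀⟩ := hm _ (hI 0)
  obtain ⟨r₁, h₁⟩ := hm _ (hI 1)
  have h : t 1 * r₀ = t 0 * r₁ := by
    apply hι
    rw [← smul_eq_mul, ← smul_eq_mul, map_smul, map_smul, ← h₀, ← h₁, smul_comm]
  obtain ⟨u, rfl⟩ := ht.exists_eq _ _ h
  have hu : t 0 • (m - ι u) = 0 := by
    rw [smul_sub, h₀, ← smul_eq_mul, map_smul, sub_self]
  refine ⟨u, fun a ha => ?_⟩
  obtain ⟨r, hr⟩ := hm a ha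
  have h' : a • (m - ι u) = ι (r - a * u) := by
    rw [smul_sub, hr, map_sub, ← smul_eq_mul, map_smul]
  have : r - a * u = 0 := by
    apply ht.eq_zero
    apply hι
    rw [← smul_eq_mul, map_smul, ← h', smul_comm, hu, smul_zero, map_zero]
  rw [h', this, map_zero]

/-- If `I` contains a regular sequence of length `3`, and `0 ⟶ R ⟶ K ⟶ Q ⟶ 0` is an exact sequence
such that the first member of the regular sequence acts bijectively on `K`, then every extension `M`
of `R ⧸ I` by `Q` splits. -/
lemma IsRegularTriple.exists_smul_sub_eq_zero_of_exact (ht : IsRegularTriple t)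
    (hI : ∀ i, t i ∈ I) {K Q : Type*} [AddCommGroup K] [AddCommGroup Q] [Module R K] [Module R Q]
    (ι : R →ₗ[R] K) (π : K →ₗ[R] Q) (j : Q →ₗ[R] M) (hι : Function.Injective ι)
    (hπ : Function.Surjective π) (hex : Function.Exact ι π) (hj : Function.Injective j)
    (hK : Function.Bijective fun k : K => t 0 • k) (m : M) (hm : ∀ a ∈ I, ∃ q, a • m = j q) :
    ∃ q, ∀ a ∈ I, a • (m - j q) = 0 := by
  have hπι (r : R) : π (ι r) = 0 := (hex _).2 ⟨r, rfl⟩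
  have hlift (q : Q) (a : R) (ha : a ∈ I) : ∃ k, a • (m - j q) = j (π k) := by
    obtain ⟨q', h⟩ := hm a ha
    obtain ⟨k, hk⟩ := hπ (q' - a • q)
    exact ⟨k, by rw [hk, smul_sub, h, map_sub, map_smul]⟩
  have hzero {k : K} (h : j (π k) = 0) : ∃ r, ι r = k :=
    (hex k).1 (hj (h.trans (map_zero j).symm))
  -- as `t 0` is invertible on `K`, the lift `m` can be changed to `m₁`, which is killed by `t 0`
  obtain ⟨k₀, h₀⟩ := hlift 0 _ (hI 0)
  obtain ⟨k, rfl⟩ := hK.2 k₀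
  set m₁ := m - j (π k) with hm₁
  have h₁₀ : t 0 • m₁ = 0 := by
    dsimp only at h₀
    rw [map_zero, sub_zero, map_smul, map_smul] at h₀
    rw [hm₁, smul_sub, h₀, sub_self]
  -- `t 1 • m₁` and `t 2 • m₁` come from fractions `s₁ / t 0` and `s₂ / t 0`
  obtain ⟨k₁, h₁⟩ := hlift (π k) _ (hI 1)
  obtain ⟨k₂, h₂⟩ := hlift (π k) _ (hI 2)
  rw [← hm₁] at h₁ h₂
  obtain ⟨s₁, hs₁⟩ := hzero (k := t 0 • k₁) (by
    rw [map_smul, map_smul, ← h₁, smul_comm, h₁₀, smul_zero])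
  obtain ⟨s₂, hs₂⟩ := hzero (k := t 0 • k₂) (by
    rw [map_smul, map_smul, ← h₂, smul_comm, h₁₀, smul_zero])
  obtain ⟨w, hw⟩ := hzero (k := t 1 • k₂ - t 2 • k₁) (by
    rw [map_sub, map_sub, map_smul, map_smul, map_smul, map_smul, ← h₁, ← h₂, smul_comm, sub_self])
  have h : t 2 * s₁ = t 0 * (-w) + t 1 * s₂ := by
    apply hι
    have e : ι (t 0 * w) = ι (t 1 * s₂ - t 2 * s₁) := by
      rw [map_sub, ← smul_eq_mul, ← smul_eq_mul, ← smul_eq_mul, map_smul, map_smul, map_smul, hw,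
        hs₁, hs₂, smul_sub, smul_comm (t 0) (t 1), smul_comm (t 0) (t 2)]
    rw [mul_neg, neg_add_eq_sub, hι e]
    congr 1
    ring
  -- by regularity `s₁ / t 0 = u + t 1 * (v / t 0)`, so a change of `m₁` by `v / t 0`
  -- kills `t 1 • m₁`
  obtain ⟨u, v, rfl⟩ := ht.exists_eq_add _ _ _ h
  obtain ⟨k', hk'⟩ := hK.2 (ι v)
  dsimp only at hk'
  have hk₁ : k₁ = ι u + t 1 • k' := by
    apply hK.1
    dsimp only
    rw [← hs₁, map_add, ← smul_eq_mul, ← smul_eq_mul, map_smul, map_smul, smul_add,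
      smul_comm (t 0) (t 1), hk']
  have e₀ : t 0 • (m - j (π (k + k'))) = 0 := by
    rw [map_add, map_add, ← sub_sub, ← hm₁, smul_sub, h₁₀, ← map_smul, ← map_smul, hk', hπι,
      map_zero, sub_zero]
  have e₁ : t 1 • (m - j (π (k + k'))) = 0 := by
    rw [map_add, map_add, ← sub_sub, ← hm₁, smul_sub, h₁, hk₁, map_add, hπι, zero_add, map_smul,
      map_smul, sub_self]
  -- the new lift is killed by `t 0` and `t 1`, hence by all of `I`, again by regularity
  refine ⟨π (k + k'), fun a ha => ?_⟩
  obtain ⟨c, hc⟩ := hlift (π (k + k')) a ha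
  obtain ⟨d, hd⟩ := hzero (k := t 0 • c) (by
    rw [map_smul, map_smul, ← hc, smul_comm, e₀, smul_zero])
  obtain ⟨e, he⟩ := hzero (k := t 1 • c) (by
    rw [map_smul, map_smul, ← hc, smul_comm, e₁, smul_zero])
  obtain ⟨u', rfl⟩ := ht.exists_eq d e (hι (by
    rw [← smul_eq_mul, ← smul_eq_mul, map_smul, map_smul, hd, he, smul_comm]))
  have : c = ι u' := hK.1 (by dsimp only; rw [← hd, ← smul_eq_mul, map_smul])
  rw [hc, this, hπι, map_zero]

end RegularTriple

section PointSheaf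
open TopologicalSpace

variable {X : Scheme.{0}} {M : X.Modules} {x : X}

/-- The generator of the stalk of `𝒪_x` at `x`. -/
def pointGen (x : X) : Stalk (pointSheaf x) x := residueToStalk x 1

lemma smul_pointGen_eq_zero_iff (r : X.presheaf.stalk x) :
    r • pointGen x = 0 ↔ r ∈ IsLocalRing.maximalIdeal (X.presheaf.stalk x) := by
  rw [pointGen, ← map_smul, map_eq_zero_iff _ (residueToStalk_bijective x).1, Algebra.smul_def,
    mul_one]
  exact IsLocalRing.residue_eq_zero_iff r

lemma exists_smul_pointGen_eq (t : Stalk (pointSheaf x) x) :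
    ∃ r : X.presheaf.stalk x, r • pointGen x = t := by
  obtain ⟨c, rfl⟩ := (residueToStalk_bijective x).2 t
  obtain ⟨r, rfl⟩ := IsLocalRing.residue_surjective c
  refine ⟨r, ?_⟩
  rw [pointGen, ← map_smul, Algebra.smul_def, mul_one]
  rfl

/-- A morphism from `𝒪_x` is determined by the image of the generator of the stalk at `x`. -/
lemma pointSheaf_hom_ext (hx : IsClosed {x}) {φ ψ : pointSheaf x ⟶ M}
    (h : stalkMap φ x (pointGen x) = stalkMap ψ x (pointGen x)) : φ = ψ := by
  refine hom_ext_stalk fun y => LinearMap.ext fun t => ?_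
  by_cases hy : y = x
  · subst hy
    obtain ⟨r, rfl⟩ := exists_smul_pointGen_eq t
    rw [map_smul, map_smul, h]
  · have := (isSkyscraper_pointSheaf x).subsingleton_stalk (y := y) (by rwa [hx.closure_eq])
    rw [Subsingleton.elim t 0, map_zero, map_zero]

/-- The map from the local ring at `x` to the stalk of the structure sheaf. -/
def stalkUnit (x : X) : X.presheaf.stalk x →ₗ[X.presheaf.stalk x] Stalk (structureSheaf X) x :=
  LinearMap.toSpanSingleton _ _ (globalGerm (structureSheaf X) x (unitOne ⊤))

lemma stalkUnit_apply (r : X.presheaf.stalk x) :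
    stalkUnit x r = r • globalGerm (structureSheaf X) x (unitOne ⊤) := rfl

lemma stalkUnit_germO {U : X.Opens} (hx : x ∈ U) (a : Γ(X, U)) :
    stalkUnit x (germO hx a) = germ (structureSheaf X) hx (show Γ(structureSheaf X, U) from a) := by
  rw [stalkUnit_apply, ← germ_res_top hx, res_unitOne, ← germ_smul]
  exact congrArg _ (smul_unitOne _)

lemma stalkUnit_bijective (x : X) : Function.Bijective (stalkUnit x) := by
  constructor
  · rw [injective_iff_map_eq_zero]
    intro r hr
    obtain ⟨U, hx, a, rfl⟩ := exists_germO_eq r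
    rw [stalkUnit_germO] at hr
    obtain ⟨W, hW, h, e⟩ := exists_res_eq_zero hx hr
    have e' : resO h a = 0 := e
    rw [← germO_resO h hW, e', map_zero]
  · intro t
    obtain ⟨U, hx, a, rfl⟩ := exists_germ_eq t
    exact ⟨germO hx (show Γ(X, U) from a), stalkUnit_germO _ _⟩

lemma stalkMap_stalkUnit (φ : structureSheaf X ⟶ M) (r : X.presheaf.stalk x) :
    stalkMap φ x (stalkUnit x r) = r • globalGerm M x (φ.app ⊤ (unitOne ⊤)) := by
  rw [stalkUnit_apply, map_smul, stalkMap_globalGerm]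

end PointSheaf

section PointSheaf
open TopologicalSpace

variable {X : Scheme.{0}} {M : X.Modules} {x : X}

lemma exists_notMem_maximalIdeal {W : X.Opens} (hW : IsAffineOpen W) (hx : IsClosed {x})
    (hxW : x ∈ W) {y : X} (hy : y ∈ W) (hyx : y ≠ x) :
    ∃ a : Γ(X, W), germO hxW a ∈ IsLocalRing.maximalIdeal (X.presheaf.stalk x) ∧
      IsUnit (germO hy a) := by
  obtain ⟨a, ha, hya⟩ := hW.exists_basicOpen_le (V := ⟨{x}ᶜ, hx.isOpen_compl⟩) ⟨y, hyx⟩ hy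
  refine ⟨a, ?_, (X.mem_basicOpen a y hy).1 hya⟩
  rw [IsLocalRing.mem_maximalIdeal, mem_nonunits_iff]
  intro h
  exact ha ((X.mem_basicOpen a x hxW).2 h) rfl

/-- A germ at a closed point that is killed by the maximal ideal extends by zero. -/
lemma exists_global_section [IsLocallyNoetherian X] (hx : IsClosed {x}) (m : Stalk M x)
    (hm : ∀ r ∈ IsLocalRing.maximalIdeal (X.presheaf.stalk x), r • m = 0) :
    ∃ v : Γ(M, ⊤), globalGerm M x v = m ∧ ∀ y ≠ x, globalGerm M y v = 0 := by
  obtain ⟨U, hU, s, rfl⟩ := exists_germ_eq m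
  obtain ⟨W, hW, hxW, hWU'⟩ := exists_isAffineOpen_mem_and_subset hU
  have hWU : W ≤ U := hWU'
  have : IsNoetherianRing Γ(X, W) := IsLocallyNoetherian.component_noetherian ⟨W, hW⟩
  let p : Ideal Γ(X, W) := (IsLocalRing.maximalIdeal (X.presheaf.stalk x)).comap (germO hxW)
  obtain ⟨S, hS⟩ := (isNoetherianRing_iff_ideal_fg _).1 this p
  have hs : ∀ a : S, ∃ (V : X.Opens) (_ : x ∈ V) (h : V ≤ W),
      res M h (a.1 • res M hWU s) = 0 := fun a => by
    refine exists_res_eq_zero hxW ?_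
    rw [germ_smul, germ_res]
    exact hm _ (show a.1 ∈ p from hS ▸ Ideal.subset_span a.2)
  choose V hxV hVW hV using hs
  let V' : X.Opens := W ⊓ Finset.univ.inf V
  have hxV' : x ∈ V' := by
    refine ⟨hxW, ?_⟩
    rw [TopologicalSpace.Opens.coe_finset_inf]
    simpa using fun a ha => hxV ⟨a, ha⟩
  have hVV (a : S) : V' ≤ V a := inf_le_right.trans (Finset.inf_le (Finset.mem_univ a))
  have hVW' : V' ≤ W := inf_le_left
  have hker (a : Γ(X, W)) (ha : a ∈ p) : res M hVW' (a • res M hWU s) = 0 := by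
    rw [← hS] at ha
    induction ha using Submodule.span_induction with
    | mem a ha =>
      rw [← res_res (hVV ⟨a, ha⟩) (hVW ⟨a, ha⟩), hV ⟨a, ha⟩, map_zero]
    | zero => rw [zero_smul, map_zero]
    | add a b _ _ ha hb => rw [add_smul, map_add, ha, hb, add_zero]
    | smul c a _ ha => rw [smul_assoc, res_smul, ha, smul_zero]
  have hzero : ∀ y (hy : y ∈ V'), y ≠ x →
      germ M hy (res M (hVW'.trans hWU) s) = 0 := by
    intro y hy hyx
    obtain ⟨a, ha, hu⟩ := exists_notMem_maximalIdeal hW hx hxW hy.1 hyx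
    have h := congrArg (germ M hy) (hker a ha)
    rw [germ_res, germ_smul, germ_res, map_zero] at h
    rw [germ_res]
    exact (hu.smul_eq_zero).1 h
  obtain ⟨v, hv, hv'⟩ := exists_glue (F := M) (U := V') (V := ⟨{x}ᶜ, hx.isOpen_compl⟩) (W := ⊤)
    le_top le_top (fun y _ => by
      by_cases h : y = x
      · exact Or.inl (h ▸ hxV')
      · exact Or.inr h) (res M (hVW'.trans hWU) s) 0 (by
      refine section_ext fun y hy => ?_
      rw [germ_res, map_zero, map_zero]
      exact hzero y hy.1 hy.2)
  refine ⟨v, ?_, fun y hy => ?_⟩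
  · rw [← germ_res_top hxV', hv, germ_res]
  · rw [← germ_res_top (U := ⟨{x}ᶜ, hx.isOpen_compl⟩) hy, hv', map_zero]

/-- The canonical morphism from the structure sheaf to `𝒪_x`. It is an epimorphism if `x` is closed,
and the inclusion in the sheaf of rational functions if `x` is the generic point. -/
def pointQuotient (x : X) : structureSheaf X ⟶ pointSheaf x := unitHom (pointSection x ⊤ 1)

lemma stalkMap_pointQuotient (r : X.presheaf.stalk x) :
    stalkMap (pointQuotient x) x (stalkUnit x r) = r • pointGen x := by
  rw [stalkMap_stalkUnit, pointQuotient, unitHom_app_one, res_self]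
  rfl

lemma epi_pointQuotient (hx : IsClosed {x}) : Epi (pointQuotient x) := by
  refine epi_of_stalkMap_surjective _ fun y t => ?_
  by_cases hy : y = x
  · subst hy
    obtain ⟨r, rfl⟩ := exists_smul_pointGen_eq t
    exact ⟨_, stalkMap_pointQuotient r⟩
  · have := (isSkyscraper_pointSheaf x).subsingleton_stalk (y := y) (by rwa [hx.closure_eq])
    exact ⟨0, Subsingleton.elim _ _⟩

/-- Morphisms from `𝒪_x` are elements of the stalk at `x` that are killed by the maximal ideal. -/
lemma exists_pointSheaf_hom [IsLocallyNoetherian X] (hx : IsClosed {x}) (m : Stalk M x)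
    (hm : ∀ r ∈ IsLocalRing.maximalIdeal (X.presheaf.stalk x), r • m = 0) :
    ∃ σ : pointSheaf x ⟶ M, stalkMap σ x (pointGen x) = m := by
  obtain ⟨v, hv, hv'⟩ := exists_global_section hx m hm
  have := epi_pointQuotient hx
  have hS := shortExact_of_epi (pointQuotient x)
  have h : kernel.ι (pointQuotient x) ≫ unitHom v = 0 := by
    refine hom_ext_stalk fun y => LinearMap.ext fun t => ?_
    rw [stalkMap_comp, LinearMap.comp_apply, stalkMap_zero, LinearMap.zero_apply]
    have ht : stalkMap (pointQuotient x) y (stalkMap (kernel.ι (pointQuotient x)) y t) = 0 :=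
      (stalkMap_exact hS y _).2 ⟨t, rfl⟩
    obtain ⟨r, hr⟩ := (stalkUnit_bijective y).2 (stalkMap (kernel.ι (pointQuotient x)) y t)
    rw [← hr, stalkMap_stalkUnit, unitHom_app_one, res_self]
    by_cases hy : y = x
    · subst hy
      rw [← hr, stalkMap_pointQuotient, smul_pointGen_eq_zero_iff] at ht
      rw [hv, hm r ht]
    · rw [hv' y hy, smul_zero]
  refine ⟨hS.gIsCokernel.desc (CokernelCofork.ofπ (unitHom v) h), ?_⟩
  have h' : pointQuotient x ≫ hS.gIsCokernel.desc (CokernelCofork.ofπ (unitHom v) h) = unitHom v :=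
    hS.gIsCokernel.fac _ WalkingParallelPair.one
  have e := stalkMap_pointQuotient (1 : X.presheaf.stalk x)
  rw [one_smul] at e
  rw [← e, ← LinearMap.comp_apply, ← stalkMap_comp, h', stalkMap_stalkUnit, unitHom_app_one,
    res_self, one_smul, hv]

/-- An epimorphism onto `𝒪_x` splits if the generator lifts to a germ that is killed by the maximal
ideal. This turns the splitting of extensions of `𝒪_x` into a question about modules over the local
ring. -/
lemma isSplitEpi_of_smul_eq_zero [IsLocallyNoetherian X] (hx : IsClosed {x})
    (g : M ⟶ pointSheaf x) (m : Stalk M x) (hg : stalkMap g x m = pointGen x)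
    (hm : ∀ r ∈ IsLocalRing.maximalIdeal (X.presheaf.stalk x), r • m = 0) : IsSplitEpi g := by
  obtain ⟨σ, hσ⟩ := exists_pointSheaf_hom hx m hm
  refine ⟨⟨⟨σ, pointSheaf_hom_ext hx ?_⟩⟩⟩
  rw [stalkMap_comp, LinearMap.comp_apply, hσ, hg, stalkMap_id, LinearMap.id_apply]

end PointSheaf

section Vanishing
open TopologicalSpace

variable {X : Scheme.{0}} {x : X} {t : Fin 3 → X.presheaf.stalk x}

/-- `Hom(𝒪_x, 𝒪_X) = 0`, because the maximal ideal contains a nonzerodivisor. -/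
lemma pointSheaf_hom_structureSheaf_eq_zero (hx : IsClosed {x})
    (ht : ∀ i, t i ∈ IsLocalRing.maximalIdeal (X.presheaf.stalk x)) (hreg : IsRegularTriple t)
    (φ : pointSheaf x ⟶ structureSheaf X) : φ = 0 := by
  apply pointSheaf_hom_ext hx
  obtain ⟨r, hr⟩ := (stalkUnit_bijective x).2 (stalkMap φ x (pointGen x))
  have h : stalkUnit x (t 0 * r) = 0 := by
    rw [← smul_eq_mul, map_smul, hr, ← map_smul, (smul_pointGen_eq_zero_iff _).2 (ht 0), map_zero]
  rw [← hr, hreg.eq_zero r ((stalkUnit_bijective x).1 (h.trans (map_zero _).symm)), map_zero,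
    stalkMap_zero, LinearMap.zero_apply]

/-- Lifts of the generator of `𝒪_x` to an extension by `G` are multiplied into `G` by the maximal
ideal. -/
lemma exists_stalkMap_eq_pointGen {G M : X.Modules} {i : G ⟶ M} {g : M ⟶ pointSheaf x}
    {w : i ≫ g = 0} (hS : (ShortComplex.mk i g w).ShortExact) :
    ∃ m, stalkMap g x m = pointGen x ∧ (∀ q, stalkMap g x (m - stalkMap i x q) = pointGen x) ∧
      ∀ a ∈ IsLocalRing.maximalIdeal (X.presheaf.stalk x), ∃ q, a • m = stalkMap i x q := by
  have : Epi g := hS.epi_g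
  have hex := stalkMap_exact hS x
  obtain ⟨m, hm⟩ := stalkMap_surjective_of_epi g x (pointGen x)
  refine ⟨m, hm, fun q => ?_, fun a ha => ?_⟩
  · rw [map_sub, hm, (hex _).2 ⟨q, rfl⟩, sub_zero]
  · obtain ⟨q, hq⟩ := (hex (a • m)).1 (by
      change stalkMap g x (a • m) = 0
      rw [map_smul, hm, (smul_pointGen_eq_zero_iff _).2 ha])
    exact ⟨q, hq.symm⟩

/-- `Ext¹(𝒪_x, 𝒪_X) = 0`: every extension of `𝒪_x` by `𝒪_X` splits. -/
lemma isSplitEpi_of_structureSheaf [IsLocallyNoetherian X] (hx : IsClosed {x})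
    (ht : ∀ i, t i ∈ IsLocalRing.maximalIdeal (X.presheaf.stalk x)) (hreg : IsRegularTriple t)
    {M : X.Modules} {i : structureSheaf X ⟶ M} {g : M ⟶ pointSheaf x} {w : i ≫ g = 0}
    (hS : (ShortComplex.mk i g w).ShortExact) : IsSplitEpi g := by
  obtain ⟨m, -, hm', h⟩ := exists_stalkMap_eq_pointGen hS
  have : Mono i := hS.mono_f
  obtain ⟨u, hu⟩ := hreg.exists_smul_sub_eq_zero ht (stalkMap i x ∘ₗ stalkUnit x)
    ((stalkMap_injective_of_mono i x).comp (stalkUnit_bijective x).1) m fun a ha => by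
      obtain ⟨q, hq⟩ := h a ha
      obtain ⟨r, rfl⟩ := (stalkUnit_bijective x).2 q
      exact ⟨r, hq⟩
  exact isSplitEpi_of_smul_eq_zero hx g _ (hm' _) hu

/-- If `𝒪_X` embeds into a sheaf `K` such that a parameter acts bijectively on the stalk of `K` at
`x`, then every extension of `𝒪_x` by `K / 𝒪_X` splits. -/
lemma isSplitEpi_of_cokernel [IsLocallyNoetherian X] (hx : IsClosed {x})
    (ht : ∀ i, t i ∈ IsLocalRing.maximalIdeal (X.presheaf.stalk x)) (hreg : IsRegularTriple t)
    {K Q M : X.Modules} {ι : structureSheaf X ⟶ K} {π : K ⟶ Q} {w' : ι ≫ π = 0}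
    (hS' : (ShortComplex.mk ι π w').ShortExact)
    (hK : Function.Bijective fun k : Stalk K x => t 0 • k)
    {i : Q ⟶ M} {g : M ⟶ pointSheaf x} {w : i ≫ g = 0}
    (hS : (ShortComplex.mk i g w).ShortExact) : IsSplitEpi g := by
  obtain ⟨m, -, hm', h⟩ := exists_stalkMap_eq_pointGen hS
  have : Mono i := hS.mono_f
  have : Mono ι := hS'.mono_f
  have : Epi π := hS'.epi_g
  obtain ⟨q, hq⟩ := hreg.exists_smul_sub_eq_zero_of_exact ht (stalkMap ι x ∘ₗ stalkUnit x)
    (stalkMap π x) (stalkMap i x)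
    ((stalkMap_injective_of_mono ι x).comp (stalkUnit_bijective x).1)
    (stalkMap_surjective_of_epi π x) (fun k => by
      rw [stalkMap_exact hS' x k, LinearMap.coe_comp, (stalkUnit_bijective x).2.range_comp])
    (stalkMap_injective_of_mono i x) hK m h
  exact isSplitEpi_of_smul_eq_zero hx g _ (hm' _) hq

end Vanishing

/-! ### The constant sheaf of rational functions -/

section GenericPoint
open TopologicalSpace

variable (X : Scheme.{0}) [IsIntegral X]

/-- The constant sheaf of rational functions on an integral scheme, as the direct image of the
structure sheaf of the generic point. -/
abbrev rationalFunctions : X.Modules := pointSheaf (genericPoint X)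

variable {X}

lemma genericPoint_mem {U : X.Opens} {x : X} (hx : x ∈ U) : genericPoint X ∈ U :=
  (genericPoint_spec X).mem_open_set_iff U.isOpen |>.2 ⟨x, trivial, hx⟩

/-- The sheaf of rational functions is constant: a nonempty open set contains the generic point. -/
lemma germ_rationalFunctions_bijective {U : X.Opens} {x : X} (hx : x ∈ U) :
    Function.Bijective (germ (rationalFunctions X) hx) := by
  have hb (V : X.Opens) (hV : x ∈ V) :=
    (isSkyscraper_pointSheaf (genericPoint X)).bijective V (genericPoint_mem hV)
  have hres {V W : X.Opens} (h : V ≤ W) (hV : x ∈ V) :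
      Function.Bijective (res (rationalFunctions X) h) := by
    refine (Function.Bijective.of_comp_iff' (hb V hV) _).1 ?_
    have e : germ (rationalFunctions X) (genericPoint_mem hV) ∘ res (rationalFunctions X) h =
      germ (rationalFunctions X) (genericPoint_mem (h hV)) := funext fun s => germ_res h _ s
    rw [e]
    exact hb W (h hV)
  constructor
  · rw [injective_iff_map_eq_zero]
    intro s hs
    obtain ⟨W, hW, h, e⟩ := exists_res_eq_zero hx hs
    exact (hres h hW).1 (e.trans (map_zero _).symm)
  · intro t
    obtain ⟨W, hW, s, rfl⟩ := exists_germ_eq t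
    have hUW : x ∈ U ⊓ W := ⟨hx, hW⟩
    obtain ⟨s', hs'⟩ := (hres (inf_le_left : U ⊓ W ≤ U) hUW).2
      (res _ (inf_le_right : U ⊓ W ≤ W) s)
    refine ⟨s', ?_⟩
    rw [← germ_res (inf_le_left : U ⊓ W ≤ U) hUW, hs', germ_res]

lemma residue_germO_ne_zero {U : X.Opens} {x : X} (hx : x ∈ U) {a : Γ(X, U)}
    (ha : germO hx a ≠ 0) :
    X.residue (genericPoint X) (germO (genericPoint_mem hx) a) ≠ 0 := by
  have h : germO (genericPoint_mem hx) a ≠ 0 := fun h => by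
    have e : a = 0 := germ_injective_of_isIntegral X _ (genericPoint_mem hx)
      (h.trans (map_zero _).symm)
    exact ha (by rw [e, map_zero])
  have hu : IsUnit (germO (genericPoint_mem hx) a) :=
    IsUnit.mk0 (G₀ := X.functionField) _ h
  exact (hu.map (X.residue (genericPoint X)).hom).ne_zero

/-- Nonzero germs of functions act invertibly on rational functions. -/
lemma smul_rationalFunctions_bijective {x : X} {r : X.presheaf.stalk x} (hr : r ≠ 0) :
    Function.Bijective fun k : Stalk (rationalFunctions X) x => r • k := by
  obtain ⟨U, hx, a, rfl⟩ := exists_germO_eq r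
  have hc := residue_germO_ne_zero hx hr
  have h1 : Function.Bijective fun s : Γ(rationalFunctions X, U) => a • s := by
    have hp := pointSection_bijective (genericPoint X) (genericPoint_mem hx)
    refine (Function.Bijective.of_comp_iff _ hp).1 ?_
    have e : (fun s : Γ(rationalFunctions X, U) => a • s) ∘ pointSection (genericPoint X) U =
        pointSection (genericPoint X) U ∘
          (X.residue (genericPoint X) (germO (genericPoint_mem hx) a) * ·) :=
      funext fun c => smul_pointSection _ (genericPoint_mem hx) a c
    rw [e]
    exact hp.comp (mulLeft_bijective₀ _ hc)
  have hg := germ_rationalFunctions_bijective hx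
  refine (Function.Bijective.of_comp_iff _ hg).1 ?_
  have : (fun k : Stalk (rationalFunctions X) x => germO hx a • k) ∘ germ _ hx =
    germ _ hx ∘ fun s : Γ(rationalFunctions X, U) => a • s :=
      funext fun s => (germ_smul hx a s).symm
  rw [this]
  exact hg.comp h1

variable (X) in
/-- The inclusion of the structure sheaf in the sheaf of rational functions. -/
def toRationalFunctions : structureSheaf X ⟶ rationalFunctions X := pointQuotient (genericPoint X)

instance : Mono (toRationalFunctions X) := by
  refine mono_of_stalkMap_injective _ fun x => ?_
  rw [injective_iff_map_eq_zero]
  intro t ht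
  obtain ⟨r, rfl⟩ := (stalkUnit_bijective x).2 t
  by_contra h
  have hr : r ≠ 0 := fun h' => h (by rw [h', map_zero])
  have e : stalkMap (toRationalFunctions X) x (stalkUnit x r) =
    r • globalGerm (rationalFunctions X) x (pointSection (genericPoint X) ⊤ 1) := by
      rw [stalkMap_stalkUnit, toRationalFunctions, pointQuotient, unitHom_app_one, res_self]
  rw [e] at ht
  have h0 := (smul_rationalFunctions_bijective hr).1 (ht.trans (smul_zero r).symm)
  have h1 : pointSection (genericPoint X) ⊤ 1 = 0 :=
    (germ_rationalFunctions_bijective (Opens.mem_top x)).1 (h0.trans (map_zero _).symm)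
  exact one_ne_zero ((pointSection_bijective (genericPoint X) (Opens.mem_top _)).1
    (h1.trans (map_zero _).symm))

/-- Morphisms to the sheaf of rational functions are linear maps of generic stalks, which are vector
spaces over the function field. -/
instance : Injective (rationalFunctions X) where
  factors {F G} g f _ := by
    have hss : IsSemisimpleRing (X.presheaf.stalk (genericPoint X)) :=
      inferInstanceAs (IsSemisimpleRing X.functionField)
    have hP := isSkyscraper_pointSheaf (genericPoint X)
    obtain ⟨p, hp⟩ := (stalkMap f (genericPoint X)).exists_leftInverse_of_injective
      (LinearMap.ker_eq_bot.2 (stalkMap_injective_of_mono f _))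
    obtain ⟨φ, hφ⟩ := hP.exists_hom (stalkMap g (genericPoint X) ∘ₗ p)
    refine ⟨φ, hP.hom_ext ?_⟩
    rw [stalkMap_comp, hφ, LinearMap.comp_assoc, hp, LinearMap.comp_id]

end GenericPoint

/-! ### Cohomology of the structure sheaf -/

section Cohomology
open TopologicalSpace

variable {X : Scheme.{0}}

variable (X) in
/-- The functor that sends a sheaf of modules to the underlying sheaf of abelian groups. -/
def toAbSheaf : X.Modules ⥤ Sheaf (Opens.grothendieckTopology X) AddCommGrpCat.{0} :=
  SheafOfModules.toSheaf X.ringCatSheaf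

instance : (toAbSheaf X).PreservesZeroMorphisms where
  map_zero _ _ := rfl

instance : PreservesFiniteLimits (toAbSheaf X) :=
  inferInstanceAs (PreservesFiniteLimits (SheafOfModules.toSheaf X.ringCatSheaf))

lemma shortExact_toAbSheaf {S : ShortComplex X.Modules} (hS : S.ShortExact) :
    (S.map (toAbSheaf X)).ShortExact where
  exact := by
    have := hS.mono_f
    exact hS.exact.map_of_mono_of_preservesKernel _ inferInstance inferInstance
  mono_f := by
    have := hS.mono_f
    exact inferInstanceAs (Mono ((toAbSheaf X).map S.f))
  epi_g := by
    have := hS.epi_g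
    exact epi_toSheaf_map S.g

/-- If `H¹(𝒪_X) = 0`, global sections lift along epimorphisms with kernel `𝒪_X`. -/
lemma exists_global_lift (h : FirstCohomologyVanishes X) {M B : X.Modules}
    {i : structureSheaf X ⟶ M} {g : M ⟶ B} {w : i ≫ g = 0}
    (hS : (ShortComplex.mk i g w).ShortExact) (s : Γ(B, ⊤)) : ∃ t : Γ(M, ⊤), g.app ⊤ t = s := by
  let : HasExt.{1} (Sheaf (Opens.grothendieckTopology X) AddCommGrpCat.{0}) := HasExt.standard _
  have hsub : Subsingleton (Sheaf.H ((toAbSheaf X).obj (structureSheaf X)) 1) := h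
  let hT : IsTerminal (⊤ : Opens X) := isTerminalTop
  let e := Sheaf.H.equiv₀ ((toAbSheaf X).obj B) hT
  obtain ⟨y, hy⟩ := Abelian.Ext.covariant_sequence_exact₃ _ (shortExact_toAbSheaf hS) (e.symm s)
    (zero_add 1) (@Subsingleton.elim _ hsub _ _)
  refine ⟨Sheaf.H.equiv₀ ((toAbSheaf X).obj M) hT y, ?_⟩
  have := Sheaf.H.equiv₀_naturality hT ((toAbSheaf X).map g) y
  exact this.trans ((congrArg e hy).trans (e.apply_symm_apply s))

/-- Since `H¹(𝒪_X) = 0`, the section `1` of the quotient of an extension of `𝒪_X` by `𝒪_X` lifts. -/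
lemma isSplitEpi_of_firstCohomologyVanishes (h : FirstCohomologyVanishes X) {M : X.Modules}
    {i : structureSheaf X ⟶ M} {g : M ⟶ structureSheaf X} {w : i ≫ g = 0}
    (hS : (ShortComplex.mk i g w).ShortExact) : IsSplitEpi g := by
  obtain ⟨t, ht⟩ := exists_global_lift h hS (unitOne ⊤)
  refine ⟨⟨⟨unitHom t, structureSheaf_hom_ext ?_⟩⟩⟩
  have e : (unitHom t ≫ g).app ⊤ (unitOne ⊤) = g.app ⊤ ((unitHom t).app ⊤ (unitOne ⊤)) := rfl
  rw [e, unitHom_app_one, res_self, ht]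
  rfl

end Cohomology

/-! ### Vanishing of extension groups -/

section Vanishing
open Abelian

variable {X : Scheme.{0}} {f : X ⟶ Spec (.of ℂ)}

/-- `Ext¹(F, G)` vanishes if every extension of `F` by `G` splits. -/
lemma ext_one_eq_zero [HasExt.{w} X.Modules] [HasDerivedCategory.{w} X.Modules] {F G : X.Modules}
    (H : ∀ (M : X.Modules) (i : G ⟶ M) (g : M ⟶ F) (w : i ≫ g = 0),
      (ShortComplex.mk i g w).ShortExact → IsSplitEpi g) (e : Ext F G 1) : e = 0 := by
  have h : Ext.homAddEquiv e = 0 := by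
    refine hom_shift_one_eq_zero (fun S hS h₁ h₃ => ?_) (Ext.homAddEquiv e)
    obtain @⟨A, M, B, i, g, w⟩ := S
    change A = G at h₁
    change B = F at h₃
    clear e
    revert i g w
    rw [h₁, h₃]
    exact fun i g w hS => H M i g w hS
  exact (AddEquiv.map_eq_zero_iff _).1 h

lemma IsCalabiYauThreefold.isNoetherian (hX : IsCalabiYauThreefold f) : IsNoetherian X :=
  hX.projective.isNoetherian

/-- The vanishing of `Hom(𝒪_x, 𝒪_X)`, `Ext¹(𝒪_x, 𝒪_X)` and `Ext²(𝒪_x, 𝒪_X)`: the depth of the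
local ring is three. -/
lemma IsCalabiYauThreefold.ext_pointSheaf_eq_zero [HasExt.{w} X.Modules]
    [HasDerivedCategory.{w} X.Modules] (hX : IsCalabiYauThreefold f) {x : X} (hx : IsClosed {x})
    {n : ℕ} (hn : n ≤ 2) (e : Ext (pointSheaf x) (structureSheaf X) n) : e = 0 := by
  have := hX.isIntegral
  have := hX.isNoetherian
  obtain ⟨t, ht, hreg⟩ := exists_isRegularTriple_stalk hX.smooth hx
  interval_cases n
  · obtain ⟨φ, rfl⟩ := (Ext.mk₀_bijective _ _).2 e
    rw [pointSheaf_hom_structureSheaf_eq_zero hx ht hreg φ, Ext.mk₀_zero]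
  · exact ext_one_eq_zero (fun _ _ _ _ hS => isSplitEpi_of_structureSheaf hx ht hreg hS) e
  -- the sheaf `K` of rational functions is injective, so `Ext²(𝒪_x, 𝒪_X) = Ext¹(𝒪_x, K / 𝒪_X)`
  · have hS := shortExact_of_mono (toRationalFunctions X)
    have h0 : t 0 ≠ 0 := fun h => one_ne_zero (hreg.eq_zero 1 (by rw [h, zero_mul]))
    obtain ⟨y, rfl⟩ := Ext.covariant_sequence_exact₁ _ hS e (Ext.eq_zero_of_injective _) rfl
    have hy : y = 0 := ext_one_eq_zero (fun _ _ _ _ hS' =>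
      isSplitEpi_of_cokernel hx ht hreg hS (smul_rationalFunctions_bijective h0) hS') y
    rw [hy, Ext.zero_comp]

/-- The vanishing of `Extⁿ(F, 𝒪_X)` for `n ≤ 2` and `F` of finite length, by dévissage to `F = 𝒪_x`.
-/
lemma IsCalabiYauThreefold.ext_eq_zero [HasExt.{w} X.Modules]
    [HasDerivedCategory.{w} X.Modules] (hX : IsCalabiYauThreefold f) {F : X.Modules}
    (hF : HasFiniteLength F) {n : ℕ} (hn : n ≤ 2) (e : Ext F (structureSheaf X) n) : e = 0 := by
  revert e
  refine HasFiniteLength.induction (P := fun F => ∀ e : Ext F (structureSheaf X) n, e = 0)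
    (fun F hF e => ?_) (fun S x hS hx h₃ _ ih e => ?_) hF
  · rw [← Ext.mk₀_id_comp e, hF.eq_of_src (𝟙 F) 0, Ext.mk₀_zero, Ext.zero_comp]
  · obtain ⟨y, rfl⟩ := Ext.contravariant_sequence_exact₂ hS _ e (ih _)
    have hy : y = 0 := by
      clear ih hS
      revert y
      rw [h₃]
      exact hX.ext_pointSheaf_eq_zero hx hn
    rw [hy, Ext.comp_zero]

variable [HasDerivedCategory.{w} X.Modules]

local notation "S₀" => DerivedCategory.singleFunctor X.Modules 0

lemma hom_shift_eq_zero_of_ext [HasExt.{w} X.Modules] {F G : X.Modules} {n : ℕ}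
    (h : ∀ e : Ext F G n, e = 0) {m : ℤ} (hm : m = n)
    (g : (S₀).obj F ⟶ ((S₀).obj G)⟦m⟧) : g = 0 := by
  subst hm
  obtain ⟨e, rfl⟩ := (Ext.homAddEquiv (X := F) (Y := G) (n := n)).surjective g
  rw [h e, map_zero]

lemma hom_shift_free_eq_zero {K : DerivedCategory X.Modules} {n : ℤ}
    (h : ∀ g : K ⟶ ((S₀).obj (structureSheaf X))⟦n⟧, g = 0) {r : ℕ}
    (g : K ⟶ ((S₀).obj (free X r))⟦n⟧) : g = 0 := by
  rw [← Category.comp_id g, ← CategoryTheory.Functor.map_id, ← CategoryTheory.Functor.map_id,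
    ← sum_freeπ_freeι, Functor.map_sum, Functor.map_sum, Preadditive.comp_sum]
  refine Finset.sum_eq_zero fun i _ => ?_
  rw [Functor.map_comp, Functor.map_comp, ← Category.assoc, h (g ≫ _), zero_comp]

lemma free_hom_eq_zero {K : DerivedCategory X.Modules}
    (h : ∀ g : (S₀).obj (structureSheaf X) ⟶ K, g = 0) {r : ℕ}
    (g : (S₀).obj (free X r) ⟶ K) : g = 0 := by
  rw [← Category.id_comp g, ← CategoryTheory.Functor.map_id,
    ← sum_freeπ_freeι, Functor.map_sum, Preadditive.sum_comp]
  refine Finset.sum_eq_zero fun i _ => ?_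
  rw [Functor.map_comp, Category.assoc, h (_ ≫ g), comp_zero]

namespace IsCalabiYauThreefold

lemma hom_free_shift_eq_zero (hX : IsCalabiYauThreefold f) {F : X.Modules}
    (hF : HasFiniteLength F) {n : ℕ} (hn : n ≤ 2) {m : ℤ} (hm : m = n) {r : ℕ}
    (g : (S₀).obj F ⟶ ((S₀).obj (free X r))⟦m⟧) : g = 0 := by
  let : HasExt.{w} X.Modules := hasExt_of_hasDerivedCategory X.Modules
  exact hom_shift_free_eq_zero
    (fun g => hom_shift_eq_zero_of_ext (fun e => hX.ext_eq_zero hF hn e) hm g) g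

/-- `Ext¹` between free sheaves vanishes because `H¹(𝒪_X)` does. -/
lemma free_hom_free_shift_eq_zero (hX : IsCalabiYauThreefold f) {r r' : ℕ}
    (g : (S₀).obj (free X r) ⟶ ((S₀).obj (free X r'))⟦(1 : ℤ)⟧) : g = 0 := by
  let : HasExt.{w} X.Modules := hasExt_of_hasDerivedCategory X.Modules
  refine hom_shift_free_eq_zero (fun g => free_hom_eq_zero (fun g => ?_) g) g
  exact hom_shift_eq_zero_of_ext (ext_one_eq_zero fun _ _ _ _ hS =>
    isSplitEpi_of_firstCohomologyVanishes hX.cohomology hS) rfl g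

end IsCalabiYauThreefold
end Vanishing

/-! ### Objects of the heart as two-term complexes -/

section FreeSheaves

variable {X : Scheme.{0}}

lemma isZero_free_zero : IsZero (free X 0) := by
  rw [IsZero.iff_id_eq_zero]
  exact free_hom_ext fun i => i.elim0

/-- `𝒪_X^{⊕ 1} ≅ 𝒪_X`. -/
def freeOneIso : free X 1 ≅ structureSheaf X where
  hom := freeDesc fun _ => 𝟙 _
  inv := freeι 0
  hom_inv_id := free_hom_ext fun i => by
    rw [← Category.assoc, freeι_freeDesc, Category.id_comp, Category.comp_id, Subsingleton.elim i 0]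
  inv_hom_id := freeι_freeDesc _ _

/-- `𝒪_X^{⊕ r} ⊕ 𝒪_X^{⊕ r'} ≅ 𝒪_X^{⊕ (r + r')}`. -/
def freeAddIso (r r' : ℕ) : free X r ⊞ free X r' ≅ free X (r + r') where
  hom := biprod.desc (freeDesc fun i => freeι (Fin.castAdd r' i))
    (freeDesc fun i => freeι (Fin.natAdd r i))
  inv := freeDesc (Fin.addCases (fun i => freeι i ≫ biprod.inl) (fun i => freeι i ≫ biprod.inr))
  hom_inv_id := by
    refine biprod.hom_ext' _ _ (free_hom_ext fun i => ?_) (free_hom_ext fun i => ?_)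
    · rw [biprod.inl_desc_assoc, ← Category.assoc, freeι_freeDesc, freeι_freeDesc,
        Fin.addCases_left, Category.comp_id]
    · rw [biprod.inr_desc_assoc, ← Category.assoc, freeι_freeDesc, freeι_freeDesc,
        Fin.addCases_right, Category.comp_id]
  inv_hom_id := free_hom_ext fun i => by
    rw [← Category.assoc, freeι_freeDesc, Category.comp_id]
    induction i using Fin.addCases with
    | left i => rw [Fin.addCases_left, Category.assoc, biprod.inl_desc, freeι_freeDesc]
    | right i => rw [Fin.addCases_right, Category.assoc, biprod.inr_desc, freeι_freeDesc]

variable (X) in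
/-- The sheaves that are isomorphic to `𝒪_X^{⊕ r}` for some `r`. -/
def IsFree : ObjectProperty X.Modules := fun A => ∃ r : ℕ, Nonempty (A ≅ free X r)

lemma isFree_free (r : ℕ) : IsFree X (free X r) := ⟨r, ⟨Iso.refl _⟩⟩

variable {f : X ⟶ Spec (.of ℂ)}

/-- On a noetherian scheme, `Coh₀(X)` consists of the sheaves of finite length. -/
lemma isCohZero_iff [IsNoetherian X] {F : X.Modules} : IsCohZero F ↔ HasFiniteLength F :=
  ⟨fun h => h.hasFiniteLength, fun h => h.isCohZero⟩

variable [HasDerivedCategory.{w} X.Modules]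

local notation "S₀" => DerivedCategory.singleFunctor X.Modules 0

/-- Extensions of free sheaves are free, because they split. -/
lemma IsCalabiYauThreefold.isFree_extension (hX : IsCalabiYauThreefold f)
    {S : ShortComplex X.Modules} (hS : S.ShortExact) (h₁ : IsFree X S.X₁) (h₃ : IsFree X S.X₃) :
    IsFree X S.X₂ := by
  obtain ⟨r, ⟨e⟩⟩ := h₁
  obtain ⟨r', ⟨e'⟩⟩ := h₃
  let : HasExt.{w} X.Modules := hasExt_of_hasDerivedCategory X.Modules
  have hzero (y : Abelian.Ext S.X₃ S.X₁ 1) : y = 0 := by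
    have h : (Abelian.Ext.mk₀ e'.inv).comp (y.comp (Abelian.Ext.mk₀ e.hom) (add_zero 1))
        (zero_add 1) = 0 := by
      have := hX.free_hom_free_shift_eq_zero (Abelian.Ext.homAddEquiv
        ((Abelian.Ext.mk₀ e'.inv).comp (y.comp (Abelian.Ext.mk₀ e.hom) (add_zero 1)) (zero_add 1)))
      exact (AddEquiv.map_eq_zero_iff _).1 this
    have h' : (Abelian.Ext.mk₀ e'.hom).comp (((Abelian.Ext.mk₀ e'.inv).comp
        (y.comp (Abelian.Ext.mk₀ e.hom) (add_zero 1)) (zero_add 1)).comp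
          (Abelian.Ext.mk₀ e.inv) (add_zero 1)) (zero_add 1) = y := by
      simp
    rw [← h', h, Abelian.Ext.zero_comp, Abelian.Ext.comp_zero]
  obtain ⟨t, ht⟩ := Abelian.Ext.covariant_sequence_exact₃ _ hS (Abelian.Ext.mk₀ (𝟙 S.X₃))
    (zero_add 1) (hzero _)
  obtain ⟨σ, rfl⟩ := (Abelian.Ext.mk₀_bijective _ _).2 t
  rw [Abelian.Ext.mk₀_comp_mk₀] at ht
  have hσ : σ ≫ S.g = 𝟙 S.X₃ := (Abelian.Ext.mk₀_bijective _ _).1 ht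
  have := hS.mono_f
  have hsp : S.Splitting := ShortComplex.Splitting.ofExactOfSection S hS.exact σ hσ this
  exact ⟨r + r', ⟨hsp.isoBinaryBiproduct ≪≫ biprod.mapIso e e' ≪≫ freeAddIso r r'⟩⟩

/-- `Hom(F[-1], A[1]) = Ext²(F, A)` vanishes for `F ∈ Coh₀(X)` and `A` free. -/
lemma IsCalabiYauThreefold.single_one_hom_free_shift_eq_zero (hX : IsCalabiYauThreefold f)
    {A F : X.Modules} (hA : IsFree X A) (hF : HasFiniteLength F)
    (g : (DerivedCategory.singleFunctor X.Modules 1).obj F ⟶ ((S₀).obj A)⟦(1 : ℤ)⟧) : g = 0 := by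
  obtain ⟨r, ⟨e⟩⟩ := hA
  have h := hX.hom_free_shift_eq_zero hF le_rfl (m := 2) rfl
    ((singleOneShiftIso F).inv ≫ g⟦(1 : ℤ)⟧' ≫ (((S₀).map e.hom)⟦(1 : ℤ)⟧')⟦(1 : ℤ)⟧' ≫
      (shiftFunctorAdd' (DerivedCategory X.Modules) (1 : ℤ) 1 2 rfl).inv.app ((S₀).obj (free X r)))
  rw [← cancel_mono (((S₀).map e.hom)⟦(1 : ℤ)⟧'), zero_comp]
  apply (shiftFunctor (DerivedCategory X.Modules) (1 : ℤ)).map_injective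
  rw [Functor.map_comp, Functor.map_zero]
  rw [← cancel_mono ((shiftFunctorAdd' (DerivedCategory X.Modules) (1 : ℤ) 1 2 rfl).inv.app
    ((S₀).obj (free X r))), ← cancel_epi (singleOneShiftIso F).inv, zero_comp, comp_zero]
  simpa using h

end FreeSheaves

section HeartObjects
open Pretriangulated

variable {X : Scheme.{0}} {f : X ⟶ Spec (.of ℂ)} [HasDerivedCategory.{w} X.Modules]

local notation "S₀" => DerivedCategory.singleFunctor X.Modules 0
local notation "S₁" => DerivedCategory.singleFunctor X.Modules 1

lemma isIso_pairProjQ {A B : X.Modules} (s : A ⟶ B) (hB : IsZero B) : IsIso (pairProjQ s) :=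
  (Triangle.isZero₁_iff_isIso₂ _ (pair_stupid_distinguished s)).1 ((S₁).map_isZero hB)

lemma isIso_pairInclQ {A B : X.Modules} (s : A ⟶ B) (hA : IsZero A) : IsIso (pairInclQ s) :=
  (Triangle.isZero₃_iff_isIso₁ _ (pair_stupid_distinguished s)).1 ((S₀).map_isZero hA)

variable (X) in
/-- The isomorphism between the two descriptions of `F[-1]`. -/
def singleOneIso (F : X.Modules) : (S₁).obj F ≅ ((S₀).obj F)⟦(-1 : ℤ)⟧ :=
  (((DerivedCategory.singleFunctors X.Modules).shiftIso (-1) 1 0 (by simp)).app F).symm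

lemma heart_single_one {F : X.Modules} (hF : IsCohZero F) : heart X ((S₁).obj F) :=
  .of_iso (singleOneIso X F).symm (.shift F hF)

lemma heart_of_isZero [IsNoetherian X] {E : DerivedCategory X.Modules} (hE : IsZero E) :
    heart X E := by
  have h : IsZero ((S₁).obj (free X 0)) := (S₁).map_isZero isZero_free_zero
  exact .of_iso (h.iso hE)
    (heart_single_one (isCohZero_iff.2 (hasFiniteLength_of_isZero isZero_free_zero)))

lemma heart_free [IsNoetherian X] (r : ℕ) : heart X ((S₀).obj (free X r)) := by
  induction r with
  | zero => exact heart_of_isZero ((S₀).map_isZero isZero_free_zero)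
  | succ r ih =>
    refine .of_iso ((S₀).mapIso (freeAddIso r 1)) ?_
    let S := ShortComplex.mk (biprod.inl : free X r ⟶ free X r ⊞ free X 1) biprod.snd (by simp)
    have hS : S.ShortExact := (ShortComplex.Splitting.ofHasBinaryBiproduct _ _).shortExact
    exact .extension _ hS.singleTriangle_distinguished ih
      (.of_iso ((S₀).mapIso freeOneIso.symm) .structureSheaf)

lemma heart_isFree [IsNoetherian X] {A : X.Modules} (hA : IsFree X A) : heart X ((S₀).obj A) := by
  obtain ⟨r, ⟨e⟩⟩ := hA
  exact .of_iso ((S₀).mapIso e.symm) (heart_free r)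

lemma heart_pairObj [IsNoetherian X] {A F : X.Modules} (s : A ⟶ F) (hA : IsFree X A)
    (hF : IsCohZero F) : heart X (pairObj s) :=
  .extension _ (pair_stupid_distinguished s) (heart_single_one hF) (heart_isFree hA)

/-- Every object of `𝒜_X` is isomorphic to a two-term complex: the class of these complexes is
closed under extensions since `Ext¹(𝒪_X, 𝒪_X)` and `Ext²(F, 𝒪_X)` vanish. -/
lemma IsCalabiYauThreefold.heart_le (hX : IsCalabiYauThreefold f) {E : DerivedCategory X.Modules}
    (hE : heart X E) : twoTerms (IsFree X) IsCohZero E := by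
  have := hX.isNoetherian
  have hz : IsCohZero (free X 0) := isCohZero_iff.2 (hasFiniteLength_of_isZero isZero_free_zero)
  induction hE with
  | structureSheaf =>
    have := isIso_pairProjQ (0 : free X 1 ⟶ free X 0) isZero_free_zero
    exact ⟨_, _, 0, isFree_free 1, hz,
      ⟨(S₀).mapIso freeOneIso.symm ≪≫ (asIso (pairProjQ (0 : free X 1 ⟶ free X 0))).symm⟩⟩
  | shift F hF =>
    have := isIso_pairInclQ (0 : free X 0 ⟶ F) isZero_free_zero
    exact ⟨_, _, 0, isFree_free 0, hF,
      ⟨(singleOneIso X F).symm ≪≫ asIso (pairInclQ (0 : free X 0 ⟶ F))⟩⟩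
  | of_iso e _ ih =>
    obtain ⟨A, B, s, hA, hB, ⟨i⟩⟩ := ih
    exact ⟨A, B, s, hA, hB, ⟨e.symm ≪≫ i⟩⟩
  | extension T hT _ _ ih₁ ih₃ =>
    refine twoTerms_extension (P := IsFree X) (Q := IsCohZero)
      (fun S hS h₁ h₃ => hX.isFree_extension hS h₁ h₃) (fun S hS h₁ h₃ => ?_)
      (fun A B hA hB g => hX.single_one_hom_free_shift_eq_zero hA (isCohZero_iff.1 hB) g) _ ?_
    · rw [isCohZero_iff] at h₁ h₃ ⊢
      exact (hasFiniteLength_iff_of_shortExact hS).2 ⟨h₁, h₃⟩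
    · exact ⟨_, _, T.mor₁, T.mor₂, T.mor₃, hT, ih₁, ih₃⟩

end HeartObjects

section PairCategory

variable (X : Scheme.{0}) {f : X ⟶ Spec (.of ℂ)}

/-- The morphisms `A ⟶ F` with `A ≅ 𝒪_X^{⊕ r}` and `F ∈ Coh₀(X)`. -/
def isPair : ObjectProperty (Arrow X.Modules) := fun s => IsFree X s.left ∧ IsCohZero s.right

/-- The category of morphisms `A ⟶ F` with `A ≅ 𝒪_X^{⊕ r}` and `F ∈ Coh₀(X)`. -/
abbrev Pair := (isPair X).FullSubcategory

variable {X} in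
/-- A pair, from its data. -/
def Pair.mk {A F : X.Modules} (s : A ⟶ F) (hA : IsFree X A) (hF : IsCohZero F) : Pair X :=
  ⟨Arrow.mk s, hA, hF⟩

variable {X} in
/-- The morphism of pairs given by a commutative square. -/
def Pair.homMk {S T : Pair X} (b : S.obj.left ⟶ T.obj.left) (a : S.obj.right ⟶ T.obj.right)
    (h : b ≫ T.obj.hom = S.obj.hom ≫ a) : S ⟶ T :=
  ObjectProperty.homMk (Arrow.homMk b a h)

variable [HasDerivedCategory.{w} X.Modules]

variable {X} in
lemma nonempty_iso_twoTerm_of_iso {A F A' F' : X.Modules} {s : A ⟶ F} {s' : A' ⟶ F'} (b : A ≅ A')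
    (a : F ≅ F') (h : s ≫ a.hom = b.hom ≫ s') :
    Nonempty ((twoTerm s : DerivedCategory X.Modules) ≅ twoTerm s') :=
  ⟨(pairFunctorQ X.Modules).mapIso (Arrow.isoMk (f := Arrow.mk s) (g := Arrow.mk s') b a h.symm)⟩

variable [IsNoetherian X]

/-- The functor that sends a pair to the two-term complex. -/
def pairToHeart : Pair X ⥤ Heart X :=
  (heart X).lift ((isPair X).ι ⋙ pairFunctorQ X.Modules)
    fun S => heart_pairObj S.obj.hom S.property.1 S.property.2

variable {X}

lemma IsCalabiYauThreefold.hom_isFree_eq_zero (hX : IsCalabiYauThreefold f) {A F : X.Modules}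
    (hA : IsFree X A) (hF : IsCohZero F) (g : F ⟶ A) : g = 0 := by
  obtain ⟨r, ⟨e⟩⟩ := hA
  have h := hX.hom_free_shift_eq_zero (isCohZero_iff.1 hF) (Nat.zero_le 2) (m := 0) rfl
    ((DerivedCategory.singleFunctor X.Modules 0).map (g ≫ e.hom) ≫
      (shiftFunctorZero (DerivedCategory X.Modules) ℤ).inv.app
        ((DerivedCategory.singleFunctor X.Modules 0).obj (free X r)))
  rw [← cancel_mono e.hom, zero_comp]
  apply (DerivedCategory.singleFunctor X.Modules 0).map_injective
  rw [Functor.map_zero]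
  exact (Preadditive.IsIso.comp_right_eq_zero _ ((shiftFunctorZero (DerivedCategory X.Modules)
    ℤ).inv.app ((DerivedCategory.singleFunctor X.Modules 0).obj (free X r)))).1 h

lemma IsCalabiYauThreefold.hom_isFree_shift_eq_zero (hX : IsCalabiYauThreefold f) {A F : X.Modules}
    (hA : IsFree X A) (hF : IsCohZero F) (g : (DerivedCategory.singleFunctor X.Modules 0).obj F ⟶
      ((DerivedCategory.singleFunctor X.Modules 0).obj A)⟦(1 : ℤ)⟧) : g = 0 := by
  obtain ⟨r, ⟨e⟩⟩ := hA
  rw [← cancel_mono (((DerivedCategory.singleFunctor X.Modules 0).map e.hom)⟦(1 : ℤ)⟧'), zero_comp]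
  exact hX.hom_free_shift_eq_zero (isCohZero_iff.1 hF) one_le_two rfl _

lemma IsCalabiYauThreefold.faithful_pairToHeart (hX : IsCalabiYauThreefold f) :
    (pairToHeart X).Faithful where
  map_injective {S T} φ ψ h := by
    have h' : (pairFunctorQ X.Modules).map φ.hom = (pairFunctorQ X.Modules).map ψ.hom :=
      congrArg (fun χ => χ.hom) h
    exact ObjectProperty.hom_ext _ (pairFunctorQ_map_injective
      (fun g => hX.hom_isFree_eq_zero T.property.1 S.property.2 g) h')

lemma IsCalabiYauThreefold.full_pairToHeart (hX : IsCalabiYauThreefold f) :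
    (pairToHeart X).Full where
  map_surjective {S T} c := by
    obtain ⟨φ, hφ⟩ := pairFunctorQ_map_surjective
      (fun g => hX.hom_isFree_eq_zero T.property.1 S.property.2 g)
      (fun g => hX.hom_isFree_shift_eq_zero T.property.1 S.property.2 g) c.hom
    exact ⟨ObjectProperty.homMk φ, ObjectProperty.hom_ext _ hφ⟩

lemma IsCalabiYauThreefold.essSurj_pairToHeart (hX : IsCalabiYauThreefold f) :
    (pairToHeart X).EssSurj where
  mem_essImage E := by
    obtain ⟨A, F, s, hA, hF, ⟨e⟩⟩ := hX.heart_le E.property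
    exact ⟨.mk s hA hF, ⟨(heart X).isoMk e.symm⟩⟩

/-- `𝒜_X` is equivalent to the category of morphisms `A ⟶ F` with `A` free and `F ∈ Coh₀(X)`. -/
lemma IsCalabiYauThreefold.isEquivalence_pairToHeart (hX : IsCalabiYauThreefold f) :
    (pairToHeart X).IsEquivalence where
  faithful := hX.faithful_pairToHeart
  full := hX.full_pairToHeart
  essSurj := hX.essSurj_pairToHeart

/-- The isomorphism in the heart given by an isomorphism with a two-term complex. -/
def isoPairToHeart {E : Heart X} {A F : X.Modules} {s : A ⟶ F} (hA : IsFree X A) (hF : IsCohZero F)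
    (e : E.obj ≅ twoTerm s) : E ≅ (pairToHeart X).obj (.mk s hA hF) :=
  (heart X).isoMk e

/-- The two terms of a complex in `𝒜_X` are determined up to isomorphism by the object. -/
lemma IsCalabiYauThreefold.nonempty_iso_of_twoTerm_iso (hX : IsCalabiYauThreefold f)
    {A F A' F' : X.Modules} {s : A ⟶ F} {s' : A' ⟶ F'} (hA : IsFree X A) (hF : IsCohZero F)
    (hA' : IsFree X A') (hF' : IsCohZero F')
    (e : (twoTerm s : DerivedCategory X.Modules) ≅ twoTerm s') :
    Nonempty (A ≅ A') ∧ Nonempty (F ≅ F') := by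
  have := hX.faithful_pairToHeart
  have := hX.full_pairToHeart
  have i : (pairToHeart X).obj (.mk s hA hF) ≅ (pairToHeart X).obj (.mk s' hA' hF') :=
    (heart X).isoMk e
  have j := (isPair X).ι.mapIso ((pairToHeart X).preimageIso i)
  exact ⟨⟨Arrow.leftFunc.mapIso j⟩, ⟨Arrow.rightFunc.mapIso j⟩⟩

end PairCategory

/-! ### Global sections of free sheaves -/

section GlobalSections

variable {X : Scheme.{0}} {f : X ⟶ Spec (.of ℂ)} {F G H : X.Modules}

lemma H0map_comp (φ : F ⟶ G) (ψ : G ⟶ H) : H0map f (φ ≫ ψ) = H0map f ψ ∘ₗ H0map f φ := rfl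

lemma H0map_id : H0map f (𝟙 F) = LinearMap.id := rfl

variable (f) in
/-- The section `1` of the structure sheaf. -/
def oneSection : H0 f (structureSheaf X) := unitOne ⊤

lemma smul_oneSection (c : ℂ) :
    c • oneSection f = (show Γ(structureSheaf X, ⊤) from scalars f ⊤ c) :=
  mul_one (scalars f ⊤ c)

lemma exists_smul_oneSection_eq (hf : Function.Bijective (scalars f ⊤))
    (v : H0 f (structureSheaf X)) : ∃ c : ℂ, c • oneSection f = v := by
  obtain ⟨c, hc⟩ := hf.2 (show Γ(X, ⊤) from v)
  exact ⟨c, (smul_oneSection c).trans hc⟩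

lemma eq_zero_of_smul_oneSection_eq_zero (hf : Function.Bijective (scalars f ⊤)) {c : ℂ}
    (h : c • oneSection f = 0) : c = 0 :=
  hf.1 (((smul_oneSection c).symm.trans h).trans (map_zero (scalars f ⊤)).symm)

variable (f) in
/-- The standard sections of a free sheaf. -/
def freeSection {r : ℕ} (i : Fin r) : H0 f (free X r) := H0map f (freeι i) (oneSection f)

lemma H0map_freeπ_freeSection {r : ℕ} (i k : Fin r) :
    H0map f (freeπ k) (freeSection f i) = if i = k then oneSection f else 0 := by
  rw [freeSection, ← LinearMap.comp_apply, ← H0map_comp, freeι_freeπ]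
  split_ifs <;> rfl

lemma H0map_sum {ι : Type*} (s : Finset ι) (φ : ι → (F ⟶ G)) :
    H0map f (∑ i ∈ s, φ i) = ∑ i ∈ s, H0map f (φ i) := by
  classical
  induction s using Finset.induction_on with
  | empty => rfl
  | insert a s ha ih => rw [Finset.sum_insert ha, Finset.sum_insert ha, ← ih]; rfl

lemma sum_H0map {r : ℕ} (v : H0 f (free X r)) :
    ∑ i : Fin r, H0map f (freeι i) (H0map f (freeπ i) v) = v := by
  have h := congrArg (fun φ => H0map f φ v) (sum_freeπ_freeι (X := X) (I := Fin r))
  rw [H0map_sum, LinearMap.sum_apply] at h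
  exact h

/-- The basis of `H⁰(𝒪_X^{⊕ r})` if `H⁰(𝒪_X) = ℂ`. -/
def freeBasis (hf : Function.Bijective (scalars f ⊤)) (r : ℕ) :
    Module.Basis (Fin r) ℂ (H0 f (free X r)) :=
  .mk (v := freeSection f)
    (by
      rw [Fintype.linearIndependent_iff]
      intro c hc k
      have h := congrArg (H0map f (freeπ k)) hc
      simp only [map_sum, map_smul, map_zero, H0map_freeπ_freeSection] at h
      rw [Finset.sum_eq_single k (fun i _ hi => by rw [if_neg hi, smul_zero]) (by simp),
        if_pos rfl] at h
      exact eq_zero_of_smul_oneSection_eq_zero hf h)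
    (by
      intro v _
      rw [← sum_H0map v]
      refine Submodule.sum_mem _ fun i _ => ?_
      obtain ⟨c, hc⟩ := exists_smul_oneSection_eq hf (H0map f (freeπ i) v)
      rw [← hc, map_smul]
      exact Submodule.smul_mem _ _ (Submodule.subset_span ⟨i, rfl⟩))

lemma freeBasis_apply (hf : Function.Bijective (scalars f ⊤)) {r : ℕ} (i : Fin r) :
    freeBasis hf r i = freeSection f i := Module.Basis.mk_apply _ _ _

lemma finrank_H0_free (hf : Function.Bijective (scalars f ⊤)) (r : ℕ) :
    Module.finrank ℂ (H0 f (free X r)) = r := by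
  rw [Module.finrank_eq_card_basis (freeBasis hf r), Fintype.card_fin]

lemma finite_H0_free (hf : Function.Bijective (scalars f ⊤)) (r : ℕ) :
    Module.Finite ℂ (H0 f (free X r)) := .of_basis (freeBasis hf r)

lemma free_hom_ext_freeSection {r : ℕ} {φ ψ : free X r ⟶ F}
    (h : ∀ i, H0map f φ (freeSection f i) = H0map f ψ (freeSection f i)) : φ = ψ :=
  free_hom_ext fun i => structureSheaf_hom_ext (h i)

/-- The morphism from a free sheaf that sends the standard sections to given sections. -/
def freeHom {r : ℕ} (v : Fin r → H0 f F) : free X r ⟶ F := freeDesc fun i => unitHom (v i)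

lemma H0map_freeHom {r : ℕ} (v : Fin r → H0 f F) (i : Fin r) :
    H0map f (freeHom v) (freeSection f i) = v i := by
  rw [freeSection, ← LinearMap.comp_apply, ← H0map_comp, freeHom, freeι_freeDesc]
  exact (unitHom_app_one (v i) ⊤).trans (res_self _)

/-- Morphisms from free sheaves are linear maps on global sections. -/
lemma exists_free_hom (hf : Function.Bijective (scalars f ⊤)) {r : ℕ}
    (T : H0 f (free X r) →ₗ[ℂ] H0 f F) : ∃ φ : free X r ⟶ F, H0map f φ = T := by
  refine ⟨freeHom fun i => T (freeSection f i), (freeBasis hf r).ext fun i => ?_⟩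
  rw [freeBasis_apply, H0map_freeHom]

lemma free_hom_ext_H0map {r : ℕ} {φ ψ : free X r ⟶ F} (h : H0map f φ = H0map f ψ) : φ = ψ :=
  free_hom_ext_freeSection (f := f) fun i => by rw [h]

lemma H0map_injective (φ : F ⟶ G) [Mono φ] : Function.Injective (H0map f φ) :=
  app_injective_of_mono φ ⊤

/-- An injective map on sections has a linear retraction, which comes from a retraction of sheaves.
-/
lemma mono_of_H0map_injective (hf : Function.Bijective (scalars f ⊤)) {k r : ℕ}
    (b : free X k ⟶ free X r) (h : Function.Injective (H0map f b)) : Mono b := by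
  obtain ⟨p, hp⟩ := (H0map f b).exists_leftInverse_of_injective (LinearMap.ker_eq_bot.2 h)
  obtain ⟨φ, hφ⟩ := exists_free_hom hf p
  have : b ≫ φ = 𝟙 _ := free_hom_ext_H0map (f := f) (by rw [H0map_comp, hφ, hp, H0map_id])
  exact (SplitMono.mk φ this).mono

lemma le_of_mono_free (hf : Function.Bijective (scalars f ⊤)) {k r : ℕ}
    (b : free X k ⟶ free X r) [Mono b] : k ≤ r := by
  have := finite_H0_free hf r
  have := LinearMap.finrank_le_finrank_of_injective (H0map_injective (f := f) b)
  rwa [finrank_H0_free hf, finrank_H0_free hf] at this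

lemma isIso_of_mono_free (hf : Function.Bijective (scalars f ⊤)) {r : ℕ}
    (b : free X r ⟶ free X r) [Mono b] : IsIso b := by
  have := finite_H0_free hf r
  have hb := H0map_injective (f := f) b
  obtain ⟨p, hp⟩ := (H0map f b).exists_leftInverse_of_injective (LinearMap.ker_eq_bot.2 hb)
  obtain ⟨φ, hφ⟩ := exists_free_hom hf p
  refine ⟨φ, free_hom_ext_H0map (f := f) (by rw [H0map_comp, hφ, hp, H0map_id]),
    free_hom_ext_H0map (f := f) ?_⟩
  rw [H0map_comp, hφ, H0map_id]
  exact (LinearMap.comp_eq_id_comm _ _).1 hp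

lemma eq_of_free_iso (hf : Function.Bijective (scalars f ⊤)) {k r : ℕ} (e : free X k ≅ free X r) :
    k = r :=
  (le_of_mono_free hf e.hom).antisymm (le_of_mono_free hf e.inv)

/-- A subspace of `H⁰(𝒪_X^{⊕ r})` is the space of sections of a free subsheaf. -/
lemma exists_mono_free (hf : Function.Bijective (scalars f ⊤)) {r : ℕ}
    (U : Submodule ℂ (H0 f (free X r))) :
    ∃ b : free X (Module.finrank ℂ U) ⟶ free X r, Mono b ∧ LinearMap.range (H0map f b) = U := by
  have := finite_H0_free hf r
  have := finite_H0_free hf (Module.finrank ℂ U)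
  let e := LinearEquiv.ofFinrankEq (H0 f (free X (Module.finrank ℂ U))) U (finrank_H0_free hf _)
  obtain ⟨b, hb⟩ := exists_free_hom hf (U.subtype ∘ₗ e.toLinearMap)
  refine ⟨b, mono_of_H0map_injective hf b ?_, ?_⟩
  · rw [hb]
    exact U.subtype_injective.comp e.injective
  · rw [hb, LinearMap.range_comp_of_range_eq_top _ e.range, U.range_subtype]

end GlobalSections

/-! ### Subsheaves generated by global sections -/

section Generated

variable {X : Scheme.{0}} {f : X ⟶ Spec (.of ℂ)} {F G : X.Modules}

lemma freeSec_evaluation (W : Submodule ℂ (H0 f F)) (v : W) :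
    freeSec (evaluation W) v = (v.1 : H0 f F) := by
  have h := congrFun ((SheafOfModules.freeHomEquiv (R := X.ringCatSheaf) F).apply_symm_apply
    fun v : W => toSections v.1) v
  have h' := congrArg (fun s => s.val (.op ⊤)) h
  exact h'.trans (res_self (F := F) (U := ⊤) (v.1 : H0 f F))

lemma evaluation_eq_of_sections {W : Submodule ℂ (H0 f F)} {φ : freeOn X W ⟶ F}
    (h : ∀ v : W, freeSec φ v = (v.1 : H0 f F)) : φ = evaluation W :=
  free_hom_ext fun v => structureSheaf_hom_ext ((h v).trans (freeSec_evaluation W v).symm)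

lemma exists_comp_eq_of_imageSubobject_le {C : Type*} [Category C] [Abelian C] {A B Y : C}
    (φ : A ⟶ Y) (a : B ⟶ Y) [Mono a] (h : imageSubobject φ ≤ Subobject.mk a) :
    ∃ ψ : A ⟶ B, ψ ≫ a = φ :=
  ⟨factorThruImageSubobject φ ≫ Subobject.ofLEMk _ a h, by simp⟩

/-- `𝒪_X · W` is the smallest subsheaf whose sections contain `W`. -/
lemma generated_le_iff (W : Submodule ℂ (H0 f F)) (a : G ⟶ F) [Mono a] :
    generated W ≤ Subobject.mk a ↔ W ≤ LinearMap.range (H0map f a) := by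
  constructor
  · intro h v hv
    obtain ⟨ψ, e⟩ : ∃ ψ : freeOn X W ⟶ G, ψ ≫ a = evaluation W :=
      exists_comp_eq_of_imageSubobject_le _ a h
    have e' : freeSec (ψ ≫ a) ⟨v, hv⟩ = (v : H0 f F) :=
      (congrArg (fun φ => freeSec φ _) e).trans (freeSec_evaluation W ⟨v, hv⟩)
    exact ⟨freeSec ψ ⟨v, hv⟩, e'⟩
  · intro h
    choose g hg using fun v : W => h v.2
    refine imageSubobject_le_mk a (evaluation W) (freeDesc fun v => unitHom (g v))
      (evaluation_eq_of_sections fun v => ?_)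
    have e : freeSec ((freeDesc fun v => unitHom (g v)) ≫ a) v =
        a.app ⊤ ((freeι v ≫ freeDesc fun v => unitHom (g v)).app ⊤ (unitOne ⊤)) := rfl
    rw [e, freeι_freeDesc]
    exact (congrArg (a.app ⊤) ((unitHom_app_one (g v) ⊤).trans (res_self _))).trans (hg v)

lemma le_range_generated_arrow (W : Submodule ℂ (H0 f F)) :
    W ≤ LinearMap.range (H0map f (generated W).arrow) := by
  rw [← generated_le_iff, Subobject.mk_arrow]

open scoped ZeroObject in
lemma generated_bot_eq : generated (⊥ : Submodule ℂ (H0 f F)) = ⊥ := by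
  rw [← le_bot_iff, Subobject.bot_eq_zero]
  exact (generated_le_iff ⊥ (0 : (0 : X.Modules) ⟶ F)).2 bot_le

/-- A morphism from a free sheaf whose sections lie in `W` factors through the subsheaf generated
by `W`. -/
lemma exists_lift_generated {r : ℕ} (φ : free X r ⟶ F) (W : Submodule ℂ (H0 f F))
    (h : LinearMap.range (H0map f φ) ≤ W) :
    ∃ ψ : free X r ⟶ (generated W : X.Modules), ψ ≫ (generated W).arrow = φ := by
  choose g hg using fun i : Fin r => le_range_generated_arrow W (h ⟨freeSection f i, rfl⟩)
  refine ⟨freeHom g, free_hom_ext_freeSection (f := f) fun i => ?_⟩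
  rw [H0map_comp, LinearMap.comp_apply, H0map_freeHom, hg]

end Generated

/-! ### Subobjects in the heart -/

section Subobjects

variable {X : Scheme.{0}} {f : X ⟶ Spec (.of ℂ)}

lemma IsCalabiYauThreefold.scalars_bijective (hX : IsCalabiYauThreefold f) :
    Function.Bijective (scalars f ⊤) :=
  have := hX.isIntegral
  hX.projective.scalars_bijective

/-- `c` is the class of a subobject of the pair `s`: it is `(r', length F')` for a commutative
square of monomorphisms from a morphism `𝒪_X^{⊕ r'} ⟶ F'` to `s`. Zero and `s` itself are
included. -/
def IsSubclass {r : ℕ} {F : X.Modules} (s : free X r ⟶ F) (c : ℕ × ℕ) : Prop :=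
  ∃ (F' : X.Modules) (s' : free X c.1 ⟶ F') (b : free X c.1 ⟶ free X r) (a : F' ⟶ F),
    Mono b ∧ Mono a ∧ b ≫ s = s' ≫ a ∧ totalLength F' = c.2

lemma IsCohZero.of_mono [IsNoetherian X] {F G : X.Modules} (hG : IsCohZero G) (a : F ⟶ G) [Mono a] :
    IsCohZero F :=
  isCohZero_iff.2 ((isCohZero_iff.1 hG).of_mono a)

lemma isCohZero_of_isZero [IsNoetherian X] {F : X.Modules} (hF : IsZero F) : IsCohZero F :=
  isCohZero_iff.2 (hasFiniteLength_of_isZero hF)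

lemma isIso_pair {S T : Pair X} (φ : S ⟶ T) (h₁ : IsIso φ.hom.left) (h₂ : IsIso φ.hom.right) :
    IsIso φ := by
  have : IsIso φ.hom := Arrow.isIso_of_isIso_left_of_isIso_right φ.hom
  have : IsIso ((isPair X).ι.map φ) := this
  exact isIso_of_reflects_iso φ (isPair X).ι

lemma mono_pair {S T : Pair X} (φ : S ⟶ T) (h₁ : Mono φ.hom.left) (h₂ : Mono φ.hom.right) :
    Mono φ where
  right_cancellation g h e := by
    have e' : g.hom ≫ φ.hom = h.hom ≫ φ.hom := congrArg (fun χ => χ.hom) e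
    refine ObjectProperty.hom_ext _ (Arrow.hom_ext _ _ ?_ ?_)
    · exact (cancel_mono φ.hom.left).1 (congrArg (fun χ => χ.left) e')
    · exact (cancel_mono φ.hom.right).1 (congrArg (fun χ => χ.right) e')

/-- The kernel of the right component, in degree `1`, is a pair `0 ⟶ K` that is killed by `φ`. -/
lemma mono_right_of_mono [IsNoetherian X] {S T : Pair X} (φ : S ⟶ T) [Mono φ] :
    Mono φ.hom.right := by
  let K := kernel φ.hom.right
  have hK : IsCohZero K := S.property.2.of_mono (kernel.ι φ.hom.right)
  let g : Pair.mk (0 : free X 0 ⟶ K) (isFree_free 0) hK ⟶ S :=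
    Pair.homMk 0 (kernel.ι φ.hom.right) (by exact zero_comp.trans zero_comp.symm)
  let g' : Pair.mk (0 : free X 0 ⟶ K) (isFree_free 0) hK ⟶ S :=
    Pair.homMk 0 0 (by exact zero_comp.trans zero_comp.symm)
  have h : g ≫ φ = g' ≫ φ := by
    refine ObjectProperty.hom_ext _ (Arrow.hom_ext _ _ rfl ?_)
    exact (kernel.condition φ.hom.right).trans zero_comp.symm
  have h' : kernel.ι φ.hom.right = 0 := congrArg (fun χ => χ.hom.right) ((cancel_mono φ).1 h)
  exact Preadditive.mono_of_kernel_zero h'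

/-- A global section killed by the left component gives a morphism from the pair `𝒪_X ⟶ 0` that is
killed by `φ`, because the right component is a monomorphism. -/
lemma mono_left_of_mono [IsNoetherian X] (hf : Function.Bijective (scalars f ⊤)) {S T : Pair X}
    (φ : S ⟶ T) [Mono φ] : Mono φ.hom.left := by
  have := mono_right_of_mono φ
  have hinj : Function.Injective (H0map f φ.hom.left) := by
    rw [injective_iff_map_eq_zero]
    intro v hv
    let β : free X 1 ⟶ S.obj.left := freeHom (f := f) fun _ => v
    have hβ : β ≫ φ.hom.left = 0 := free_hom_ext_freeSection (f := f) fun i => by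
      rw [H0map_comp, LinearMap.comp_apply, H0map_freeHom, hv]
      rfl
    have hβ' : β ≫ S.obj.hom = 0 := by
      rw [← cancel_mono φ.hom.right, Category.assoc, zero_comp]
      exact (congrArg (β ≫ ·) φ.hom.w.symm).trans
        ((Category.assoc _ _ _).symm.trans ((congrArg (· ≫ T.obj.hom) hβ).trans zero_comp))
    let U := Pair.mk (0 : free X 1 ⟶ free X 0) (isFree_free 1)
      (isCohZero_of_isZero isZero_free_zero)
    let g : U ⟶ S := Pair.homMk β 0 (by exact hβ'.trans comp_zero.symm)
    let g' : U ⟶ S := Pair.homMk 0 0 (by exact zero_comp.trans comp_zero.symm)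
    have h : g ≫ φ = g' ≫ φ := by
      refine ObjectProperty.hom_ext _ (Arrow.hom_ext _ _ ?_ rfl)
      exact hβ.trans zero_comp.symm
    have h' : β = 0 := congrArg (fun χ => χ.hom.left) ((cancel_mono φ).1 h)
    have e : H0map f β (freeSection f 0) = v := H0map_freeHom _ _
    rw [← e, h']
    rfl
  obtain ⟨k, ⟨i⟩⟩ := S.property.1
  obtain ⟨r, ⟨j⟩⟩ := T.property.1
  have : Mono (i.inv ≫ φ.hom.left ≫ j.hom) := by
    refine mono_of_H0map_injective hf _ ?_
    rw [H0map_comp, H0map_comp]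
    exact ((H0map_injective j.hom).comp hinj).comp (H0map_injective i.inv)
  have h : φ.hom.left = i.hom ≫ (i.inv ≫ φ.hom.left ≫ j.hom) ≫ j.inv := by simp
  rw [h]
  infer_instance

variable [HasDerivedCategory.{w} X.Modules]

namespace IsCalabiYauThreefold

lemma exists_iso_twoTerm (hX : IsCalabiYauThreefold f) (E : Heart X) :
    ∃ (r : ℕ) (F : X.Modules) (s : free X r ⟶ F), IsCohZero F ∧ Nonempty (E.obj ≅ twoTerm s) := by
  have := hX.isNoetherian
  obtain ⟨A, F, s, ⟨r, ⟨e⟩⟩, hF, ⟨i⟩⟩ := hX.heart_le E.property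
  obtain ⟨j⟩ := nonempty_iso_twoTerm_of_iso (s := s) (s' := e.inv ≫ s) e (Iso.refl F) (by simp)
  exact ⟨r, F, e.inv ≫ s, hF, ⟨i ≪≫ j⟩⟩

variable {E : Heart X} {r : ℕ} {F : X.Modules} {s : free X r ⟶ F}

/-- The class of an object of `𝒜_X` is unique and can be read off from any two-term complex that
represents it. -/
lemma hasClass_iff (hX : IsCalabiYauThreefold f) (hF : IsCohZero F) (e : E.obj ≅ twoTerm s)
    (c : ℤ × ℤ) : HasClass E c ↔ c = ((r : ℤ), (totalLength F : ℤ)) := by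
  have := hX.isNoetherian
  constructor
  · rintro ⟨r', F', s', hF', ⟨e'⟩, rfl⟩
    obtain ⟨⟨i⟩, ⟨j⟩⟩ := hX.nonempty_iso_of_twoTerm_iso (isFree_free r') hF' (isFree_free r) hF
      (e'.symm ≪≫ e)
    rw [(isCohZero_iff.1 hF').length_eq, totalLength_eq_of_iso j,
      eq_of_free_iso hX.scalars_bijective i]
  · rintro rfl
    exact ⟨r, F, s, hF, ⟨e⟩, by rw [(isCohZero_iff.1 hF).length_eq]⟩

/-- The class of a complex `𝒪_X^{⊕ r} ⟶ F` does not depend on the choice of the complex. -/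
lemma cl_eq (hX : IsCalabiYauThreefold f) (hF : IsCohZero F) (e : E.obj ≅ twoTerm s) :
    cl E = ((r : ℤ), (totalLength F : ℤ)) := by
  have h : ∃ c, HasClass E c := ⟨_, (hX.hasClass_iff hF e _).2 rfl⟩
  rw [cl, dif_pos h]
  exact (hX.hasClass_iff hF e _).1 h.choose_spec

/-- The zero object is the only object of class zero. -/
lemma isZero_iff (hX : IsCalabiYauThreefold f) (hF : IsCohZero F) (e : E.obj ≅ twoTerm s) :
    IsZero E ↔ (r, totalLength F) = 0 := by
  have := hX.isNoetherian
  have := hX.faithful_pairToHeart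
  let i := isoPairToHeart (isFree_free r) hF e
  have hl : totalLength F = 0 ↔ IsZero F := (isCohZero_iff.1 hF).totalLength_eq_zero_iff
  constructor
  · intro h
    have h' := h.of_iso i.symm
    have e0 : 𝟙 (Pair.mk s (isFree_free r) hF) = Pair.homMk 0 0 (by simp) :=
      (pairToHeart X).map_injective (h'.eq_of_src _ _)
    have hb : 𝟙 (free X r) = 0 := congrArg (fun φ => φ.hom.left) e0
    have ha : 𝟙 F = 0 := congrArg (fun φ => φ.hom.right) e0
    have hz : IsZero (free X r) := (IsZero.iff_id_eq_zero _).2 hb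
    rw [Prod.mk_eq_zero, hl]
    exact ⟨eq_of_free_iso hX.scalars_bijective (hz.iso isZero_free_zero),
      (IsZero.iff_id_eq_zero _).2 ha⟩
  · intro h
    rw [Prod.mk_eq_zero, hl] at h
    obtain ⟨rfl, h⟩ := h
    have hz : IsZero (twoTerm s : DerivedCategory X.Modules) :=
      Pretriangulated.Triangle.isZero₂_of_isZero₁₃ _ (pair_stupid_distinguished s)
        ((DerivedCategory.singleFunctor X.Modules 1).map_isZero h)
        ((DerivedCategory.singleFunctor X.Modules 0).map_isZero isZero_free_zero)
    have hz' := hz.of_iso e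
    rw [IsZero.iff_id_eq_zero]
    exact ObjectProperty.hom_ext _ (hz'.eq_of_src _ _)

/-- A condition on the classes of the proper subobjects of an object of the heart, in terms of
pairs. -/
lemma forall_subobject_iff (hX : IsCalabiYauThreefold f) (hF : IsCohZero F)
    (e : E.obj ≅ twoTerm s) (P : ℤ × ℤ → Prop) :
    (∀ (E' : Heart X) (i : E' ⟶ E), Mono i → ¬ IsZero E' → ¬ IsIso i → P (cl E')) ↔
      ∀ c, IsSubclass s c → c ≠ 0 → c ≠ (r, totalLength F) → P ((c.1 : ℤ), (c.2 : ℤ)) := by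
  have := hX.isNoetherian
  have := hX.isEquivalence_pairToHeart
  let j := isoPairToHeart (isFree_free r) hF e
  constructor
  · rintro h ⟨r', l'⟩ ⟨F', s', b, a, hb, ha, hs, rfl⟩ h0 h1
    have hF' := hF.of_mono a
    let S' := Pair.mk s' (isFree_free r') hF'
    let φ : S' ⟶ Pair.mk s (isFree_free r) hF := Pair.homMk b a hs
    have hcl : cl ((pairToHeart X).obj S') = ((r' : ℤ), (totalLength F' : ℤ)) :=
      hX.cl_eq (s := s') hF' (Iso.refl _)
    rw [← hcl]
    have : Mono φ := mono_pair φ hb ha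
    refine h _ ((pairToHeart X).map φ ≫ j.inv) inferInstance ?_ fun hi => h1 ?_
    · rwa [hX.isZero_iff (s := s') hF' (Iso.refl _)]
    · have : IsIso ((pairToHeart X).map φ) := by
        have := IsIso.comp_isIso (f := (pairToHeart X).map φ ≫ j.inv) (h := j.hom)
        simpa using this
      have : IsIso φ := isIso_of_reflects_iso φ (pairToHeart X)
      have i := (isPair X).ι.mapIso (asIso φ)
      have i₁ : free X r' ≅ free X r := Arrow.leftFunc.mapIso i
      have i₂ : F' ≅ F := Arrow.rightFunc.mapIso i
      rw [eq_of_free_iso hX.scalars_bijective i₁, totalLength_eq_of_iso i₂]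
  · intro h E' i hi h0 h1
    obtain ⟨r', F', s', hF', ⟨e'⟩⟩ := hX.exists_iso_twoTerm E'
    let j' := isoPairToHeart (isFree_free r') hF' e'
    let φ := (pairToHeart X).preimage (j'.inv ≫ i ≫ j.hom)
    have hφ : (pairToHeart X).map φ = j'.inv ≫ i ≫ j.hom := (pairToHeart X).map_preimage _
    have : Mono ((pairToHeart X).map φ) := by rw [hφ]; infer_instance
    have : Mono φ := (pairToHeart X).mono_of_mono_map this
    have hb : Mono (Y := free X r) φ.hom.left := mono_left_of_mono hX.scalars_bijective φ
    have ha : Mono (Y := F) φ.hom.right := mono_right_of_mono φ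
    rw [hX.cl_eq hF' e']
    refine h (r', totalLength F') ⟨F', s', φ.hom.left, φ.hom.right, hb, ha, φ.hom.w, rfl⟩
      (fun h => h0 ((hX.isZero_iff hF' e').2 h)) fun hc => h1 ?_
    obtain ⟨hr, hl⟩ := Prod.mk.inj hc
    subst hr
    have hb' : ∀ b : free X r' ⟶ free X r', Mono b → IsIso b := fun b _ =>
      isIso_of_mono_free hX.scalars_bijective b
    have : IsIso φ := isIso_pair φ (hb' φ.hom.left hb)
      (isIso_of_totalLength_le (isCohZero_iff.1 hF) φ.hom.right hl.ge)
    have hi' : i = j'.hom ≫ (pairToHeart X).map φ ≫ j.inv := by simp [hφ]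
    rw [hi']
    infer_instance

end IsCalabiYauThreefold
end Subobjects

/-! ### Classes of subobjects -/

section Classes

variable {X : Scheme.{0}} {f : X ⟶ Spec (.of ℂ)} {r : ℕ} {F : X.Modules} {s : free X r ⟶ F}

lemma IsSubclass.le_fst (hf : Function.Bijective (scalars f ⊤)) {c : ℕ × ℕ} (h : IsSubclass s c) :
    c.1 ≤ r := by
  obtain ⟨F', s', b, a, hb, ha, hs, hl⟩ := h
  exact le_of_mono_free hf b

lemma IsSubclass.le_snd (hF : HasFiniteLength F) {c : ℕ × ℕ} (h : IsSubclass s c) :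
    c.2 ≤ totalLength F := by
  obtain ⟨F', s', b, a, hb, ha, hs, hl⟩ := h
  rw [← hl]
  exact totalLength_le_of_mono hF a

lemma isSubclass_of_mono {F' : X.Modules} (a : F' ⟶ F) [Mono a] :
    IsSubclass s (0, totalLength F') :=
  ⟨F', 0, 0, a, ⟨fun _ _ _ => isZero_free_zero.eq_of_tgt _ _⟩, inferInstance,
    zero_comp.trans zero_comp.symm, rfl⟩

lemma isSubclass_zero_totalLength : IsSubclass s (0, totalLength F) := isSubclass_of_mono (𝟙 F)

/-- The kernel of a surjection of `F` onto the structure sheaf of a point has colength one. -/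
lemma HasFiniteLength.exists_mono (hF : HasFiniteLength F) (h : totalLength F ≠ 0) :
    ∃ (F' : X.Modules) (a : F' ⟶ F), Mono a ∧ totalLength F' + 1 = totalLength F := by
  obtain ⟨x, φ, hx, hφ⟩ := hF.exists_epi fun hz => h (hF.totalLength_eq_zero_iff.2 hz)
  have h := totalLength_add (shortExact_of_epi φ) hF
  exact ⟨kernel φ, kernel.ι φ, inferInstance, by
    rw [h]; exact congrArg _ (totalLength_pointSheaf hx).symm⟩

/-- Sheaves of length one are the structure sheaves of closed points. -/
lemma HasFiniteLength.exists_iso_pointSheaf (hF : HasFiniteLength F) (h : totalLength F = 1) :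
    ∃ x : X, IsClosed {x} ∧ Nonempty (F ≅ pointSheaf x) := by
  obtain ⟨x, φ, hx, hφ⟩ := hF.exists_epi fun hz => by
    rw [hF.totalLength_eq_zero_iff.2 hz] at h
    exact zero_ne_one h
  have h' := totalLength_add (shortExact_of_epi φ) hF
  have h0 : totalLength (kernel φ) = 0 := by
    have e : totalLength F = totalLength (kernel φ) + totalLength (pointSheaf x) := h'
    rw [h, totalLength_pointSheaf hx] at e
    omega
  have hz : IsZero (kernel φ) :=
    ((hF.of_mono (kernel.ι φ)).totalLength_eq_zero_iff).1 h0
  have : Mono φ := Preadditive.mono_of_isZero_kernel φ hz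
  have : IsIso φ := isIso_of_mono_of_epi φ
  exact ⟨x, hx, ⟨asIso φ⟩⟩

/-- `𝒪_X` is a subobject of `𝒪_X^{⊕ r} ⟶ 0`. -/
lemma isSubclass_one_zero (hr : 0 < r) (hF : IsZero F) :
    IsSubclass s (1, 0) := by
  have h : (freeDesc fun _ => freeι ⟨0, hr⟩ : free X 1 ⟶ free X r) ≫ freeπ ⟨0, hr⟩ ≫ freeι 0 =
      𝟙 _ := free_hom_ext fun i => by
    rw [← Category.assoc, freeι_freeDesc, ← Category.assoc, freeι_freeπ, if_pos rfl,
      Category.id_comp, Category.comp_id, Subsingleton.elim i 0]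
  exact ⟨F, 0, freeDesc fun _ => freeι ⟨0, hr⟩, 𝟙 F, (SplitMono.mk _ h).mono, inferInstance,
    hF.eq_of_tgt _ _, (hasFiniteLength_of_isZero hF).totalLength_eq_zero_iff.2 hF⟩

/-- An object without a proper subobject of the same slope whose class lies on an axis is simple. -/
lemma eq_of_forall_isSubclass (hF : HasFiniteLength F)
    (h : ∀ c, IsSubclass s c → c ≠ 0 → c ≠ (r, totalLength F) → c.1 * totalLength F ≠ c.2 * r)
    (h0 : (r, totalLength F) ≠ 0) (hp : r = 0 ∨ totalLength F = 0) :
    (r, totalLength F) = (1, 0) ∨ (r, totalLength F) = (0, 1) := by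
  rcases hp with rfl | hl
  · have hl : totalLength F ≠ 0 := fun e => h0 (by rw [e]; rfl)
    obtain ⟨F', a, ha, e⟩ := hF.exists_mono hl
    by_contra! hne
    have hl1 : totalLength F ≠ 1 := fun e => hne.2 (by rw [e])
    refine h (0, totalLength F') (isSubclass_of_mono a) (fun e' => ?_) (fun e' => ?_) (by simp)
    · have := congrArg Prod.snd e'
      dsimp at this
      omega
    · have := congrArg Prod.snd e'
      dsimp at this
      omega
  · have hr : r ≠ 0 := fun e => h0 (by rw [hl, e]; rfl)
    by_contra! hne
    refine h (1, 0) (isSubclass_one_zero (Nat.pos_of_ne_zero hr)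
      (hF.totalLength_eq_zero_iff.1 hl)) (by simp) (fun e' => hne.1 ?_) (by simp [hl])
    rw [← e']

/-- The subsheaf generated by `W` has the least length among the subsheaves whose sections contain
`W`. -/
lemma totalLength_generated_le (hF : HasFiniteLength F) {G : X.Modules} (W : Submodule ℂ (H0 f F))
    (a : G ⟶ F) [Mono a] (h : W ≤ LinearMap.range (H0map f a)) :
    totalLength (generated W : X.Modules) ≤ totalLength G :=
  totalLength_le_of_mono (hF.of_mono a) (Subobject.ofLEMk _ a ((generated_le_iff W a).2 h))

/-- A space of sections of `𝒪_X^{⊕ r}` and the subsheaf of `F` that its image generates form a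
subobject. -/
lemma isSubclass_generated (hf : Function.Bijective (scalars f ⊤))
    (U : Submodule ℂ (H0 f (free X r))) :
    IsSubclass s (Module.finrank ℂ U, totalLength (generated (U.map (H0map f s)) : X.Modules)) := by
  obtain ⟨b, hb, hU⟩ := exists_mono_free hf U
  obtain ⟨ψ, hψ⟩ := exists_lift_generated (b ≫ s) (U.map (H0map f s))
    (by rw [H0map_comp, LinearMap.range_comp, hU])
  exact ⟨_, ψ, b, (generated _).arrow, hb, inferInstance, hψ.symm, rfl⟩

/-- The sheaf part of a subobject contains the subsheaf generated by the sections that it has to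
contain. -/
lemma IsSubclass.exists_submodule (hf : Function.Bijective (scalars f ⊤)) (hF : HasFiniteLength F)
    {c : ℕ × ℕ} (h : IsSubclass s c) : ∃ U : Submodule ℂ (H0 f (free X r)),
      Module.finrank ℂ U = c.1 ∧
        totalLength (generated (U.map (H0map f s)) : X.Modules) ≤ c.2 := by
  obtain ⟨F', s', b, a, hb, ha, hs, hl⟩ := h
  refine ⟨LinearMap.range (H0map f b), ?_, ?_⟩
  · rw [LinearMap.finrank_range_of_inj (H0map_injective b), finrank_H0_free hf]
  · rw [← hl]
    refine totalLength_generated_le hF _ a ?_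
    rw [← LinearMap.range_comp, ← H0map_comp, hs, H0map_comp]
    exact LinearMap.range_comp_le_range _ _

lemma totalLength_generated_bot :
    totalLength (generated (⊥ : Submodule ℂ (H0 f F)) : X.Modules) = 0 := by
  rw [generated_bot_eq]
  have hz : IsZero ((⊥ : Subobject F) : X.Modules) :=
    IsZero.of_iso (isZero_zero _) Subobject.botCoeIsoZero
  exact (hasFiniteLength_of_isZero hz).totalLength_eq_zero_iff.2 hz

lemma totalLength_top : totalLength ((⊤ : Subobject F) : X.Modules) = totalLength F :=
  totalLength_eq_of_iso (asIso (⊤ : Subobject F).arrow)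

lemma finrank_map_H0map (hs : Function.Injective (H0map f s)) (U : Submodule ℂ (H0 f (free X r))) :
    Module.finrank ℂ (U.map (H0map f s)) = Module.finrank ℂ U :=
  (Submodule.equivMapOfInjective _ hs U).finrank_eq.symm

/-- If no subobject has excessive slope, then `H⁰(s)` is injective and its image generates `F`.
Otherwise the kernel of `H⁰(s)`, which gives a subobject `𝒪_X^{⊕ k} ⟶ 0`, or the subobject `𝒪_X^{⊕
r} ⟶ 𝒪_X · V` violates the inequality. -/
lemma injective_and_generated_eq_top (hf : Function.Bijective (scalars f ⊤))
    (hF : HasFiniteLength F) (hr : 0 < r) (hl : 0 < totalLength F)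
    (h : ∀ c, IsSubclass s c → c ≠ 0 → c ≠ (r, totalLength F) → c.1 * totalLength F ≤ c.2 * r) :
    Function.Injective (H0map f s) ∧ generated (imageSections f s) = ⊤ := by
  have := finite_H0_free hf r
  constructor
  · have hsub := isSubclass_generated hf (s := s) (LinearMap.ker (H0map f s))
    rw [LinearMap.le_ker_iff_map.1 le_rfl, totalLength_generated_bot] at hsub
    by_contra hinj
    have hk : Module.finrank ℂ (LinearMap.ker (H0map f s)) ≠ 0 := fun e =>
      hinj (LinearMap.ker_eq_bot.1 (Submodule.finrank_eq_zero.1 e))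
    have h' := h _ hsub (fun e => hk (congrArg Prod.fst e))
      (fun e => hl.ne (congrArg Prod.snd e))
    have : 0 < Module.finrank ℂ (LinearMap.ker (H0map f s)) * totalLength F := by positivity
    simp only [zero_mul] at h'
    omega
  · have hsub := isSubclass_generated hf (s := s) ⊤
    rw [Submodule.map_top, finrank_top, finrank_H0_free hf] at hsub
    have hge : totalLength F ≤ totalLength (generated (imageSections f s) : X.Modules) := by
      by_contra hlt
      have h' := h _ hsub (fun e => hr.ne' (congrArg Prod.fst e))
        (fun e => hlt (congrArg Prod.snd e).ge)
      exact hlt (Nat.le_of_mul_le_mul_left (h'.trans_eq (mul_comm _ _)) hr)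
    have := isIso_of_totalLength_le hF (generated (imageSections f s)).arrow hge
    exact (Subobject.isIso_arrow_iff_eq_top _).1 this

/-- A proper nonzero subspace `W` of the image of `H⁰(s)` gives a proper nonzero subobject of class
`(dim W, length (𝒪_X · W))`. -/
lemma exists_isSubclass_generated (hf : Function.Bijective (scalars f ⊤))
    (hs : Function.Injective (H0map f s)) {W : Submodule ℂ (H0 f F)} (h0 : ⊥ < W)
    (hW : W < imageSections f s) :
    IsSubclass s (Module.finrank ℂ W, totalLength (generated W : X.Modules)) ∧
      0 < Module.finrank ℂ W ∧ Module.finrank ℂ W < r := by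
  have := finite_H0_free hf r
  have hfin : Module.Finite ℂ (imageSections f s) :=
    inferInstanceAs (Module.Finite ℂ (LinearMap.range (H0map f s)))
  have hfinW : Module.Finite ℂ W := Submodule.finiteDimensional_of_le hW.le
  have hm : (W.comap (H0map f s)).map (H0map f s) = W := Submodule.map_comap_eq_of_le hW.le
  have hsub := isSubclass_generated hf (s := s) (W.comap (H0map f s))
  rw [← finrank_map_H0map hs, hm] at hsub
  refine ⟨hsub, ?_, ?_⟩
  · exact Nat.pos_of_ne_zero fun e => h0.ne' (Submodule.finrank_eq_zero.1 e)
  · have := Submodule.finrank_lt_finrank_of_lt hW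
    rwa [imageSections, LinearMap.finrank_range_of_inj hs, finrank_H0_free hf] at this

lemma injective_of_finrank_eq (hf : Function.Bijective (scalars f ⊤))
    (hs : Module.finrank ℂ (imageSections f s) = r) : Function.Injective (H0map f s) := by
  have := finite_H0_free hf r
  have h := LinearMap.finrank_range_add_finrank_ker (H0map f s)
  rw [finrank_H0_free hf] at h
  rw [← LinearMap.ker_eq_bot, ← Submodule.finrank_eq_zero]
  have e : Module.finrank ℂ (LinearMap.range (H0map f s)) = r := hs
  omega

/-- Every subobject lies in degree `1`, or has full class, or contains the subobject given by a
proper nonzero subspace `W` with the same rank. Only the last kind can violate the slope inequality.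
-/
lemma IsSubclass.eq_or_exists (hf : Function.Bijective (scalars f ⊤)) (hF : HasFiniteLength F)
    (hs : Module.finrank ℂ (imageSections f s) = r) (hg : generated (imageSections f s) = ⊤)
    {c : ℕ × ℕ} (h : IsSubclass s c) :
    c.1 = 0 ∨ c = (r, totalLength F) ∨ ∃ W : Submodule ℂ (H0 f F), ⊥ < W ∧
      W < imageSections f s ∧ Module.finrank ℂ W = c.1 ∧
        totalLength (generated W : X.Modules) ≤ c.2 := by
  have := finite_H0_free hf r
  have hinj := injective_of_finrank_eq hf hs
  obtain ⟨U, hU, hle⟩ := h.exists_submodule hf hF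
  by_cases h0 : c.1 = 0
  · exact .inl h0
  refine .inr ?_
  by_cases hV : U.map (H0map f s) = imageSections f s
  -- the image generates `F`, so the sheaf part is everything
  · left
    rw [hV, hg, totalLength_top] at hle
    have h1 : c.1 = r := by rw [← hU, ← finrank_map_H0map hinj, hV, hs]
    exact Prod.ext h1 ((h.le_snd hF).antisymm hle)
  · right
    refine ⟨U.map (H0map f s), bot_lt_iff_ne_bot.2 fun e => h0 ?_,
      lt_of_le_of_ne LinearMap.map_le_range hV, (finrank_map_H0map hinj U).trans hU, hle⟩
    rw [← hU, ← finrank_map_H0map hinj, e, finrank_bot]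

lemma length_generated (hF : HasFiniteLength F) (W : Submodule ℂ (H0 f F)) :
    length (generated W : X.Modules) = totalLength (generated W : X.Modules) :=
  (hF.of_mono (generated W).arrow).length_eq

/-- The conditions on the subspaces of `V` amount to the slope inequality for all proper subobjects.
-/
lemma isSemistablePair_iff (hf : Function.Bijective (scalars f ⊤)) (hF : HasFiniteLength F)
    (hr : 0 < r) (hl : 0 < totalLength F) :
    IsSemistablePair f s ↔ ∀ c, IsSubclass s c → c ≠ 0 → c ≠ (r, totalLength F) →
      c.1 * totalLength F ≤ c.2 * r := by
  constructor
  · rintro ⟨h1, h2, h3⟩ c hc h0 hc'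
    rcases hc.eq_or_exists hf hF h1 h2 with h | h | ⟨W, hW, hW', hd, hle⟩
    · rw [h, zero_mul]
      exact Nat.zero_le _
    · exact absurd h hc'
    · have h := h3 W hW hW'
      rw [hF.length_eq, length_generated hF, div_le_div_iff₀ (by exact_mod_cast hr)
        (by exact_mod_cast
          (exists_isSubclass_generated hf (injective_of_finrank_eq hf h1) hW hW').2.1)] at h
      have h' : totalLength F * c.1 ≤ totalLength (generated W : X.Modules) * r := by
        rw [← hd]; exact_mod_cast h
      calc c.1 * totalLength F = totalLength F * c.1 := mul_comm _ _
        _ ≤ _ := h'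
        _ ≤ c.2 * r := Nat.mul_le_mul_right _ hle
  · intro h
    obtain ⟨hs, hg⟩ := injective_and_generated_eq_top hf hF hr hl h
    refine ⟨by rw [imageSections, LinearMap.finrank_range_of_inj hs, finrank_H0_free hf], hg,
      fun W hW hW' => ?_⟩
    obtain ⟨hsub, hpos, hlt⟩ := exists_isSubclass_generated hf hs hW hW'
    have h' := h _ hsub (fun e => hpos.ne' (congrArg Prod.fst e))
      (fun e => hlt.ne (congrArg Prod.fst e))
    rw [hF.length_eq, length_generated hF, div_le_div_iff₀ (by exact_mod_cast hr)
      (by exact_mod_cast hpos), mul_comm]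
    exact_mod_cast h'

/-- The conditions on the subspaces of `V`, with strict inequalities, amount to the strict slope
inequality for all proper subobjects. -/
lemma isStablePair_iff (hf : Function.Bijective (scalars f ⊤)) (hF : HasFiniteLength F)
    (hr : 0 < r) (hl : 0 < totalLength F) :
    IsStablePair f s ↔ ∀ c, IsSubclass s c → c ≠ 0 → c ≠ (r, totalLength F) →
      c.1 * totalLength F < c.2 * r := by
  constructor
  · rintro ⟨h1, h2, h3⟩ c hc h0 hc'
    rcases hc.eq_or_exists hf hF h1 h2 with h | h | ⟨W, hW, hW', hd, hle⟩
    · rw [h, zero_mul]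
      exact Nat.mul_pos (Nat.pos_of_ne_zero fun e => h0 (Prod.ext h e)) hr
    · exact absurd h hc'
    · have h := h3 W hW hW'
      rw [hF.length_eq, length_generated hF, div_lt_div_iff₀ (by exact_mod_cast hr)
        (by exact_mod_cast
          (exists_isSubclass_generated hf (injective_of_finrank_eq hf h1) hW hW').2.1)] at h
      have h' : totalLength F * c.1 < totalLength (generated W : X.Modules) * r := by
        rw [← hd]; exact_mod_cast h
      calc c.1 * totalLength F = totalLength F * c.1 := mul_comm _ _
        _ < _ := h'
        _ ≤ c.2 * r := Nat.mul_le_mul_right _ hle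
  · intro h
    obtain ⟨hs, hg⟩ := injective_and_generated_eq_top hf hF hr hl
      fun c h1 h2 h3 => (h c h1 h2 h3).le
    refine ⟨by rw [imageSections, LinearMap.finrank_range_of_inj hs, finrank_H0_free hf], hg,
      fun W hW hW' => ?_⟩
    obtain ⟨hsub, hpos, hlt⟩ := exists_isSubclass_generated hf hs hW hW'
    have h' := h _ hsub (fun e => hpos.ne' (congrArg Prod.fst e))
      (fun e => hlt.ne (congrArg Prod.fst e))
    rw [hF.length_eq, length_generated hF, div_lt_div_iff₀ (by exact_mod_cast hr)
      (by exact_mod_cast hpos), mul_comm]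
    exact_mod_cast h'

end Classes

/-! ### Phases -/

section Phases

/-- In the open upper half-plane, arguments are compared by the sign of a determinant, which is `|z|
|w| sin (arg w - arg z)`. -/
lemma arg_lt_arg_iff {z w : ℂ} (hz : 0 < z.im) (hw : 0 < w.im) :
    Complex.arg z < Complex.arg w ↔ w.re * z.im < z.re * w.im := by
  have hz0 : 0 < ‖z‖ := norm_pos_iff.2 fun h => by simp [h] at hz
  have hw0 : 0 < ‖w‖ := norm_pos_iff.2 fun h => by simp [h] at hw
  have e : z.re * w.im - w.re * z.im = ‖z‖ * ‖w‖ * Real.sin (w.arg - z.arg) := by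
    rw [Real.sin_sub]
    linear_combination -w.im * Complex.norm_mul_cos_arg z -
      ‖z‖ * Real.cos z.arg * Complex.norm_mul_sin_arg w + z.im * Complex.norm_mul_cos_arg w +
      ‖w‖ * Real.cos w.arg * Complex.norm_mul_sin_arg z
  have hz1 := Complex.arg_nonneg_iff.2 hz.le
  have hw1 := Complex.arg_nonneg_iff.2 hw.le
  have hz2 : z.arg < Real.pi := Complex.arg_lt_pi_iff.2 (.inr hz.ne')
  have hw2 : w.arg < Real.pi := Complex.arg_lt_pi_iff.2 (.inr hw.ne')
  rw [← sub_pos (a := z.re * w.im), e]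
  constructor
  · intro h
    have := Real.sin_pos_of_pos_of_lt_pi (x := w.arg - z.arg) (by linarith) (by linarith)
    positivity
  · intro h
    by_contra! h'
    have := Real.sin_nonpos_of_nonpos_of_neg_pi_le (x := w.arg - z.arg) (by linarith) (by linarith)
    have : ‖z‖ * ‖w‖ * Real.sin (w.arg - z.arg) ≤ 0 :=
      mul_nonpos_of_nonneg_of_nonpos (by positivity) this
    linarith

lemma apply_eq (Z : ℤ × ℤ →+ ℂ) (a b : ℕ) :
    Z ((a : ℤ), (b : ℤ)) = a * Z (1, 0) + b * Z (0, 1) := by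
  have h : ((a : ℤ), (b : ℤ)) = (a : ℤ) • ((1 : ℤ), (0 : ℤ)) + (b : ℤ) • ((0 : ℤ), (1 : ℤ)) := by
    simp
  rw [h, map_add, map_zsmul, map_zsmul]
  simp

variable {Z : ℤ × ℤ →+ ℂ}

/-- The values of `Z` at two classes are compared by the sign of a determinant, which is the product
of the determinants of the two classes and of the values of `Z` at the basis. -/
lemma arg_apply_lt_iff (h₁ : 0 < (Z (1, 0)).im) (h₂ : 0 < (Z (0, 1)).im) {c d : ℕ × ℕ} (hc : c ≠ 0)
    (hd : d ≠ 0) : Complex.arg (Z ((c.1 : ℤ), (c.2 : ℤ))) < Complex.arg (Z ((d.1 : ℤ), (d.2 : ℤ))) ↔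
      0 < ((c.1 * d.2 : ℝ) - c.2 * d.1) *
        ((Z (1, 0)).re * (Z (0, 1)).im - (Z (0, 1)).re * (Z (1, 0)).im) := by
  have him {c : ℕ × ℕ} (hc : c ≠ 0) : 0 < (Z ((c.1 : ℤ), (c.2 : ℤ))).im := by
    rw [apply_eq]
    have h : c.1 ≠ 0 ∨ c.2 ≠ 0 := by
      by_contra! h
      exact hc (Prod.ext h.1 h.2)
    simp only [Complex.add_im, Complex.mul_im, Complex.natCast_re, Complex.natCast_im, zero_mul,
      add_zero]
    rcases h with h | h
    · have : (0 : ℝ) < c.1 := by exact_mod_cast Nat.pos_of_ne_zero h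
      positivity
    · have : (0 : ℝ) < c.2 := by exact_mod_cast Nat.pos_of_ne_zero h
      positivity
  rw [arg_lt_arg_iff (him hc) (him hd), ← sub_pos]
  rw [apply_eq, apply_eq]
  simp only [Complex.add_im, Complex.mul_im, Complex.natCast_re, Complex.natCast_im, zero_mul,
      add_zero, Complex.add_re, Complex.mul_re, sub_zero]
  apply iff_of_eq
  congr 1
  ring

lemma arg_lt_iff_of_lt (h₁ : 0 < (Z (1, 0)).im) (h₂ : 0 < (Z (0, 1)).im) {c d : ℕ × ℕ} (hc : c ≠ 0)
    (hd : d ≠ 0)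
    (h : Complex.arg (Z (1, 0)) < Complex.arg (Z (0, 1))) :
    Complex.arg (Z ((c.1 : ℤ), (c.2 : ℤ))) < Complex.arg (Z ((d.1 : ℤ), (d.2 : ℤ))) ↔
      c.2 * d.1 < c.1 * d.2 := by
  rw [arg_lt_arg_iff h₁ h₂] at h
  rw [arg_apply_lt_iff h₁ h₂ hc hd, mul_pos_iff_of_pos_right (sub_pos.2 h), sub_pos]
  exact_mod_cast Iff.rfl

lemma arg_lt_iff_of_gt (h₁ : 0 < (Z (1, 0)).im) (h₂ : 0 < (Z (0, 1)).im) {c d : ℕ × ℕ} (hc : c ≠ 0)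
    (hd : d ≠ 0)
    (h : Complex.arg (Z (0, 1)) < Complex.arg (Z (1, 0))) :
    Complex.arg (Z ((c.1 : ℤ), (c.2 : ℤ))) < Complex.arg (Z ((d.1 : ℤ), (d.2 : ℤ))) ↔
      c.1 * d.2 < c.2 * d.1 := by
  rw [arg_lt_arg_iff h₂ h₁] at h
  rw [arg_apply_lt_iff h₁ h₂ hc hd, ← neg_mul_neg, mul_pos_iff_of_pos_right (by linarith), neg_sub,
    sub_pos]
  exact_mod_cast Iff.rfl

lemma arg_eq_of_eq (h₁ : 0 < (Z (1, 0)).im) (h₂ : 0 < (Z (0, 1)).im) {c d : ℕ × ℕ} (hc : c ≠ 0)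
    (hd : d ≠ 0)
    (h : Complex.arg (Z (1, 0)) = Complex.arg (Z (0, 1))) :
    Complex.arg (Z ((c.1 : ℤ), (c.2 : ℤ))) = Complex.arg (Z ((d.1 : ℤ), (d.2 : ℤ))) := by
  have h' := mt (arg_lt_arg_iff h₁ h₂).2 h.not_lt
  have h'' := mt (arg_lt_arg_iff h₂ h₁).2 h.not_gt
  have h0 : (Z (1, 0)).re * (Z (0, 1)).im - (Z (0, 1)).re * (Z (1, 0)).im = 0 := by linarith
  refine le_antisymm (not_lt.1 ?_) (not_lt.1 ?_)
  · rw [arg_apply_lt_iff h₁ h₂ hd hc, h0, mul_zero]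
    exact lt_irrefl _
  · rw [arg_apply_lt_iff h₁ h₂ hc hd, h0, mul_zero]
    exact lt_irrefl _

end Phases

/-! ### Semistable and stable objects -/

section Stability

variable {X : Scheme.{0}} {f : X ⟶ Spec (.of ℂ)}

namespace IsCalabiYauThreefold

variable {r : ℕ} {F : X.Modules} {s : free X r ⟶ F}

/-- A closed point is needed for an object of class `(0, 1)`, on which `Z` takes its value at the
second basis vector. -/
lemma exists_isClosed_singleton (hX : IsCalabiYauThreefold f) : ∃ x : X, IsClosed {x} := by
  have := hX.isIntegral
  have := hX.isNoetherian
  obtain ⟨x, -, hx⟩ := IsClosed.exists_closed_singleton (isClosed_univ (X := X)) Set.univ_nonempty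
  exact ⟨x, hx⟩

lemma ne_zero_of_isSubclass (hX : IsCalabiYauThreefold f) (hF : IsCohZero F) {c : ℕ × ℕ}
    (hc : IsSubclass s c) (h0 : c ≠ 0) : (r, totalLength F) ≠ 0 := by
  have := hX.isNoetherian
  intro h
  have h1 := hc.le_fst hX.scalars_bijective
  have h2 := hc.le_snd (isCohZero_iff.1 hF)
  rw [Prod.mk_eq_zero] at h
  exact h0 (Prod.ext (Nat.le_zero.1 (h1.trans_eq h.1)) (Nat.le_zero.1 (h2.trans_eq h.2)))

/-- All subobjects of an object whose class lies on an axis have classes on the same axis. -/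
lemma mul_eq_zero_of_isSubclass (hX : IsCalabiYauThreefold f) (hF : IsCohZero F)
    (hp : r = 0 ∨ totalLength F = 0) {c : ℕ × ℕ} (hc : IsSubclass s c) :
    c.1 * totalLength F = 0 ∧ c.2 * r = 0 := by
  have := hX.isNoetherian
  have h2 := hc.le_fst hX.scalars_bijective
  have h3 := hc.le_snd (isCohZero_iff.1 hF)
  rcases hp with hp | hp
  · rw [hp, Nat.le_zero] at h2
    rw [h2, hp, zero_mul, mul_zero]
    exact ⟨rfl, rfl⟩
  · rw [hp, Nat.le_zero] at h3
    rw [h3, hp, zero_mul, mul_zero]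
    exact ⟨rfl, rfl⟩

variable [HasDerivedCategory.{w} X.Modules] {E : Heart X} {Z : ℤ × ℤ →+ ℂ}

lemma im_pos (hX : IsCalabiYauThreefold f) (hZ : IsStabilityCondition X Z)
    (s : free X r ⟶ F) (hF : IsCohZero F) (h : (r, totalLength F) ≠ 0) :
    0 < (Z ((r : ℤ), (totalLength F : ℤ))).im := by
  have := hX.isNoetherian
  let E := (pairToHeart X).obj (.mk s (isFree_free r) hF)
  have h' := hZ E (mt (hX.isZero_iff (E := E) (s := s) hF (Iso.refl _)).1 h)
  rwa [hX.cl_eq (E := E) (s := s) hF (Iso.refl _)] at h'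

lemma im_apply_one_zero_pos (hX : IsCalabiYauThreefold f) (hZ : IsStabilityCondition X Z) :
    0 < (Z (1, 0)).im := by
  have := hX.isNoetherian
  have hz : totalLength (free X 0) = 0 :=
    (hasFiniteLength_of_isZero isZero_free_zero).totalLength_eq_zero_iff.2 isZero_free_zero
  have h := hX.im_pos hZ (0 : free X 1 ⟶ free X 0) (isCohZero_of_isZero isZero_free_zero) (by simp)
  rw [hz] at h
  exact_mod_cast h

lemma im_apply_zero_one_pos (hX : IsCalabiYauThreefold f) (hZ : IsStabilityCondition X Z) :
    0 < (Z (0, 1)).im := by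
  have := hX.isNoetherian
  obtain ⟨x, hx⟩ := hX.exists_isClosed_singleton
  have h := hX.im_pos hZ (0 : free X 0 ⟶ pointSheaf x)
    (isCohZero_iff.2 (hasFiniteLength_pointSheaf hx)) (by simp [totalLength_pointSheaf hx])
  rw [totalLength_pointSheaf hx] at h
  exact_mod_cast h

lemma isSemistable_iff (hX : IsCalabiYauThreefold f) (hF : IsCohZero F)
    (e : E.obj ≅ twoTerm s) : IsSemistable Z E ↔
      ∀ c, IsSubclass s c → c ≠ 0 → c ≠ (r, totalLength F) →
        Complex.arg (Z ((c.1 : ℤ), (c.2 : ℤ))) ≤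
          Complex.arg (Z ((r : ℤ), (totalLength F : ℤ))) := by
  have h := hX.forall_subobject_iff hF e
    fun c => Complex.arg (Z c) ≤ Complex.arg (Z ((r : ℤ), (totalLength F : ℤ)))
  rw [← h, IsSemistable, hX.cl_eq hF e]

lemma isStable_iff (hX : IsCalabiYauThreefold f) (hF : IsCohZero F)
    (e : E.obj ≅ twoTerm s) : IsStable Z E ↔ (r, totalLength F) ≠ 0 ∧
      ∀ c, IsSubclass s c → c ≠ 0 → c ≠ (r, totalLength F) →
        Complex.arg (Z ((c.1 : ℤ), (c.2 : ℤ))) <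
          Complex.arg (Z ((r : ℤ), (totalLength F : ℤ))) := by
  have h := hX.forall_subobject_iff hF e
    fun c => Complex.arg (Z c) < Complex.arg (Z ((r : ℤ), (totalLength F : ℤ)))
  rw [← h, IsStable, hX.cl_eq hF e, hX.isZero_iff hF e]

open scoped ZeroObject

/-- Pure objects are those with a class on one of the two axes. -/
lemma isPure_iff (hX : IsCalabiYauThreefold f) (hF : IsCohZero F) (e : E.obj ≅ twoTerm s) :
    IsPure E ↔ r = 0 ∨ totalLength F = 0 := by
  have := hX.isNoetherian
  have hF' := isCohZero_iff.1 hF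
  have hcl := hX.cl_eq hF e
  constructor
  · rintro (⟨r', ⟨i⟩⟩ | ⟨F', hF'', ⟨i⟩⟩)
    · have h := hX.cl_eq (isCohZero_of_isZero (isZero_zero X.Modules)) i
      rw [hcl, (hasFiniteLength_of_isZero (isZero_zero X.Modules)).totalLength_eq_zero_iff.2
        (isZero_zero X.Modules)] at h
      exact .inr (by exact_mod_cast (Prod.mk.inj h).2)
    · obtain ⟨j⟩ := nonempty_iso_twoTerm_of_iso (s := (0 : (0 : X.Modules) ⟶ F'))
        (s' := (0 : free X 0 ⟶ F')) (isZero_zero _ |>.iso isZero_free_zero) (Iso.refl F') (by simp)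
      have h := hX.cl_eq hF'' (i ≪≫ j)
      rw [hcl] at h
      exact .inl (by exact_mod_cast (Prod.mk.inj h).1)
  · rintro (rfl | h)
    · obtain ⟨j⟩ := nonempty_iso_twoTerm_of_iso (s := s) (s' := (0 : (0 : X.Modules) ⟶ F))
        (isZero_free_zero.iso (isZero_zero _)) (Iso.refl F) (isZero_free_zero.eq_of_src _ _)
      exact .inr ⟨F, hF, ⟨e ≪≫ j⟩⟩
    · have hz := hF'.totalLength_eq_zero_iff.1 h
      obtain ⟨j⟩ := nonempty_iso_twoTerm_of_iso (s := s) (s' := (0 : free X r ⟶ (0 : X.Modules)))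
        (Iso.refl _) (hz.iso (isZero_zero _)) ((isZero_zero _).eq_of_tgt _ _)
      exact .inl ⟨r, ⟨e ≪≫ j⟩⟩

/-- `S₀` and the objects `S_x` are those whose class is a basis vector. -/
lemma isSimplePure_iff (hX : IsCalabiYauThreefold f) (hF : IsCohZero F) (e : E.obj ≅ twoTerm s) :
    IsSimplePure E ↔ (r, totalLength F) = (1, 0) ∨ (r, totalLength F) = (0, 1) := by
  have := hX.isNoetherian
  have hF' := isCohZero_iff.1 hF
  have hcl := hX.cl_eq hF e
  constructor
  · rintro (⟨⟨i⟩⟩ | ⟨x, hx, ⟨i⟩⟩)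
    · obtain ⟨j⟩ := nonempty_iso_twoTerm_of_iso (s := (0 : structureSheaf X ⟶ (0 : X.Modules)))
        (s' := (0 : free X 1 ⟶ (0 : X.Modules))) freeOneIso.symm (Iso.refl _) (by simp)
      have h := hX.cl_eq (isCohZero_of_isZero (isZero_zero X.Modules)) (i ≪≫ j)
      rw [hcl, (hasFiniteLength_of_isZero (isZero_zero X.Modules)).totalLength_eq_zero_iff.2
        (isZero_zero X.Modules)] at h
      exact .inl (Prod.ext (by exact_mod_cast (Prod.mk.inj h).1)
        (by exact_mod_cast (Prod.mk.inj h).2))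
    · obtain ⟨j⟩ := nonempty_iso_twoTerm_of_iso (s := (0 : (0 : X.Modules) ⟶ pointSheaf x))
        (s' := (0 : free X 0 ⟶ pointSheaf x)) (isZero_zero _ |>.iso isZero_free_zero) (Iso.refl _)
        (by simp)
      have h := hX.cl_eq (isCohZero_iff.2 (hasFiniteLength_pointSheaf hx)) (i ≪≫ j)
      rw [hcl, totalLength_pointSheaf hx] at h
      exact .inr (Prod.ext (by exact_mod_cast (Prod.mk.inj h).1)
        (by exact_mod_cast (Prod.mk.inj h).2))
  · rintro (h | h)
    · obtain ⟨hr, hl⟩ := Prod.mk.inj h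
      subst hr
      have hz := hF'.totalLength_eq_zero_iff.1 hl
      obtain ⟨j⟩ := nonempty_iso_twoTerm_of_iso (s := s)
        (s' := (0 : structureSheaf X ⟶ (0 : X.Modules))) freeOneIso (hz.iso (isZero_zero _))
        ((isZero_zero _).eq_of_tgt _ _)
      exact .inl ⟨e ≪≫ j⟩
    · obtain ⟨hr, hl⟩ := Prod.mk.inj h
      subst hr
      obtain ⟨x, hx, ⟨i⟩⟩ := hF'.exists_iso_pointSheaf hl
      obtain ⟨j⟩ := nonempty_iso_twoTerm_of_iso (s := s)
        (s' := (0 : (0 : X.Modules) ⟶ pointSheaf x)) (isZero_free_zero.iso (isZero_zero _)) i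
        (isZero_free_zero.eq_of_src _ _)
      exact .inr ⟨x, hx, ⟨e ≪≫ j⟩⟩

/-- The objects `S₀` and `S_x` have no proper subobjects. -/
lemma isStable_of_isSimplePure (hX : IsCalabiYauThreefold f) (hE : IsSimplePure E) :
    IsStable Z E := by
  have := hX.isNoetherian
  obtain ⟨r, F, s, hF, ⟨e⟩⟩ := hX.exists_iso_twoTerm E
  rw [hX.isSimplePure_iff hF e] at hE
  rw [hX.isStable_iff hF e]
  refine ⟨fun h => ?_, fun c hc h0 h1 => ?_⟩
  · rw [Prod.mk_eq_zero] at h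
    rw [Prod.mk.injEq, Prod.mk.injEq] at hE
    omega
  · have h2 := hc.le_fst hX.scalars_bijective
    have h3 := hc.le_snd (isCohZero_iff.1 hF)
    obtain ⟨a, b⟩ := c
    rw [ne_eq, Prod.mk_eq_zero] at h0
    rw [ne_eq, Prod.mk.injEq] at h1
    rw [Prod.mk.injEq, Prod.mk.injEq] at hE
    dsimp only at h2 h3
    omega

/-- A pure object without a proper subobject of the same slope is `S₀` or some `S_x`. -/
lemma isSimplePure_of_isPure (hX : IsCalabiYauThreefold f) (hF : IsCohZero F)
    (e : E.obj ≅ twoTerm s) (hp : r = 0 ∨ totalLength F = 0) (h0 : (r, totalLength F) ≠ 0)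
    (h : ∀ c, IsSubclass s c → c ≠ 0 → c ≠ (r, totalLength F) → c.1 * totalLength F ≠ c.2 * r) :
    IsSimplePure E := by
  have := hX.isNoetherian
  rw [hX.isSimplePure_iff hF e]
  exact eq_of_forall_isSubclass (isCohZero_iff.1 hF) h h0 hp

lemma isSemistable_iff_of_lt (hX : IsCalabiYauThreefold f) (hZ : IsStabilityCondition X Z)
    (h : Complex.arg (Z (1, 0)) < Complex.arg (Z (0, 1))) : IsSemistable Z E ↔ IsPure E := by
  have := hX.isNoetherian
  obtain ⟨r, F, s, hF, ⟨e⟩⟩ := hX.exists_iso_twoTerm E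
  have h1 := hX.im_apply_one_zero_pos hZ
  have h2 := hX.im_apply_zero_one_pos hZ
  rw [hX.isSemistable_iff hF e, hX.isPure_iff hF e]
  constructor
  · intro hs
    by_contra! hp
    -- the subobject `F[-1]` has the larger phase
    have hc := hs (0, totalLength F) isSubclass_zero_totalLength
      (fun h => hp.2 (congrArg Prod.snd h)) (fun h => hp.1 (congrArg Prod.fst h).symm)
    rw [← not_lt, arg_lt_iff_of_lt h1 h2 (c := (r, totalLength F))
      (fun h => hp.2 (congrArg Prod.snd h)) (fun h => hp.2 (congrArg Prod.snd h)) h] at hc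
    apply hc
    have := Nat.mul_pos (Nat.pos_of_ne_zero hp.1) (Nat.pos_of_ne_zero hp.2)
    simpa using this
  · intro hp c hc h0 h0'
    obtain ⟨hm, hm'⟩ := hX.mul_eq_zero_of_isSubclass hF hp hc
    rw [← not_lt, arg_lt_iff_of_lt h1 h2 (c := (r, totalLength F))
      (hX.ne_zero_of_isSubclass hF hc h0) h0 h]
    dsimp only
    rw [mul_comm, hm, mul_comm, hm']
    exact lt_irrefl 0

lemma isStable_iff_of_lt (hX : IsCalabiYauThreefold f) (hZ : IsStabilityCondition X Z)
    (h : Complex.arg (Z (1, 0)) < Complex.arg (Z (0, 1))) : IsStable Z E ↔ IsSimplePure E := by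
  refine ⟨fun hs => ?_, hX.isStable_of_isSimplePure⟩
  have hp : IsPure E := (hX.isSemistable_iff_of_lt hZ h).1
    fun E' i hi h0 h1 => (hs.2 E' i hi h0 h1).le
  obtain ⟨r, F, s, hF, ⟨e⟩⟩ := hX.exists_iso_twoTerm E
  rw [hX.isPure_iff hF e] at hp
  rw [hX.isStable_iff hF e] at hs
  refine hX.isSimplePure_of_isPure hF e hp hs.1 fun c hc h0 h1 heq => ?_
  have := (arg_lt_iff_of_lt (hX.im_apply_one_zero_pos hZ) (hX.im_apply_zero_one_pos hZ)
    (d := (r, totalLength F)) h0 hs.1 h).1 (hs.2 c hc h0 h1)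
  exact this.ne heq.symm

lemma isSemistable_of_eq (hX : IsCalabiYauThreefold f) (hZ : IsStabilityCondition X Z)
    (h : Complex.arg (Z (1, 0)) = Complex.arg (Z (0, 1))) : IsSemistable Z E := by
  obtain ⟨r, F, s, hF, ⟨e⟩⟩ := hX.exists_iso_twoTerm E
  rw [hX.isSemistable_iff hF e]
  intro c hc h0 _
  exact (arg_eq_of_eq (hX.im_apply_one_zero_pos hZ) (hX.im_apply_zero_one_pos hZ)
    (d := (r, totalLength F)) h0 (hX.ne_zero_of_isSubclass hF hc h0) h).le

lemma isStable_iff_of_eq (hX : IsCalabiYauThreefold f) (hZ : IsStabilityCondition X Z)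
    (h : Complex.arg (Z (1, 0)) = Complex.arg (Z (0, 1))) : IsStable Z E ↔ IsSimplePure E := by
  refine ⟨fun hs => ?_, hX.isStable_of_isSimplePure⟩
  obtain ⟨r, F, s, hF, ⟨e⟩⟩ := hX.exists_iso_twoTerm E
  rw [hX.isStable_iff hF e] at hs
  have hno : ∀ c, IsSubclass s c → c ≠ 0 → ¬ c ≠ (r, totalLength F) := fun c hc h0 h1 =>
    (hs.2 c hc h0 h1).ne (arg_eq_of_eq (hX.im_apply_one_zero_pos hZ)
      (hX.im_apply_zero_one_pos hZ) (d := (r, totalLength F)) h0 hs.1 h)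
  refine hX.isSimplePure_of_isPure hF e ?_ hs.1 fun c hc h0 h1 => absurd h1 (hno c hc h0)
  by_contra! hp
  -- `F[-1]` is a proper nonzero subobject
  exact hno (0, totalLength F) isSubclass_zero_totalLength
      (fun h => hp.2 (congrArg Prod.snd h)) (fun h => hp.1 (congrArg Prod.fst h).symm)

/-- When `Z` gives the larger phase to `𝒪_X`, semistability is the slope inequality for all proper
subobjects. -/
lemma isSemistable_iff_of_gt (hX : IsCalabiYauThreefold f) (hZ : IsStabilityCondition X Z)
    (h : Complex.arg (Z (0, 1)) < Complex.arg (Z (1, 0))) (hF : IsCohZero F)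
    (e : E.obj ≅ twoTerm s) : IsSemistable Z E ↔ ∀ c, IsSubclass s c → c ≠ 0 →
      c ≠ (r, totalLength F) → c.1 * totalLength F ≤ c.2 * r := by
  rw [hX.isSemistable_iff hF e]
  refine forall_congr' fun c => forall_congr' fun hc => forall_congr' fun h0 =>
    imp_congr_right fun _ => ?_
  rw [← not_lt, arg_lt_iff_of_gt (hX.im_apply_one_zero_pos hZ) (hX.im_apply_zero_one_pos hZ)
    (c := (r, totalLength F)) (hX.ne_zero_of_isSubclass hF hc h0) h0 h, not_lt]
  dsimp only
  rw [mul_comm, mul_comm r]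

/-- When `Z` gives the larger phase to `𝒪_X`, stability is the strict slope inequality for all
proper subobjects. -/
lemma isStable_iff_of_gt (hX : IsCalabiYauThreefold f) (hZ : IsStabilityCondition X Z)
    (h : Complex.arg (Z (0, 1)) < Complex.arg (Z (1, 0))) (hF : IsCohZero F)
    (e : E.obj ≅ twoTerm s) : IsStable Z E ↔ (r, totalLength F) ≠ 0 ∧
      ∀ c, IsSubclass s c → c ≠ 0 → c ≠ (r, totalLength F) → c.1 * totalLength F < c.2 * r := by
  rw [hX.isStable_iff hF e]
  refine and_congr_right fun h0 => forall_congr' fun c => imp_congr_right fun _ =>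
    forall_congr' fun hc => imp_congr_right fun _ => ?_
  exact arg_lt_iff_of_gt (hX.im_apply_one_zero_pos hZ) (hX.im_apply_zero_one_pos hZ)
    (d := (r, totalLength F)) hc h0 h

lemma isSemistable_iff_isPure_or (hX : IsCalabiYauThreefold f) (hZ : IsStabilityCondition X Z)
    (h : Complex.arg (Z (0, 1)) < Complex.arg (Z (1, 0))) : IsSemistable Z E ↔ IsPure E ∨
      ∃ (r : ℕ) (F : X.Modules) (s : free X r ⟶ F), 0 < r ∧ ¬ IsZero F ∧ IsCohZero F ∧
        Nonempty (E.obj ≅ twoTerm s) ∧ IsSemistablePair f s := by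
  have := hX.isNoetherian
  constructor
  · intro hs
    obtain ⟨r, F, s, hF, ⟨e⟩⟩ := hX.exists_iso_twoTerm E
    have hF' := isCohZero_iff.1 hF
    rw [or_iff_not_imp_left, hX.isPure_iff hF e]
    intro hp
    push Not at hp
    rw [hX.isSemistable_iff_of_gt hZ h hF e, ← isSemistablePair_iff hX.scalars_bijective hF'
      (Nat.pos_of_ne_zero hp.1) (Nat.pos_of_ne_zero hp.2)] at hs
    exact ⟨r, F, s, Nat.pos_of_ne_zero hp.1, mt hF'.totalLength_eq_zero_iff.2 hp.2, hF, ⟨e⟩, hs⟩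
  · rintro (hp | ⟨r, F, s, hr, hz, hF, ⟨e⟩, hs⟩)
    · obtain ⟨r, F, s, hF, ⟨e⟩⟩ := hX.exists_iso_twoTerm E
      rw [hX.isPure_iff hF e] at hp
      rw [hX.isSemistable_iff_of_gt hZ h hF e]
      intro c hc _ _
      rw [(hX.mul_eq_zero_of_isSubclass hF hp hc).1]
      exact Nat.zero_le _
    · have hF' := isCohZero_iff.1 hF
      rwa [hX.isSemistable_iff_of_gt hZ h hF e, ← isSemistablePair_iff hX.scalars_bijective hF' hr
        (Nat.pos_of_ne_zero (mt hF'.totalLength_eq_zero_iff.1 hz))]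

lemma isStable_iff_isSimplePure_or (hX : IsCalabiYauThreefold f) (hZ : IsStabilityCondition X Z)
    (h : Complex.arg (Z (0, 1)) < Complex.arg (Z (1, 0))) : IsStable Z E ↔ IsSimplePure E ∨
      ∃ (r : ℕ) (F : X.Modules) (s : free X r ⟶ F), 0 < r ∧ ¬ IsZero F ∧ IsCohZero F ∧
        Nonempty (E.obj ≅ twoTerm s) ∧ IsStablePair f s := by
  have := hX.isNoetherian
  constructor
  · intro hs
    obtain ⟨r, F, s, hF, ⟨e⟩⟩ := hX.exists_iso_twoTerm E
    have hF' := isCohZero_iff.1 hF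
    rw [hX.isStable_iff_of_gt hZ h hF e] at hs
    by_cases hp : r = 0 ∨ totalLength F = 0
    · exact .inl (hX.isSimplePure_of_isPure hF e hp hs.1 fun c hc h0 h1 => (hs.2 c hc h0 h1).ne)
    · push Not at hp
      exact .inr ⟨r, F, s, Nat.pos_of_ne_zero hp.1, mt hF'.totalLength_eq_zero_iff.2 hp.2, hF, ⟨e⟩,
        (isStablePair_iff hX.scalars_bijective hF' (Nat.pos_of_ne_zero hp.1)
          (Nat.pos_of_ne_zero hp.2)).2 hs.2⟩
  · rintro (hp | ⟨r, F, s, hr, hz, hF, ⟨e⟩, hs⟩)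
    · exact hX.isStable_of_isSimplePure hp
    · have hF' := isCohZero_iff.1 hF
      rw [hX.isStable_iff_of_gt hZ h hF e]
      exact ⟨fun h => hr.ne' (congrArg Prod.fst h), (isStablePair_iff hX.scalars_bijective hF' hr
        (Nat.pos_of_ne_zero (mt hF'.totalLength_eq_zero_iff.1 hz))).1 hs⟩

end IsCalabiYauThreefold
end Stability

end BoundState

end

theorem proposition2p6 {X : Scheme.{0}} (f : X ⟶ Spec (.of ℂ))
    (hX : BoundState.IsCalabiYauThreefold f) [HasDerivedCategory.{w} X.Modules]
    (Zminus Zzero Zplus : ℤ × ℤ →+ ℂ)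
    (hminus : BoundState.IsStabilityCondition X Zminus)
    (hzero : BoundState.IsStabilityCondition X Zzero)
    (hplus : BoundState.IsStabilityCondition X Zplus)
    (hminus' : Complex.arg (Zminus (1, 0)) < Complex.arg (Zminus (0, 1)))
    (hzero' : Complex.arg (Zzero (1, 0)) = Complex.arg (Zzero (0, 1)))
    (hplus' : Complex.arg (Zplus (1, 0)) > Complex.arg (Zplus (0, 1)))
    (E : BoundState.Heart X) :
    ((BoundState.IsSemistable Zminus E ↔ BoundState.IsPure E) ∧
      (BoundState.IsStable Zminus E ↔ BoundState.IsSimplePure E)) ∧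
    (BoundState.IsSemistable Zzero E ∧
      (BoundState.IsStable Zzero E ↔ BoundState.IsSimplePure E)) ∧
    ((BoundState.IsSemistable Zplus E ↔
        BoundState.IsPure E ∨
          ∃ (r : ℕ) (F : X.Modules) (s : BoundState.free X r ⟶ F), 0 < r ∧ ¬ IsZero F ∧
            BoundState.IsCohZero F ∧ Nonempty (E.obj ≅ BoundState.twoTerm s) ∧
            BoundState.IsSemistablePair f s) ∧
      (BoundState.IsStable Zplus E ↔
        BoundState.IsSimplePure E ∨
          ∃ (r : ℕ) (F : X.Modules) (s : BoundState.free X r ⟶ F), 0 < r ∧ ¬ IsZero F ∧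
            BoundState.IsCohZero F ∧ Nonempty (E.obj ≅ BoundState.twoTerm s) ∧
            BoundState.IsStablePair f s)) := by
  exact ⟨⟨hX.isSemistable_iff_of_lt hminus hminus', hX.isStable_iff_of_lt hminus hminus'⟩,
    ⟨hX.isSemistable_of_eq hzero hzero', hX.isStable_iff_of_eq hzero hzero'⟩,
    hX.isSemistable_iff_isPure_or hplus hplus', hX.isStable_iff_isSimplePure_or hplus hplus'⟩
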